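/- For $p>0$ and points $x_1,\dots,x_n,y_1,\dots,y_n\in\mathbb R^d$ let $$M_p\big(\{x_1,\dots,x_n\},\{y_1,\dots,y_n\}\big)=\min_{\sigma}\sum_{i=1}^n|x_i-y_{\sigma(i)}|^p ,$$ where $|\cdot|$ is the Euclidean norm and the minimum runs over all permutations $\sigma$ of $\{1,\dots,n\}$. **Theorem.** Let $d\ge 1$ be an integer and $0<2p<d$. There are constants $\beta_p(d)>0$ and $\beta'_p(d)>0$, depending only on $p$ and $d$, with the following property. Let $\mu$ be a probability measure on $\mathbb R^d$ such that $\int|x|^\alpha\,d\mu(x)<\infty$ for some $\alpha>\frac{4dp}{d-2p}$, and let $f$ be the density (with respect to Lebesgue measure) of the absolutely continuous part of $\mu$. Then $\int_{\mathbb R^d} f^{1-p/d}<\infty$. Let moreover $(X_i)_{i\ge1}$ and $(Y_j)_{j\ge1}$ be random variables with law $\mu$, all mutually independent. Then, almost surely, $$\limsup_{n\to\infty} n^{\frac pd-1}M_p\big(\{X_1,\dots,X_n\},\{Y_1,\dots,Y_n\}\big)\le\beta_p(d)\int_{\mathbb R^d} f^{1-\frac pd},$$ $$\liminf_{n\to\infty}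 n^{\frac pd-1}M_p\big(\{X_1,\dots,X_n\},\{Y_1,\dots,Y_n\}\big)\ge\beta'_p(d)\int_{\mathbb R^d} f^{1-\frac pd}.$$ Moreover, with the same constant $\beta_p(d)$, almost surely $$\lim_{n\to\infty} n^{\frac pd-1}M_p\big(\{X_1,\dots,X_n\},\{Y_1,\dots,Y_n\}\big)=\beta_p(d)\int_{\mathbb R^d} f^{1-\frac pd}$$ provided that one of the following hypotheses holds: - $\mu$ is the uniform distribution on a bounded Lebesgue measurable set $S\subset\mathbb R^d$ of positive Lebesgue measure; - either $d\in\{1,2\}$ and $0<p<d/2$, or $d\ge3$ and $0<p\le1$; and $f=c\,\mathbf 1_S$ almost everywhere for some constant $c\ge0$ and some bounded Lebesgue measurable set $S\subset\mathbb R^d$ of positive Lebesgue measure (the singular part of $\mu$ being arbitrary). -/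

import Mathlib

open MeasureTheory ProbabilityTheory Filter Topology
open scoped ENNReal NNReal

/-- The cost `M_p(x, y)` of the minimal bipartite matching of the multisets `{x_1, …, x_n}` and
`{y_1, …, y_n}` of points of `ℝ^d`, for the cost `|x - y| ^ p` (Euclidean norm). The infimum runs
over the finite nonempty set of all permutations of the indices, hence it is a minimum. -/
noncomputable def matchingCost {d n : ℕ} (p : ℝ) (x y : Fin n → EuclideanSpace ℝ (Fin d)) : ℝ :=
  ⨅ σ : Equiv.Perm (Fin n), ∑ i, ‖x i - y (σ i)‖ ^ p

/-- The normalized matching cost `n ^ (p / d - 1) * M_p({X_1, …, X_n}, {Y_1, …, Y_n})` of the first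
`n` points of two sequences (indexed from `0`), seen as an element of `[0, ∞]`. -/
noncomputable def scaledMatchingCost {d : ℕ} (p : ℝ) (X Y : ℕ → EuclideanSpace ℝ (Fin d))
    (n : ℕ) : ℝ≥0∞ :=
  ENNReal.ofReal ((n : ℝ) ^ (p / d - 1) *
    matchingCost p (fun i : Fin n => X i) (fun i : Fin n => Y i))

/-- The integral over `ℝ^d` of `f ^ (1 - p / d)`, where `f` is the density of the absolutely
continuous part of `μ` with respect to Lebesgue measure. -/
noncomputable def densityPowerIntegral {d : ℕ} (p : ℝ) (μ : Measure (EuclideanSpace ℝ (Fin d))) :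
    ℝ≥0∞ :=
  ∫⁻ x, (μ.rnDeriv volume x) ^ (1 - p / d) ∂volume

/-! Matchings are relaxed to partial matchings, in which a point may stay unmatched at a penalty
(`pmCost`). This cost is subadditive over disjoint regions. With a constant penalty it is Lipschitz
in the points. If the penalties of `x` and `y` together dominate `c x y`, raising the penalties
costs only the new penalty times the discrepancy between the two numbers of points
(`pmCost_le_add_gap`). With penalties `(2‖x‖)^p` the partial cost bounds the cost of perfect
matchings.

The engine is `exists_hierarchical_bound`. Match inside cubes of side `t`, then match the leftovers
inside cubes of side `2t`, `4t`, and so on. At side `s`, a region of volume `V` meets about `V/s^d`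
cubes, and sampling fluctuations leave about `√(nV/s^d)` points, each costing about `s^p`. The total
`√(nV) s^(p-d/2)` decreases geometrically in `s` because `2p < d`, so only the scale `n^(-1/d)`
matters.

Upper bound. Splitting the unit cube gives approximate subadditivity, so the scaled mean cost of
uniform points converges to some `β` (`exists_tendsto_cubeCost`). A density on a bounded set is
nearly constant, in `L¹`, on cubes of side `r n^(-1/d)`. Each such cube behaves like a uniform one,
and `r → ∞` yields `β ∫ f^(1-p/d)`. A compact null set has thickenings of small volume, so its
points cost nothing in the limit. The moment condition controls distant shells. These combine in
`limsup_regionCost_le`.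

Lower bound. A point pays at least the distance to its nearest neighbour. Lebesgue density points
and Fatou's lemma give the constant `exp (-v)`, with `v` the volume of the unit ball
(`le_liminf_regionCost`), and this also shows `β > 0`. If the density is constant on `S`, put `S` in
a cube `K`. The limit for `K` is known and `K \ S` obeys the sharp upper bound, so by subadditivity
`S` obeys the sharp lower bound. When `p ≤ 1` a four-point inequality shows that deleting the points
of the singular part raises the cost by at most their own, negligible, cost.

Almost sure statements. The cost truncated at `n^q` changes by `O(n^q)` when one point moves, so
McDiarmid's inequality and Borel–Cantelli reduce everything to means. The moment condition makes the
truncation inactive for large `n`. -/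

/-! ### Partial matchings of multisets with penalties. -/

section PartialMatching

variable {α β : Type*}

/-- The least cost of a partial matching of the multisets `A` and `B`, where matching `x` with `y`
costs `c x y`, and leaving `x` or `y` unmatched costs `a x` or `b y`. -/
noncomputable def pmCost (c : α → β → ℝ≥0∞) (a : α → ℝ≥0∞) (b : β → ℝ≥0∞)
    (A : Multiset α) (B : Multiset β) : ℝ≥0∞ :=
  ⨅ (M : Multiset (α × β)) (U : Multiset α) (V : Multiset β)
    (_ : M.map Prod.fst + U = A) (_ : M.map Prod.snd + V = B),
    (M.map fun e => c e.1 e.2).sum + (U.map a).sum + (V.map b).sum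

variable {c c' : α → β → ℝ≥0∞} {a a' : α → ℝ≥0∞} {b b' : β → ℝ≥0∞}
  {A A' : Multiset α} {B B' : Multiset β}

theorem pmCost_le (M : Multiset (α × β)) (U : Multiset α) (V : Multiset β)
    (hA : M.map Prod.fst + U = A) (hB : M.map Prod.snd + V = B) :
    pmCost c a b A B ≤ (M.map fun e => c e.1 e.2).sum + (U.map a).sum + (V.map b).sum :=
  iInf_le_of_le M <| iInf_le_of_le U <| iInf_le_of_le V <| iInf_le_of_le hA <| iInf_le _ hB

theorem le_pmCost {r : ℝ≥0∞}
    (h : ∀ (M : Multiset (α × β)) (U : Multiset α) (V : Multiset β),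
      M.map Prod.fst + U = A → M.map Prod.snd + V = B →
      r ≤ (M.map fun e => c e.1 e.2).sum + (U.map a).sum + (V.map b).sum) :
    r ≤ pmCost c a b A B :=
  le_iInf fun M => le_iInf fun U => le_iInf fun V => le_iInf fun hA => le_iInf fun hB =>
    h M U V hA hB

theorem pmCost_le_unmatched : pmCost c a b A B ≤ (A.map a).sum + (B.map b).sum := by
  simpa using pmCost_le (c := c) (a := a) (b := b) 0 A B (by simp) (by simp)

@[simp] theorem pmCost_zero : pmCost c a b 0 0 = 0 := by
  simpa using pmCost_le_unmatched (c := c) (a := a) (b := b) (A := 0) (B := 0)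

theorem pmCost_mono (hc : ∀ x ∈ A, ∀ y ∈ B, c x y ≤ c' x y) (ha : ∀ x ∈ A, a x ≤ a' x)
    (hb : ∀ y ∈ B, b y ≤ b' y) : pmCost c a b A B ≤ pmCost c' a' b' A B := by
  refine le_pmCost fun M U V hA hB => (pmCost_le M U V hA hB).trans ?_
  subst hA hB
  gcongr ?_ + ?_ + ?_
  · refine Multiset.sum_map_le_sum_map _ _ fun e he => hc _ ?_ _ ?_
    · exact Multiset.mem_add.2 (Or.inl (Multiset.mem_map_of_mem _ he))
    · exact Multiset.mem_add.2 (Or.inl (Multiset.mem_map_of_mem _ he))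
  · exact Multiset.sum_map_le_sum_map _ _ fun e he => ha _ (Multiset.mem_add.2 (Or.inr he))
  · exact Multiset.sum_map_le_sum_map _ _ fun e he => hb _ (Multiset.mem_add.2 (Or.inr he))

theorem pmCost_congr (hc : ∀ x ∈ A, ∀ y ∈ B, c x y = c' x y) (ha : ∀ x ∈ A, a x = a' x)
    (hb : ∀ y ∈ B, b y = b' y) : pmCost c a b A B = pmCost c' a' b' A B :=
  le_antisymm (pmCost_mono (fun x hx y hy => (hc x hx y hy).le) (fun x hx => (ha x hx).le)
    fun y hy => (hb y hy).le) (pmCost_mono (fun x hx y hy => (hc x hx y hy).ge)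
    (fun x hx => (ha x hx).ge) fun y hy => (hb y hy).ge)

/-- Partial matchings of the two pieces can be put side by side. Every splitting into regions below
rests on this subadditivity. -/
theorem pmCost_add_le :
    pmCost c a b (A + A') (B + B') ≤ pmCost c a b A B + pmCost c a b A' B' := by
  rw [pmCost.eq_1 c a b A B, pmCost.eq_1 c a b A' B']
  simp only [ENNReal.iInf_add, ENNReal.add_iInf]
  refine le_iInf fun M => le_iInf fun U => le_iInf fun V => le_iInf fun hA => le_iInf fun hB =>
    le_iInf fun M' => le_iInf fun U' => le_iInf fun V' => le_iInf fun hA' => le_iInf fun hB' => ?_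
  subst hA hB hA' hB'
  refine (pmCost_le (M' + M) (U' + U) (V' + V) ?_ ?_).trans (le_of_eq ?_)
  · simp only [Multiset.map_add]; abel
  · simp only [Multiset.map_add]; abel
  · simp only [Multiset.map_add, Multiset.sum_add]; abel

theorem pmCost_swap_le : pmCost (fun y x => c x y) b a B A ≤ pmCost c a b A B := by
  refine le_pmCost fun M U V hA hB => ?_
  refine (pmCost_le (M.map Prod.swap) V U ?_ ?_).trans (le_of_eq ?_)
  · simpa [Multiset.map_map] using hB
  · simpa [Multiset.map_map] using hA
  · simp only [Multiset.map_map, Function.comp_def, Prod.fst_swap, Prod.snd_swap]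
    rw [add_right_comm]

theorem pmCost_swap : pmCost (fun y x => c x y) b a B A = pmCost c a b A B :=
  le_antisymm pmCost_swap_le pmCost_swap_le

theorem pmCost_map_le {α' β' : Type*} (e : α' → α) (e' : β' → β) (A : Multiset α')
    (B : Multiset β') :
    pmCost c a b (A.map e) (B.map e') ≤
      pmCost (fun x y => c (e x) (e' y)) (fun x => a (e x)) (fun y => b (e' y)) A B := by
  refine le_pmCost fun M U V hA hB => ?_
  subst hA hB
  refine (pmCost_le (M.map (Prod.map e e')) (U.map e) (V.map e') ?_ ?_).trans (le_of_eq ?_)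
  · simp [Multiset.map_map]
  · simp [Multiset.map_map]
  · simp [Multiset.map_map]

/-- Injections have left inverses, so the converse inequality is `pmCost_map_le` applied to these.
Empty index types are treated apart because `Function.invFun` needs a point. -/
theorem pmCost_map {α' β' : Type*} {e : α' → α} {e' : β' → β} (he : e.Injective)
    (he' : e'.Injective) (A : Multiset α') (B : Multiset β') :
    pmCost c a b (A.map e) (B.map e') =
      pmCost (fun x y => c (e x) (e' y)) (fun x => a (e x)) (fun y => b (e' y)) A B := by
  refine le_antisymm (pmCost_map_le e e' A B) ?_
  rcases isEmpty_or_nonempty α' with hα | hα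
  · have hA : A = 0 := Multiset.eq_zero_of_forall_notMem fun x => hα.elim x
    subst hA
    rcases isEmpty_or_nonempty β' with hβ | hβ
    · have hB : B = 0 := Multiset.eq_zero_of_forall_notMem fun x => hβ.elim x
      subst hB
      simp
    · refine le_pmCost fun M U V hU hV => ?_
      simp only [Multiset.map_zero, add_eq_zero] at hU
      obtain ⟨h1, rfl⟩ := hU
      rw [Multiset.map_eq_zero] at h1
      subst h1
      simp only [Multiset.map_zero, zero_add] at hV
      subst hV
      refine (pmCost_le_unmatched).trans (le_of_eq ?_)
      simp [Multiset.map_map]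
  rcases isEmpty_or_nonempty β' with hβ | hβ
  · have hB : B = 0 := Multiset.eq_zero_of_forall_notMem fun x => hβ.elim x
    subst hB
    refine le_pmCost fun M U V hU hV => ?_
    simp only [Multiset.map_zero, add_eq_zero] at hV
    obtain ⟨h1, rfl⟩ := hV
    rw [Multiset.map_eq_zero] at h1
    subst h1
    simp only [Multiset.map_zero, zero_add] at hU
    subst hU
    refine (pmCost_le_unmatched).trans (le_of_eq ?_)
    simp [Multiset.map_map]
  · have hg := Function.leftInverse_invFun he
    have hg' := Function.leftInverse_invFun he'
    have h := pmCost_map_le (c := fun x y => c (e x) (e' y)) (a := fun x => a (e x))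
      (b := fun y => b (e' y)) (Function.invFun e) (Function.invFun e') (A.map e) (B.map e')
    rw [Multiset.map_map, Multiset.map_map, hg.comp_eq_id, hg'.comp_eq_id, Multiset.map_id,
      Multiset.map_id] at h
    refine h.trans (le_of_eq (pmCost_congr ?_ ?_ ?_))
    · intro x hx y hy
      obtain ⟨x, -, rfl⟩ := Multiset.mem_map.1 hx
      obtain ⟨y, -, rfl⟩ := Multiset.mem_map.1 hy
      simp only [hg x, hg' y]
    · intro x hx
      obtain ⟨x, -, rfl⟩ := Multiset.mem_map.1 hx
      simp only [hg x]
    · intro y hy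
      obtain ⟨y, -, rfl⟩ := Multiset.mem_map.1 hy
      simp only [hg' y]

/-- Removing a point costs at most the penalty. -/
theorem pmCost_le_cons_left {D : ℝ≥0∞} (hb : ∀ y ∈ B, b y ≤ D) (x : α) :
    pmCost c a b A B ≤ pmCost c a b (x ::ₘ A) B + D := by
  rw [pmCost.eq_1 c a b (x ::ₘ A)]
  simp only [ENNReal.iInf_add]
  refine le_iInf fun M => le_iInf fun U => le_iInf fun V => le_iInf fun hA => le_iInf fun hB => ?_
  have hx : x ∈ M.map Prod.fst + U := hA ▸ Multiset.mem_cons_self x A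
  -- If `x` was matched, its partner becomes unmatched and pays at most `D`; if it was unmatched, it
  -- is simply dropped.
  rcases Multiset.mem_add.1 hx with hx | hx
  · obtain ⟨⟨x', y⟩, he, rfl⟩ := Multiset.mem_map.1 hx
    obtain ⟨M, rfl⟩ := Multiset.exists_cons_of_mem he
    simp only [Multiset.map_cons, Multiset.cons_add, Multiset.cons_inj_right] at hA
    have hy : b y ≤ D := hb y (by rw [← hB]; simp)
    refine (pmCost_le M U (y ::ₘ V) hA ?_).trans ?_
    · rw [← hB]; simp
    · simp only [Multiset.map_cons, Multiset.sum_cons]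
      calc _ = (M.map fun e => c e.1 e.2).sum + (U.map a).sum + (V.map b).sum + b y := by ring
        _ ≤ (c x' y + (M.map fun e => c e.1 e.2).sum) + (U.map a).sum + (V.map b).sum + D := by
          gcongr; exact le_add_self
  · obtain ⟨U, rfl⟩ := Multiset.exists_cons_of_mem hx
    simp only [Multiset.add_cons, Multiset.cons_inj_right] at hA
    refine (pmCost_le M U V hA hB).trans ?_
    simp only [Multiset.map_cons, Multiset.sum_cons]
    refine le_add_right ?_
    gcongr
    exact le_add_self

theorem pmCost_le_cons_right {D : ℝ≥0∞} (ha : ∀ x ∈ A, a x ≤ D) (y : β) :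
    pmCost c a b A B ≤ pmCost c a b A (y ::ₘ B) + D := by
  rw [← pmCost_swap, ← pmCost_swap (B := y ::ₘ B)]
  exact pmCost_le_cons_left ha y

/-- The extra points are removed one at a time, each at the price `D`. With `pmCost_add_le_add`,
which adds points by leaving them unmatched, this is the Lipschitz property for a constant penalty.
-/
theorem pmCost_le_add {D : ℝ≥0∞} :
    pmCost c (fun _ => D) (fun _ => D) A B ≤ pmCost c (fun _ => D) (fun _ => D) (A' + A) (B' + B)
      + D * (A'.card + B'.card) := by
  have h1 : ∀ A' : Multiset α, pmCost c (fun _ => D) (fun _ => D) A B ≤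
      pmCost c (fun _ => D) (fun _ => D) (A' + A) B + D * A'.card := by
    intro A'
    induction A' using Multiset.induction_on with
    | empty => simp
    | cons x A' ih =>
      refine ih.trans ?_
      rw [Multiset.card_cons, Nat.cast_add, Nat.cast_one, mul_add, mul_one, add_comm (D * _),
        ← add_assoc, Multiset.cons_add]
      gcongr
      exact pmCost_le_cons_left (by simp) x
  have h2 : ∀ (A : Multiset α) (B' : Multiset β), pmCost c (fun _ => D) (fun _ => D) A B ≤
      pmCost c (fun _ => D) (fun _ => D) A (B' + B) + D * B'.card := by
    intro A B'
    induction B' using Multiset.induction_on with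
    | empty => simp
    | cons x B' ih =>
      refine ih.trans ?_
      rw [Multiset.card_cons, Nat.cast_add, Nat.cast_one, mul_add, mul_one, add_comm (D * _),
        ← add_assoc, Multiset.cons_add]
      gcongr
      exact pmCost_le_cons_right (by simp) x
  calc _ ≤ _ := h1 A'
    _ ≤ _ := add_le_add_left (h2 (A' + A) B') _
    _ = _ := by ring

theorem pmCost_add_le_add {D : ℝ≥0∞} :
    pmCost c (fun _ => D) (fun _ => D) (A' + A) (B' + B) ≤ pmCost c (fun _ => D) (fun _ => D) A B
      + D * (A'.card + B'.card) := by
  rw [add_comm A', add_comm B']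
  refine pmCost_add_le.trans ?_
  gcongr
  refine pmCost_le_unmatched.trans (le_of_eq ?_)
  simp [mul_add, mul_comm]

/-- Any partial matching can be improved to one of maximal cardinality. -/
theorem exists_maximal_matching (M : Multiset (α × β)) (U : Multiset α) (V : Multiset β)
    (hA : M.map Prod.fst + U = A) (hB : M.map Prod.snd + V = B)
    (hc : ∀ x ∈ A, ∀ y ∈ B, c x y ≤ a x + b y) :
    ∃ (M' : Multiset (α × β)) (U' : Multiset α) (V' : Multiset β),
      M'.map Prod.fst + U' = A ∧ M'.map Prod.snd + V' = B ∧ (U' = 0 ∨ V' = 0) ∧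
      (M'.map fun e => c e.1 e.2).sum + (U'.map a).sum + (V'.map b).sum ≤
      (M.map fun e => c e.1 e.2).sum + (U.map a).sum + (V.map b).sum := by
  induction U using Multiset.induction_on generalizing M V with
  | empty => exact ⟨M, 0, V, hA, hB, Or.inl rfl, le_rfl⟩
  | cons u U ih =>
    rcases V.empty_or_exists_mem with rfl | ⟨v, hv⟩
    · exact ⟨M, u ::ₘ U, 0, hA, hB, Or.inr rfl, le_rfl⟩
    obtain ⟨V, rfl⟩ := Multiset.exists_cons_of_mem hv
    -- As long as both sides have an unmatched point, pairing two of them does not raise the cost,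
    -- by `hc`.
    obtain ⟨M', U', V', h1, h2, h3, h4⟩ := ih ((u, v) ::ₘ M) V (by rw [← hA]; simp)
      (by rw [← hB]; simp)
    refine ⟨M', U', V', h1, h2, h3, h4.trans ?_⟩
    have huv := hc u (by rw [← hA]; simp) v (by rw [← hB]; simp)
    simp only [Multiset.map_cons, Multiset.sum_cons]
    calc _ ≤ (a u + b v) + (M.map fun e => c e.1 e.2).sum + (U.map a).sum + (V.map b).sum := by
          gcongr
      _ = _ := by ring

/-- The absolute difference of two natural numbers, as an extended nonnegative real. -/
noncomputable def gap (k l : ℕ) : ℝ≥0∞ := ENNReal.ofReal |(k : ℝ) - l|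

theorem gap_comm (k l : ℕ) : gap k l = gap l k := by rw [gap, gap, abs_sub_comm]

@[simp] theorem gap_add_left (k l : ℕ) : gap (k + l) l = k := by
  simp [gap]

@[simp] theorem gap_add_right (k l : ℕ) : gap l (k + l) = k := by
  simp [gap]

/-- Raising the penalties costs at most the new penalty times the discrepancy. -/
theorem pmCost_le_add_gap {D : ℝ≥0∞} (hc : ∀ x ∈ A, ∀ y ∈ B, c x y ≤ a x + b y)
    (ha : ∀ x ∈ A, a' x ≤ D) (hb : ∀ y ∈ B, b' y ≤ D) :
    pmCost c a' b' A B ≤ pmCost c a b A B + D * gap A.card B.card := by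
  rw [pmCost.eq_1 c a b]
  simp only [ENNReal.iInf_add]
  refine le_iInf fun M => le_iInf fun U => le_iInf fun V => le_iInf fun hA => le_iInf fun hB => ?_
  -- In a matching of maximal cardinality only one side has leftovers, and their number is exactly
  -- the gap. Only these feel the new penalties.
  obtain ⟨M', U', V', h1, h2, h3, h4⟩ := exists_maximal_matching M U V hA hB hc
  refine (pmCost_le M' U' V' h1 h2).trans ?_
  refine le_trans ?_ (add_le_add_left h4 _)
  subst h1 h2
  have e1 : (U'.map a').sum ≤ D * U'.card := by
    refine (Multiset.sum_map_le_sum_map _ (fun _ => D) fun x hx => ha x (by simp [hx])).trans ?_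
    simp [mul_comm]
  have e2 : (V'.map b').sum ≤ D * V'.card := by
    refine (Multiset.sum_map_le_sum_map _ (fun _ => D) fun x hx => hb x (by simp [hx])).trans ?_
    simp [mul_comm]
  rcases h3 with rfl | rfl
  · simp only [Multiset.card_add, Multiset.card_map, add_zero,
      Multiset.map_zero, Multiset.sum_zero]
    rw [add_comm M'.card, gap_add_right]
    gcongr
    exact le_self_add
  · simp only [Multiset.card_add, Multiset.card_map, add_zero,
      Multiset.map_zero, Multiset.sum_zero]
    rw [add_comm M'.card, gap_add_left]
    gcongr
    exact le_self_add

/-- A lower bound of the matching cost by the sum of nearest neighbour costs. -/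
theorem sum_le_pmCost {g : α → ℝ≥0∞} (hc : ∀ x ∈ A, ∀ y ∈ B, g x ≤ c x y)
    (ha : ∀ x ∈ A, g x ≤ a x) : (A.map g).sum ≤ pmCost c a b A B := by
  refine le_pmCost fun M U V hA hB => ?_
  subst hA hB
  rw [Multiset.map_add, Multiset.sum_add, Multiset.map_map]
  refine le_add_right (add_le_add ?_ ?_)
  · refine Multiset.sum_map_le_sum_map _ _ fun e he => hc _ ?_ _ ?_
    · exact Multiset.mem_add.2 (Or.inl (Multiset.mem_map_of_mem _ he))
    · exact Multiset.mem_add.2 (Or.inl (Multiset.mem_map_of_mem _ he))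
  · exact Multiset.sum_map_le_sum_map _ _ fun e he => ha _ (Multiset.mem_add.2 (Or.inr he))

/-- For a cost with the four-point inequality, removing a pair costs at most the cost of the
pair. -/
theorem pmCost_le_cons_cons {D : ℝ≥0∞} (hc : ∀ x y x' y', c x y ≤ c x y' + c x' y' + c x' y)
    (x : α) (y : β) :
    pmCost c (fun _ => D) (fun _ => D) A B ≤
      pmCost c (fun _ => D) (fun _ => D) (x ::ₘ A) (y ::ₘ B) + c x y := by
  rw [pmCost.eq_1 c _ _ (x ::ₘ A)]
  simp only [ENNReal.iInf_add]
  refine le_iInf fun M => le_iInf fun U => le_iInf fun V => le_iInf fun hA => le_iInf fun hB => ?_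
  have hx : x ∈ M.map Prod.fst + U := hA ▸ Multiset.mem_cons_self x A
  have hy : y ∈ M.map Prod.snd + V := hB ▸ Multiset.mem_cons_self y B
  rcases Multiset.mem_add.1 hx with hx | hx
  · obtain ⟨⟨x', y₀⟩, he, rfl⟩ := Multiset.mem_map.1 hx
    obtain ⟨M, rfl⟩ := Multiset.exists_cons_of_mem he
    simp only [Multiset.map_cons, Multiset.cons_add, Multiset.cons_inj_right] at hA
    rcases Multiset.mem_add.1 hy with hy | hy
    · simp only [Multiset.map_cons, Multiset.mem_cons] at hy
      rcases hy with rfl | hy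
      · simp only [Multiset.map_cons, Multiset.cons_add, Multiset.cons_inj_right] at hB
        refine (pmCost_le M U V hA hB).trans (le_add_right ?_)
        simp only [Multiset.map_cons, Multiset.sum_cons]
        gcongr
        exact le_add_self
      · obtain ⟨⟨x₀, y'⟩, he', rfl⟩ := Multiset.mem_map.1 hy
        obtain ⟨M, rfl⟩ := Multiset.exists_cons_of_mem he'
        -- The removed `x'` and `y'` leave their partners `y₀` and `x₀` alone. These are matched
        -- together, and the four-point inequality bounds the new pair by the two old pairs and `c
        -- x' y'`.
        refine (pmCost_le ((x₀, y₀) ::ₘ M) U V (by rw [← hA]; simp) ?_).trans ?_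
        · simp only [Multiset.map_cons, Multiset.cons_add] at hB ⊢
          rwa [Multiset.cons_swap, Multiset.cons_inj_right] at hB
        · simp only [Multiset.map_cons, Multiset.sum_cons]
          calc _ ≤ (c x₀ y' + c x' y' + c x' y₀) + (M.map fun e => c e.1 e.2).sum +
                (U.map fun _ => D).sum + (V.map fun _ => D).sum := by gcongr; exact hc _ _ _ _
            _ = _ := by ring
    · obtain ⟨V, rfl⟩ := Multiset.exists_cons_of_mem hy
      simp only [Multiset.map_cons, Multiset.add_cons, Multiset.cons_inj_right] at hB
      -- Here `y` was unmatched: its penalty now pays for the abandoned partner `y₀`.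
      refine (pmCost_le M U (y₀ ::ₘ V) hA (by rw [← hB]; simp)).trans (le_add_right ?_)
      simp only [Multiset.map_cons, Multiset.sum_cons]
      gcongr
      exact le_add_self
  · obtain ⟨U, rfl⟩ := Multiset.exists_cons_of_mem hx
    simp only [Multiset.add_cons, Multiset.cons_inj_right] at hA
    rcases Multiset.mem_add.1 hy with hy | hy
    · obtain ⟨⟨x₀, y'⟩, he', rfl⟩ := Multiset.mem_map.1 hy
      obtain ⟨M, rfl⟩ := Multiset.exists_cons_of_mem he'
      simp only [Multiset.map_cons, Multiset.cons_add, Multiset.cons_inj_right] at hB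
      refine (pmCost_le M (x₀ ::ₘ U) V (by rw [← hA]; simp) hB).trans (le_add_right ?_)
      simp only [Multiset.map_cons, Multiset.sum_cons]
      gcongr
      exact le_add_self
    · obtain ⟨V, rfl⟩ := Multiset.exists_cons_of_mem hy
      simp only [Multiset.add_cons, Multiset.cons_inj_right] at hB
      refine (pmCost_le M U V hA hB).trans (le_add_right ?_)
      simp only [Multiset.map_cons, Multiset.sum_cons]
      gcongr
      · exact le_add_self
      · exact le_add_self

/-- Given any partial matching of `A'` with `B'`, its pairs are deleted by `pmCost_le_cons_cons` and
its unmatched points by `pmCost_le_add`; the total price is the cost of that matching. This makes it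
possible to cut away the points of the singular part. -/
theorem pmCost_le_add_add {D : ℝ≥0∞} (hc : ∀ x y x' y', c x y ≤ c x y' + c x' y' + c x' y) :
    pmCost c (fun _ => D) (fun _ => D) A B ≤
      pmCost c (fun _ => D) (fun _ => D) (A' + A) (B' + B) +
        pmCost c (fun _ => D) (fun _ => D) A' B' := by
  rw [pmCost.eq_1 c _ _ A' B']
  simp only [ENNReal.add_iInf]
  refine le_iInf fun M => le_iInf fun U => le_iInf fun V => le_iInf fun hA => le_iInf fun hB => ?_
  subst hA hB
  have h : pmCost c (fun _ => D) (fun _ => D) A B ≤ pmCost c (fun _ => D) (fun _ => D)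
      (M.map Prod.fst + A) (M.map Prod.snd + B) + (M.map fun e => c e.1 e.2).sum := by
    induction M using Multiset.induction_on with
    | empty => simp
    | cons e M ih =>
      refine ih.trans ?_
      simp only [Multiset.map_cons, Multiset.sum_cons, Multiset.cons_add]
      rw [← add_assoc]
      gcongr
      exact pmCost_le_cons_cons hc _ _
  refine h.trans ?_
  calc _ ≤ pmCost c (fun _ => D) (fun _ => D) (U + (M.map Prod.fst + A))
        (V + (M.map Prod.snd + B)) + D * (U.card + V.card) + _ := add_le_add_left pmCost_le_add _
    _ = _ := by
      rw [← add_assoc U, ← add_assoc V, add_comm U, add_comm V]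
      simp only [Multiset.map_const', Multiset.sum_replicate, nsmul_eq_mul]
      ring

end PartialMatching

/-! ### Partial matchings and permutations. -/

section Permutations

theorem pmCost_univ_le_perm {n : ℕ} {c : Fin n → Fin n → ℝ≥0∞} {a b : Fin n → ℝ≥0∞}
    (σ : Equiv.Perm (Fin n)) :
    pmCost c a b Finset.univ.val Finset.univ.val ≤ ∑ i, c i (σ i) := by
  refine (pmCost_le (Finset.univ.val.map fun i => (i, σ i)) 0 0 ?_ ?_).trans (le_of_eq ?_)
  · rw [Multiset.map_map, add_zero]
    exact Multiset.map_id _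
  · rw [Multiset.map_map, add_zero]
    have : Prod.snd ∘ (fun i => (i, σ i)) = σ := rfl
    rw [this]
    simp
  · simp only [Multiset.map_map, Multiset.map_zero, Multiset.sum_zero, add_zero]
    rfl

/-- A partial matching improves to one with no leftovers on one side, hence on neither, both sides
having `n` points. Its pairs then form the graph of a permutation. -/
theorem exists_perm_le_pmCost {n : ℕ} {c : Fin n → Fin n → ℝ≥0∞} {a b : Fin n → ℝ≥0∞}
    (hc : ∀ i j, c i j ≤ a i + b j) :
    ⨅ σ : Equiv.Perm (Fin n), ∑ i, c i (σ i) ≤ pmCost c a b Finset.univ.val Finset.univ.val := by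
  refine le_pmCost fun M U V hA hB => ?_
  obtain ⟨M, U, V, hA, hB, h0, hle⟩ := exists_maximal_matching M U V hA hB
    (fun i _ j _ => hc i j)
  refine le_trans ?_ hle
  have hcard : U.card = V.card := by
    have h1 := congrArg Multiset.card hA
    have h2 := congrArg Multiset.card hB
    simp only [Multiset.card_add, Multiset.card_map] at h1 h2
    omega
  have hUV : U = 0 ∧ V = 0 := by
    rcases h0 with rfl | rfl
    · exact ⟨rfl, Multiset.card_eq_zero.1 (by simpa using hcard.symm)⟩
    · exact ⟨Multiset.card_eq_zero.1 (by simpa using hcard), rfl⟩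
  obtain ⟨rfl, rfl⟩ := hUV
  rw [add_zero] at hA hB
  have hM : M.Nodup := Multiset.Nodup.of_map Prod.fst (hA ▸ Finset.univ.nodup)
  have hinj := Multiset.inj_on_of_nodup_map (f := Prod.fst) (hA ▸ Finset.univ.nodup)
  have hex : ∀ i : Fin n, ∃ j, (i, j) ∈ M := by
    intro i
    have : i ∈ M.map Prod.fst := hA ▸ Finset.mem_univ i
    obtain ⟨⟨i', j⟩, h, rfl⟩ := Multiset.mem_map.1 this
    exact ⟨j, h⟩
  choose σ hσ using hex
  have hMσ : M = Finset.univ.val.map fun i => (i, σ i) := by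
    refine (Multiset.Nodup.ext hM ?_).2 fun e => ?_
    · exact Finset.univ.nodup.map fun i j h => (Prod.mk.inj h).1
    · constructor
      · intro he
        refine Multiset.mem_map.2 ⟨e.1, Finset.mem_univ e.1, ?_⟩
        exact hinj _ (hσ e.1) _ he rfl
      · intro he
        obtain ⟨i, -, rfl⟩ := Multiset.mem_map.1 he
        exact hσ i
  have hσinj : Function.Injective σ := by
    have h : (Finset.univ.val.map σ).Nodup := by
      have : Finset.univ.val.map σ = Finset.univ.val := by
        calc Finset.univ.val.map σ = M.map Prod.snd := by
              conv_rhs => rw [hMσ, Multiset.map_map]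
              rfl
          _ = _ := hB
      rw [this]; exact Finset.univ.nodup
    intro i j hij
    exact Multiset.inj_on_of_nodup_map h i (Finset.mem_univ i) j (Finset.mem_univ j) hij
  let τ : Equiv.Perm (Fin n) := Equiv.ofBijective σ (Finite.injective_iff_bijective.1 hσinj)
  refine (iInf_le _ τ).trans ?_
  rw [hMσ, Multiset.map_map]
  simp only [Multiset.map_zero, Multiset.sum_zero, add_zero]
  exact le_of_eq rfl

theorem ofReal_matchingCost {d n : ℕ} {p : ℝ} (hp : 0 ≤ p)
    (x y : Fin n → EuclideanSpace ℝ (Fin d)) :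
    ENNReal.ofReal (matchingCost p x y) =
      ⨅ σ : Equiv.Perm (Fin n), ∑ i, edist (x i) (y (σ i)) ^ p := by
  rw [matchingCost, ENNReal.ofReal_iInf]
  refine iInf_congr fun σ => ?_
  rw [ENNReal.ofReal_sum_of_nonneg fun i _ => by positivity]
  refine Finset.sum_congr rfl fun i _ => ?_
  rw [edist_dist, dist_eq_norm, ENNReal.ofReal_rpow_of_nonneg (norm_nonneg _) hp]

end Permutations

/-! ### Matching the points of two samples that fall in a region. -/

section LocalCost

variable {E ι ι' : Type*} [Fintype ι] [Fintype ι']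

open Classical in
/-- The indices of the points of the family `x` lying in `S`. -/
noncomputable def idxIn (S : Set E) (x : ι → E) : Finset ι := Finset.univ.filter fun i => x i ∈ S

@[simp] theorem mem_idxIn {S : Set E} {x : ι → E} {i : ι} : i ∈ idxIn S x ↔ x i ∈ S := by
  simp [idxIn]

omit [Fintype ι'] in
theorem mem_idxIn_inl {S : Set E} {z : ι ⊕ ι' → E} {i : ι} :
    i ∈ (idxIn S fun i => z (Sum.inl i)).val ↔ z (Sum.inl i) ∈ S := mem_idxIn

omit [Fintype ι] in
theorem mem_idxIn_inr {S : Set E} {z : ι ⊕ ι' → E} {i : ι'} :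
    i ∈ (idxIn S fun i => z (Sum.inr i)).val ↔ z (Sum.inr i) ∈ S := mem_idxIn

@[simp] theorem idxIn_univ (x : ι → E) : idxIn Set.univ x = Finset.univ := by
  ext; simp

/-- The cost of an optimal partial matching between the points of the two families which lie
in `S`. -/
noncomputable def locCost (κ : E → E → ℝ≥0∞) (a : E → ℝ≥0∞) (S : Set E) (z : ι ⊕ ι' → E) : ℝ≥0∞ :=
  pmCost (fun i j => κ (z (Sum.inl i)) (z (Sum.inr j))) (fun i => a (z (Sum.inl i)))
    (fun j => a (z (Sum.inr j))) (idxIn S fun i => z (Sum.inl i)).val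
    (idxIn S fun j => z (Sum.inr j)).val

/-- The number of points of the first family in `S`. -/
noncomputable def numL (S : Set E) (z : ι ⊕ ι' → E) : ℕ := (idxIn S fun i => z (Sum.inl i)).card

/-- The number of points of the second family in `S`. -/
noncomputable def numR (S : Set E) (z : ι ⊕ ι' → E) : ℕ := (idxIn S fun j => z (Sum.inr j)).card

variable {κ κ' : E → E → ℝ≥0∞} {a a' : E → ℝ≥0∞} {S T : Set E} {z : ι ⊕ ι' → E}

theorem idxIn_union_val (hST : Disjoint S T) (x : ι → E) :
    (idxIn (S ∪ T) x).val = (idxIn S x).val + (idxIn T x).val := by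
  classical
  have hd : Disjoint (idxIn S x) (idxIn T x) := by
    rw [Finset.disjoint_left]
    intro i hi hj
    exact Set.disjoint_left.1 hST (mem_idxIn.1 hi) (mem_idxIn.1 hj)
  rw [show idxIn (S ∪ T) x = (idxIn S x).disjUnion (idxIn T x) hd by ext; simp]
  rfl

theorem locCost_union_le (hST : Disjoint S T) :
    locCost κ a (S ∪ T) z ≤ locCost κ a S z + locCost κ a T z := by
  rw [locCost, idxIn_union_val hST, idxIn_union_val hST]
  exact pmCost_add_le

theorem locCost_mono (hκ : ∀ x ∈ S, ∀ y ∈ S, κ x y ≤ κ' x y) (ha : ∀ x ∈ S, a x ≤ a' x) :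
    locCost κ a S z ≤ locCost κ' a' S z := by
  exact pmCost_mono
    (fun _ hi _ hj => hκ _ (mem_idxIn_inl.1 hi) _ (mem_idxIn_inr.1 hj))
    (fun i hi => ha _ (mem_idxIn_inl.1 hi))
    fun j hj => ha _ (mem_idxIn_inr.1 hj)

theorem locCost_congr_set (h : ∀ i, z i ∈ S ↔ z i ∈ T) : locCost κ a S z = locCost κ a T z := by
  have h1 : (idxIn S fun i => z (Sum.inl i)) = idxIn T fun i => z (Sum.inl i) := by ext; simp [h]
  have h2 : (idxIn S fun i => z (Sum.inr i)) = idxIn T fun i => z (Sum.inr i) := by ext; simp [h]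
  rw [locCost, h1, h2, locCost]

theorem locCost_eq_zero (h : ∀ i, z i ∉ S) : locCost κ a S z = 0 := by
  rw [locCost_congr_set (T := ∅) (by simpa using h), locCost]
  have h1 : (idxIn ∅ fun i => z (Sum.inl i)) = ∅ := by ext; simp
  have h2 : (idxIn ∅ fun i => z (Sum.inr i)) = ∅ := by ext; simp
  rw [h1, h2]
  exact pmCost_zero

/-- Points are matched separately in each fibre of `ℓ`. Only the finitely many labels of sample
points contribute, so finite subadditivity suffices. -/
theorem locCost_le_tsum {τ : Type*} (ℓ : E → τ) :
    locCost κ a S z ≤ ∑' k, locCost κ a (S ∩ ℓ ⁻¹' {k}) z := by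
  classical
  have key : ∀ F : Finset τ, locCost κ a (S ∩ ℓ ⁻¹' (F : Set τ)) z ≤
      ∑ k ∈ F, locCost κ a (S ∩ ℓ ⁻¹' {k}) z := by
    intro F
    induction F using Finset.induction_on with
    | empty => simp [locCost_eq_zero]
    | insert k F hk ih =>
      rw [Finset.sum_insert hk, Finset.coe_insert, Set.insert_eq, Set.preimage_union,
        Set.inter_union_distrib_left]
      refine (locCost_union_le ?_).trans (add_le_add_right ih _)
      rw [Set.disjoint_left]
      rintro x ⟨-, hx⟩ ⟨-, hx'⟩
      rw [Set.mem_preimage, Set.mem_singleton_iff] at hx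
      exact hk (by simpa [hx] using hx')
  refine (le_of_eq (locCost_congr_set fun i => ?_)).trans
    ((key (Finset.univ.image fun i => ℓ (z i))).trans (ENNReal.sum_le_tsum _))
  simp

theorem locCost_le_card {D : ℝ≥0∞} :
    locCost κ (fun _ => D) S z ≤ D * (numL S z + numR S z) := by
  refine pmCost_le_unmatched.trans (le_of_eq ?_)
  simp [numL, numR, mul_add, mul_comm]

theorem locCost_le_add_gap {D : ℝ≥0∞} (hκ : ∀ x ∈ S, ∀ y ∈ S, κ x y ≤ a x + a y)
    (ha : ∀ x ∈ S, a' x ≤ D) :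
    locCost κ a' S z ≤ locCost κ a S z + D * gap (numL S z) (numR S z) :=
  pmCost_le_add_gap
    (fun _ hi _ hj => hκ _ (mem_idxIn_inl.1 hi) _ (mem_idxIn_inr.1 hj))
    (fun _ hi => ha _ (mem_idxIn_inl.1 hi))
    fun _ hj => ha _ (mem_idxIn_inr.1 hj)

theorem locCost_le_add_of_triangle {D : ℝ≥0∞} (hST : Disjoint S T)
    (hκ : ∀ x y x' y', κ x y ≤ κ x y' + κ x' y' + κ x' y) :
    locCost κ (fun _ => D) S z ≤ locCost κ (fun _ => D) (T ∪ S) z + locCost κ (fun _ => D) T z := by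
  rw [locCost, locCost, locCost, idxIn_union_val hST.symm, idxIn_union_val hST.symm]
  exact pmCost_le_add_add fun _ _ _ _ => hκ _ _ _ _

omit [Fintype ι] in
theorem exists_val_eq_add_erase [DecidableEq ι] (A : Finset ι) (i : ι) :
    ∃ C : Multiset ι, A.val = C + (A.erase i).val ∧ C.card ≤ 1 := by
  by_cases hi : i ∈ A
  · refine ⟨{i}, ?_, by simp⟩
    rw [Finset.erase_val, Multiset.singleton_add, Multiset.cons_erase (show i ∈ A.val from hi)]
  · exact ⟨0, by rw [Finset.erase_eq_of_notMem hi]; simp, by simp⟩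

theorem locCost_swap : locCost (fun x y => κ y x) a S (z ∘ Sum.swap) = locCost κ a S z :=
  pmCost_swap (c := fun i j => κ (z (Sum.inl i)) (z (Sum.inr j)))

/-- Once the point of index `i` is erased the two configurations agree. Erasing it and putting the
other one back cost at most `D` each. This is the bounded-difference property used in McDiarmid's
inequality. -/
theorem locCost_le_update_inl [DecidableEq (ι ⊕ ι')] {D : ℝ≥0∞} (i : ι) (x : E) :
    locCost κ (fun _ => D) S z ≤
      locCost κ (fun _ => D) S (Function.update z (Sum.inl i) x) + 2 * D := by
  classical
  set z' := Function.update z (Sum.inl i) x with hz'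
  have e1 : (idxIn S fun j => z (Sum.inr j)) = idxIn S fun j => z' (Sum.inr j) := by
    ext; simp [hz']
  have e2 : (idxIn S fun j => z (Sum.inl j)).erase i =
      (idxIn S fun j => z' (Sum.inl j)).erase i := by
    ext j
    by_cases hj : j = i
    · simp [hj]
    · simp [hz', hj]
  obtain ⟨C, hC, hC1⟩ := exists_val_eq_add_erase (idxIn S fun j => z (Sum.inl j)) i
  obtain ⟨C', hC', hC1'⟩ := exists_val_eq_add_erase (idxIn S fun j => z' (Sum.inl j)) i
  have h1 : locCost κ (fun _ => D) S z ≤ pmCost (fun i j => κ (z (Sum.inl i)) (z (Sum.inr j)))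
      (fun _ => D) (fun _ => D) ((idxIn S fun j => z (Sum.inl j)).erase i).val
      (idxIn S fun j => z (Sum.inr j)).val + D := by
    rw [locCost, hC]
    have := pmCost_add_le_add (c := fun i j => κ (z (Sum.inl i)) (z (Sum.inr j))) (D := D)
      (A := ((idxIn S fun j => z (Sum.inl j)).erase i).val) (A' := C) (B' := 0)
      (B := (idxIn S fun j => z (Sum.inr j)).val)
    rw [zero_add] at this
    refine this.trans ?_
    gcongr
    calc _ ≤ D * ((1 : ℕ) + (0 : ℕ)) := by gcongr; simp
      _ = D := by simp
  have h2 : pmCost (fun i j => κ (z' (Sum.inl i)) (z' (Sum.inr j)))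
      (fun _ => D) (fun _ => D) ((idxIn S fun j => z' (Sum.inl j)).erase i).val
      (idxIn S fun j => z' (Sum.inr j)).val ≤ locCost κ (fun _ => D) S z' + D := by
    rw [locCost, hC']
    have := pmCost_le_add (c := fun i j => κ (z' (Sum.inl i)) (z' (Sum.inr j))) (D := D)
      (A := ((idxIn S fun j => z' (Sum.inl j)).erase i).val) (A' := C') (B' := 0)
      (B := (idxIn S fun j => z' (Sum.inr j)).val)
    rw [zero_add] at this
    refine this.trans ?_
    gcongr
    calc _ ≤ D * ((1 : ℕ) + (0 : ℕ)) := by gcongr; simp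
      _ = D := by simp
  have h3 : pmCost (fun i j => κ (z (Sum.inl i)) (z (Sum.inr j)))
      (fun _ => D) (fun _ => D) ((idxIn S fun j => z (Sum.inl j)).erase i).val
      (idxIn S fun j => z (Sum.inr j)).val = pmCost (fun i j => κ (z' (Sum.inl i))
      (z' (Sum.inr j))) (fun _ => D) (fun _ => D)
      ((idxIn S fun j => z' (Sum.inl j)).erase i).val (idxIn S fun j => z' (Sum.inr j)).val := by
    rw [e1, e2]
    refine pmCost_congr (fun j hj k _ => ?_) (fun _ _ => rfl) (fun _ _ => rfl)
    have hj : j ≠ i := (Finset.mem_erase.1 hj).1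
    simp [hz', hj]
  calc _ ≤ _ := h1
    _ ≤ locCost κ (fun _ => D) S z' + D + D := by rw [h3]; gcongr
    _ = _ := by ring

theorem locCost_le_update [DecidableEq (ι ⊕ ι')] {D : ℝ≥0∞} (i : ι ⊕ ι') (x : E) :
    locCost κ (fun _ => D) S z ≤ locCost κ (fun _ => D) S (Function.update z i x) + 2 * D := by
  classical
  rcases i with i | i
  · exact locCost_le_update_inl i x
  · rw [← locCost_swap, ← locCost_swap (z := Function.update z (Sum.inr i) x)]
    refine (locCost_le_update_inl i x).trans (le_of_eq ?_)
    congr 2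
    ext j
    rcases j with j | j <;> simp [Function.update_apply]

theorem measurable_multiset_sum_map {γ X : Type*} [MeasurableSpace X] {f : γ → X → ℝ≥0∞}
    (hf : ∀ g, Measurable (f g)) (M : Multiset γ) :
    Measurable fun z => (M.map fun g => f g z).sum := by
  induction M using Multiset.induction_on with
  | empty => simp
  | cons g M ih =>
    simp only [Multiset.map_cons, Multiset.sum_cons]
    exact (hf g).add ih

variable [MeasurableSpace E]

theorem measurable_pmCost (hκ : Measurable (Function.uncurry κ)) (ha : Measurable a)
    (A : Multiset ι) (B : Multiset ι') :
    Measurable fun z : ι ⊕ ι' → E => pmCost (fun i j => κ (z (Sum.inl i)) (z (Sum.inr j)))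
      (fun i => a (z (Sum.inl i))) (fun j => a (z (Sum.inr j))) A B := by
  have hκ' : ∀ (i : ι) (j : ι'), Measurable fun z : ι ⊕ ι' → E =>
      κ (z (Sum.inl i)) (z (Sum.inr j)) := fun i j =>
    hκ.comp (f := fun z : ι ⊕ ι' → E => (z (Sum.inl i), z (Sum.inr j)))
      ((measurable_pi_apply _).prodMk (measurable_pi_apply _))
  unfold pmCost
  refine .iInf fun M => .iInf fun U => .iInf fun V => .iInf fun _ => .iInf fun _ =>
    ((measurable_multiset_sum_map (fun e : ι × ι' => hκ' e.1 e.2) M).add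
      (measurable_multiset_sum_map (fun i => ha.comp (measurable_pi_apply (Sum.inl i))) U)).add
      (measurable_multiset_sum_map (fun j => ha.comp (measurable_pi_apply (Sum.inr j))) V)

theorem measurableSet_idxIn_eq (hS : MeasurableSet S) (A : Finset ι) :
    MeasurableSet {x : ι → E | idxIn S x = A} := by
  have : {x : ι → E | idxIn S x = A} = ⋂ i, {x | x i ∈ S ↔ i ∈ A} := by
    ext x
    simp [Finset.ext_iff]
  rw [this]
  refine MeasurableSet.iInter fun i => ?_
  by_cases hi : i ∈ A
  · simp only [hi, iff_true]
    exact measurable_pi_apply i hS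
  · simp only [hi, iff_false]
    exact (measurable_pi_apply (X := fun _ => E) i) hS.compl

theorem measurable_comp_idxIn {γ : Type*} [MeasurableSpace γ] (hS : MeasurableSet S)
    (f : Finset ι → γ) : Measurable fun x : ι → E => f (idxIn S x) := by
  let _ : MeasurableSpace (Finset ι) := ⊤
  have h : Measurable fun x : ι → E => idxIn S x :=
    measurable_to_countable' fun A => measurableSet_idxIn_eq hS A
  exact (measurable_from_top (f := f)).comp h

omit [Fintype ι'] in
theorem measurable_numL (hS : MeasurableSet S) : Measurable fun z : ι ⊕ ι' → E => numL S z :=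
  (measurable_comp_idxIn hS Finset.card).comp
    (measurable_pi_lambda (fun (z : ι ⊕ ι' → E) i => z (Sum.inl i)) fun _ => measurable_pi_apply _)

omit [Fintype ι] in
theorem measurable_numR (hS : MeasurableSet S) : Measurable fun z : ι ⊕ ι' → E => numR S z :=
  (measurable_comp_idxIn hS Finset.card).comp
    (measurable_pi_lambda (fun (z : ι ⊕ ι' → E) i => z (Sum.inr i)) fun _ => measurable_pi_apply _)

theorem measurableSet_idxIn_eq_eq (hS : MeasurableSet S) (A : Finset ι) (B : Finset ι') :
    MeasurableSet {z : ι ⊕ ι' → E | (idxIn S fun i => z (Sum.inl i)) = A ∧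
      (idxIn S fun i => z (Sum.inr i)) = B} := by
  refine MeasurableSet.inter ?_ ?_
  · exact (measurable_pi_lambda (fun (z : ι ⊕ ι' → E) i => z (Sum.inl i))
      fun _ => measurable_pi_apply _) (measurableSet_idxIn_eq hS A)
  · exact (measurable_pi_lambda (fun (z : ι ⊕ ι' → E) i => z (Sum.inr i))
      fun _ => measurable_pi_apply _) (measurableSet_idxIn_eq hS B)

/-- The sets of indices in `S` take finitely many values, and where they are fixed the cost is a
fixed `pmCost`, an infimum over countably many matchings. -/
theorem measurable_locCost (hκ : Measurable (Function.uncurry κ)) (ha : Measurable a)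
    (hS : MeasurableSet S) : Measurable fun z : ι ⊕ ι' → E => locCost κ a S z := by
  classical
  have h : (fun z : ι ⊕ ι' → E => locCost κ a S z) = fun z => ∑ A : Finset ι, ∑ B : Finset ι',
      Set.indicator {z : ι ⊕ ι' → E | (idxIn S fun i => z (Sum.inl i)) = A ∧
        (idxIn S fun i => z (Sum.inr i)) = B}
      (fun z => pmCost (fun i j => κ (z (Sum.inl i)) (z (Sum.inr j)))
        (fun i => a (z (Sum.inl i))) (fun j => a (z (Sum.inr j))) A.val B.val) z := by
    ext z
    rw [Finset.sum_eq_single (idxIn S fun i => z (Sum.inl i)),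
      Finset.sum_eq_single (idxIn S fun i => z (Sum.inr i))]
    · simp [locCost]
    · intro B _ hB
      exact Set.indicator_of_notMem (fun h => hB h.2.symm) _
    · simp
    · intro A _ hA
      exact Finset.sum_eq_zero fun B _ => Set.indicator_of_notMem (fun h => hA h.1.symm) _
    · simp
  rw [h]
  exact Finset.measurable_sum _ fun A _ => Finset.measurable_sum _ fun B _ =>
    (measurable_pmCost hκ ha _ _).indicator (measurableSet_idxIn_eq_eq hS A B)

end LocalCost

/-! ### Product measures and conditioning on the number of points. -/

section ProductMeasures

variable {E ι ι' : Type*} [MeasurableSpace E] [Fintype ι] [Fintype ι']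

/-- The coordinates outside the range of `e` contribute only their total masses. The measures need
not be normalised, since the intended use is with restrictions to `S` or to its complement. -/
theorem pi_map_comp_injective (ρ : ι → Measure E) [∀ i, IsFiniteMeasure (ρ i)] {e : ι' → ι}
    (he : e.Injective) (ν : ι' → Measure E) [_hν : ∀ j, IsProbabilityMeasure (ν j)]
    (h : ∀ j, ρ (e j) = ρ (e j) Set.univ • ν j) :
    (Measure.pi ρ).map (fun z j => z (e j)) = (∏ i, ρ i Set.univ) • Measure.pi ν := by
  classical
  by_cases h0 : ∏ i, ρ i Set.univ = 0
  · have : Measure.pi ρ = 0 := by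
      rw [← Measure.measure_univ_eq_zero, Measure.pi_univ, h0]
    rw [h0, this, Measure.map_zero, zero_smul]
  have hne : ∀ i, ρ i Set.univ ≠ 0 := fun i hi =>
    h0 (Finset.prod_eq_zero (Finset.mem_univ i) hi)
  let ρ' : ι → Measure E := fun i => (ρ i Set.univ)⁻¹ • ρ i
  have hprob : ∀ i, IsProbabilityMeasure (ρ' i) := fun i => ⟨by
    simp only [ρ', Measure.smul_apply, smul_eq_mul]
    exact ENNReal.inv_mul_cancel (hne i) (measure_ne_top _ _)⟩
  have hpi : Measure.pi ρ = (∏ i, ρ i Set.univ) • Measure.pi ρ' := by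
    refine Measure.pi_eq fun s _ => ?_
    rw [Measure.smul_apply, Measure.pi_pi, smul_eq_mul, ← Finset.prod_mul_distrib]
    refine Finset.prod_congr rfl fun i _ => ?_
    simp only [ρ', Measure.smul_apply, smul_eq_mul]
    rw [← mul_assoc, ENNReal.mul_inv_cancel (hne i) (measure_ne_top _ _), one_mul]
  have hν : ∀ j, ρ' (e j) = ν j := by
    intro j
    simp only [ρ']
    conv_lhs => rw [h j]
    rw [smul_smul]
    have : ρ (e j) Set.univ • ν j = ρ (e j) := (h j).symm
    rw [show (ρ (e j) Set.univ • ν j) Set.univ = ρ (e j) Set.univ by rw [this],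
      ENNReal.inv_mul_cancel (hne _) (measure_ne_top _ _), one_smul]
  have hind : iIndepFun (fun (i : ι) (z : ι → E) => z i) (Measure.pi ρ') :=
    iIndepFun_pi (X := fun _ x => x) fun _ => aemeasurable_id
  have := (iIndepFun_iff_map_fun_eq_pi_map
    fun j => (measurable_pi_apply (X := fun _ => E) (e j)).aemeasurable).1 (hind.precomp he)
  rw [hpi, Measure.map_smul, this]
  congr 2
  ext1 j
  rw [← hν j]
  exact (measurePreserving_eval ρ' (e j)).map_eq

variable {κ : E → E → ℝ≥0∞} {a : E → ℝ≥0∞} {S : Set E}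

/-- The expected cost of an optimal partial matching between `k` and `l` independent points with
law `ν`. -/
noncomputable def meanCost (κ : E → E → ℝ≥0∞) (a : E → ℝ≥0∞) (ν : Measure E) (k l : ℕ) : ℝ≥0∞ :=
  ∫⁻ z : Fin k ⊕ Fin l → E, locCost κ a Set.univ z ∂Measure.pi fun _ => ν

theorem map_equivFin_symm_val {γ : Type*} (A : Finset γ) :
    (Finset.univ.val.map fun i => (A.equivFin.symm i : γ)) = A.val := by
  have h1 : (Finset.univ.val.map fun i => A.equivFin.symm i) = (Finset.univ : Finset A).val := by
    have := congrArg Finset.val (Finset.map_univ_equiv A.equivFin.symm)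
    rwa [Finset.map_val] at this
  calc _ = ((Finset.univ.val.map fun i => A.equivFin.symm i).map Subtype.val) := by
        rw [Multiset.map_map]; rfl
    _ = A.val := by rw [h1]; exact Multiset.attach_map_val A.val

omit [MeasurableSpace E] [Fintype ι] [Fintype ι'] in
theorem locCost_comp_sumMap {ι₁ ι₁' : Type*} [Fintype ι₁] [Fintype ι₁'] {e : ι₁ → ι}
    {e' : ι₁' → ι'} (he : e.Injective) (he' : e'.Injective) (z : ι ⊕ ι' → E) :
    locCost κ a Set.univ (fun j => z (Sum.map e e' j)) =
      pmCost (fun i j => κ (z (Sum.inl i)) (z (Sum.inr j))) (fun i => a (z (Sum.inl i)))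
        (fun j => a (z (Sum.inr j))) (Finset.univ.val.map e) (Finset.univ.val.map e') := by
  rw [pmCost_map he he', locCost, idxIn_univ, idxIn_univ]
  rfl

/-- The event is a box with sides `S` or `Sᶜ`. Restricted to it the product measure stays a product,
whose marginal on the indices in `A` and `B` is a multiple of the product of the conditional law on
`S`. -/
theorem setLIntegral_pmCost (hκ : Measurable (Function.uncurry κ)) (ha : Measurable a)
    (μ : Measure E) [IsProbabilityMeasure μ] (A : Finset ι)
    (B : Finset ι') :
    ∫⁻ z in {z : ι ⊕ ι' → E | (idxIn S fun i => z (Sum.inl i)) = A ∧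
      (idxIn S fun i => z (Sum.inr i)) = B},
      pmCost (fun i j => κ (z (Sum.inl i)) (z (Sum.inr j))) (fun i => a (z (Sum.inl i)))
        (fun j => a (z (Sum.inr j))) A.val B.val ∂(Measure.pi fun _ => μ) =
    meanCost κ a (μ[|S]) A.card B.card *
      (Measure.pi fun _ => μ) {z : ι ⊕ ι' → E | (idxIn S fun i => z (Sum.inl i)) = A ∧
      (idxIn S fun i => z (Sum.inr i)) = B} := by
  classical
  let s : ι ⊕ ι' → Set E := Sum.elim (fun i => if i ∈ A then S else Sᶜ)
    fun i => if i ∈ B then S else Sᶜ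
  have hbox : {z : ι ⊕ ι' → E | (idxIn S fun i => z (Sum.inl i)) = A ∧
      (idxIn S fun i => z (Sum.inr i)) = B} = Set.univ.pi s := by
    ext z
    simp only [Set.mem_ofPred_eq, Finset.ext_iff, mem_idxIn, Set.mem_univ_pi, Sum.forall, s,
      Sum.elim_inl, Sum.elim_inr]
    refine and_congr (forall_congr' fun i => ?_) (forall_congr' fun i => ?_)
    · by_cases hi : i ∈ A <;> simp [hi]
    · by_cases hi : i ∈ B <;> simp [hi]
  rw [hbox]
  by_cases h0 : (Measure.pi fun _ => μ) (Set.univ.pi s) = 0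
  · rw [h0, mul_zero, setLIntegral_measure_zero _ _ h0]
  have hne : ∀ i, μ (s i) ≠ 0 := by
    rw [Measure.pi_pi] at h0
    exact fun i hi => h0 (Finset.prod_eq_zero (Finset.mem_univ i) hi)
  rw [Measure.restrict_pi_pi]
  let e : Fin A.card → ι := fun i => A.equivFin.symm i
  let e' : Fin B.card → ι' := fun i => B.equivFin.symm i
  have he : e.Injective := Subtype.val_injective.comp A.equivFin.symm.injective
  have he' : e'.Injective := Subtype.val_injective.comp B.equivFin.symm.injective
  have hs : ∀ j, s (Sum.map e e' j) = S := by
    rintro (j | j)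
    · simp [s, e]
    · simp [s, e']
  have hprob : ∀ _ : Fin A.card ⊕ Fin B.card, IsProbabilityMeasure (μ[|S]) := fun j =>
    cond_isProbabilityMeasure (hs j ▸ hne _)
  have hmap := pi_map_comp_injective (fun i => μ.restrict (s i)) (he.sumMap he')
    (fun _ => μ[|S]) (_hν := hprob) fun j => by
      rw [hs, Measure.restrict_apply_univ, ProbabilityTheory.cond, smul_smul,
        ENNReal.mul_inv_cancel (hs j ▸ hne _) (measure_ne_top _ _), one_smul]
  have hm : Measurable fun (z : ι ⊕ ι' → E) j => z (Sum.map e e' j) :=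
    measurable_pi_lambda _ fun _ => measurable_pi_apply _
  calc _ = ∫⁻ z : ι ⊕ ι' → E, locCost κ a Set.univ (fun j => z (Sum.map e e' j))
        ∂(Measure.pi fun i => μ.restrict (s i)) := by
        refine lintegral_congr fun z => ?_
        rw [locCost_comp_sumMap he he', map_equivFin_symm_val, map_equivFin_symm_val]
    _ = ∫⁻ w, locCost κ a Set.univ w ∂(Measure.pi fun i => μ.restrict (s i)).map
          fun z j => z (Sum.map e e' j) :=
        (lintegral_map (measurable_locCost hκ ha .univ) hm).symm
    _ = _ := by
      rw [hmap, lintegral_smul_measure, meanCost, smul_eq_mul, mul_comm, Measure.pi_pi]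
      simp

theorem lintegral_comp_num (hS : MeasurableSet S) (μ : Measure (ι ⊕ ι' → E))
    (f : (ι ⊕ ι' → E) → ℝ≥0∞) :
    ∫⁻ z, f z ∂μ = ∑ A : Finset ι, ∑ B : Finset ι',
      ∫⁻ z in {z : ι ⊕ ι' → E | (idxIn S fun i => z (Sum.inl i)) = A ∧
      (idxIn S fun i => z (Sum.inr i)) = B}, f z ∂μ := by
  classical
  rw [← Fintype.sum_prod_type', ← lintegral_biUnion_finset]
  · rw [← setLIntegral_univ]
    congr 2
    refine (Set.eq_univ_of_forall fun z => ?_).symm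
    simp
  · intro p _ q _ hpq
    refine Set.disjoint_left.2 ?_
    rintro z ⟨h1, h2⟩ ⟨h3, h4⟩
    exact hpq (Prod.ext (h1.symm.trans h3) (h2.symm.trans h4))
  · exact fun p _ => measurableSet_idxIn_eq_eq hS p.1 p.2

/-- Conditionally on their numbers, the points which fall in `S` are independent with the
conditional law. -/
theorem lintegral_locCost (hκ : Measurable (Function.uncurry κ)) (ha : Measurable a)
    (hS : MeasurableSet S) (μ : Measure E) [IsProbabilityMeasure μ] :
    ∫⁻ z : ι ⊕ ι' → E, locCost κ a S z ∂(Measure.pi fun _ => μ) =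
      ∫⁻ z : ι ⊕ ι' → E, meanCost κ a (μ[|S]) (numL S z) (numR S z) ∂(Measure.pi fun _ => μ) := by
  rw [lintegral_comp_num hS, lintegral_comp_num hS _ fun z : ι ⊕ ι' → E => meanCost _ _ _ _ _]
  refine Finset.sum_congr rfl fun A _ => Finset.sum_congr rfl fun B _ => ?_
  have hms := measurableSet_idxIn_eq_eq hS A B
  rw [setLIntegral_congr_fun (g := fun z : ι ⊕ ι' → E => pmCost (fun i j => κ (z (Sum.inl i))
    (z (Sum.inr j))) (fun i => a (z (Sum.inl i))) (fun j => a (z (Sum.inr j))) A.val B.val) hms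
    (by rintro z ⟨rfl, rfl⟩; rfl), setLIntegral_pmCost hκ ha,
    setLIntegral_congr_fun (g := fun _ => meanCost κ a (μ[|S]) A.card B.card) hms
    (by rintro z ⟨rfl, rfl⟩; rfl), setLIntegral_const]

/-- The expected matching cost is Lipschitz in the numbers of points. -/
theorem meanCost_le_add_gap {D : ℝ≥0∞} (hκ : Measurable (Function.uncurry κ)) (ν : Measure E)
    [IsProbabilityMeasure ν] (k l k' l' : ℕ) :
    meanCost κ (fun _ => D) ν k l ≤ meanCost κ (fun _ => D) ν k' l' + D * (gap k k' + gap l l') := by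
  -- Coupling: samples of all sizes up to `N` are realised as the first points of one pair of
  -- samples of size `N`.
  have key : ∀ {k l N : ℕ} (hk : k ≤ N) (hl : l ≤ N), meanCost κ (fun _ => D) ν k l =
      ∫⁻ z : Fin N ⊕ Fin N → E, pmCost (fun i j => κ (z (Sum.inl i)) (z (Sum.inr j)))
        (fun _ => D) (fun _ => D) (Finset.univ.val.map (Fin.castLE hk))
        (Finset.univ.val.map (Fin.castLE hl)) ∂Measure.pi fun _ => ν := by
    intro k l N hk hl
    have he := Fin.castLE_injective hk
    have he' := Fin.castLE_injective hl
    have hmap := pi_map_comp_injective (fun _ => ν) (he.sumMap he') (fun _ => ν) (by simp)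
    simp only [measure_univ, Finset.prod_const_one, one_smul] at hmap
    have hm : Measurable fun (z : Fin N ⊕ Fin N → E) j => z (Sum.map (Fin.castLE hk)
      (Fin.castLE hl) j) := measurable_pi_lambda _ fun _ => measurable_pi_apply _
    rw [meanCost, ← hmap, lintegral_map (measurable_locCost hκ measurable_const .univ) hm]
    refine lintegral_congr fun z => ?_
    rw [locCost_comp_sumMap he he']
  -- Two initial segments are equalised by padding the shorter one, with as many points as the gap.
  have hsub : ∀ {k k' N : ℕ} (hk : k ≤ N) (hk' : k' ≤ N), ∃ C C' : Multiset (Fin N),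
      C + Finset.univ.val.map (Fin.castLE hk) = C' + Finset.univ.val.map (Fin.castLE hk') ∧
      (C.card : ℝ≥0∞) + C'.card = gap k k' := by
    have hsub' : ∀ {k k' N : ℕ} (hk : k ≤ N) (hk' : k' ≤ N), k ≤ k' → ∃ C : Multiset (Fin N),
        C + Finset.univ.val.map (Fin.castLE hk) = Finset.univ.val.map (Fin.castLE hk') ∧
        (C.card : ℝ≥0∞) = gap k k' := by
      intro k k' N hk hk' hkk
      have hle : Finset.univ.val.map (Fin.castLE hk) ≤ Finset.univ.val.map (Fin.castLE hk') := by
        rw [Multiset.le_iff_subset (Finset.univ.nodup.map (Fin.castLE_injective hk))]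
        intro i hi
        obtain ⟨j, -, rfl⟩ := Multiset.mem_map.1 hi
        exact Multiset.mem_map.2 ⟨Fin.castLE hkk j, Finset.mem_univ (Fin.castLE hkk j), rfl⟩
      obtain ⟨C, hC⟩ := Multiset.le_iff_exists_add.1 hle
      refine ⟨C, by rw [hC, add_comm], ?_⟩
      have h := congrArg Multiset.card hC
      simp only [Multiset.card_map, Multiset.card_add, Finset.card_val, Finset.card_univ,
        Fintype.card_fin] at h
      rw [h, add_comm k, gap_add_right]
    intro k k' N hk hk'
    rcases le_total k k' with h | h
    · obtain ⟨C, h1, h2⟩ := hsub' hk hk' h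
      exact ⟨C, 0, by rw [h1, zero_add], by simpa using h2⟩
    · obtain ⟨C, h1, h2⟩ := hsub' hk' hk h
      exact ⟨0, C, by rw [h1, zero_add], by rw [gap_comm]; simpa using h2⟩
  have hk : k ≤ k + l + k' + l' := by omega
  have hl : l ≤ k + l + k' + l' := by omega
  have hk' : k' ≤ k + l + k' + l' := by omega
  have hl' : l' ≤ k + l + k' + l' := by omega
  rw [key hk hl, key hk' hl']
  have hconst : D * (gap k k' + gap l l') = ∫⁻ _ : Fin (k + l + k' + l') ⊕ Fin (k + l + k' + l') → E,
      D * (gap k k' + gap l l') ∂Measure.pi fun _ => ν := by simp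
  rw [hconst, ← lintegral_add_right _ measurable_const]
  refine lintegral_mono fun z => ?_
  obtain ⟨C, C', h1, h2⟩ := hsub hk hk'
  obtain ⟨F, F', h3, h4⟩ := hsub hl hl'
  refine (pmCost_le_add (A' := C) (B' := F)).trans ?_
  rw [h1, h3]
  refine (add_le_add_left pmCost_add_le_add _).trans (le_of_eq ?_)
  rw [← h2, ← h4]
  ring

end ProductMeasures

/-! ### Fluctuations of the numbers of points. -/

section Fluctuations

variable {E ι ι' : Type*} [MeasurableSpace E] [Fintype ι] [Fintype ι']

theorem lintegral_abs_sub_integral_le {Ω : Type*} [MeasurableSpace Ω] {P : Measure Ω}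
    [IsProbabilityMeasure P] {X : Ω → ℝ} (hX : MemLp X 2 P) :
    ∫⁻ ω, ENNReal.ofReal |X ω - ∫ x, X x ∂P| ∂P ≤ ENNReal.ofReal (√ Var[X; P]) := by
  have hX' : MemLp (fun ω => X ω - ∫ x, X x ∂P) 2 P := hX.sub (memLp_const _)
  have h1 : ∫⁻ ω, ENNReal.ofReal |X ω - ∫ x, X x ∂P| ∂P =
      eLpNorm (fun ω => X ω - ∫ x, X x ∂P) 1 P := by
    rw [eLpNorm_one_eq_lintegral_enorm]
    exact lintegral_congr fun ω => by rw [Real.enorm_eq_ofReal_abs]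
  have h2 : eLpNorm (fun ω => X ω - ∫ x, X x ∂P) 2 P = ENNReal.ofReal (√ Var[X; P]) := by
    rw [eLpNorm_eq_lintegral_rpow_enorm_toReal (by simp) (by simp), Real.sqrt_eq_rpow,
      ← ENNReal.ofReal_rpow_of_nonneg (variance_nonneg _ _) (by norm_num),
      hX.ofReal_variance_eq, evariance]
    norm_num
  rw [h1, ← h2]
  exact eLpNorm_le_eLpNorm_of_exponent_le (by norm_num) hX'.aestronglyMeasurable

/-- The variance of a sum of independent indicators is at most its mean, and the `L¹` deviation is
at most the `L²` one. -/
theorem lintegral_abs_sum_indicator_le (μ : Measure E) [IsProbabilityMeasure μ] {S : Set E}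
    (hS : MeasurableSet S) (A : Finset ι) :
    ∫⁻ z : ι → E, ENNReal.ofReal |∑ i ∈ A, S.indicator (fun _ => (1 : ℝ)) (z i) -
      A.card * μ.real S| ∂(Measure.pi fun _ => μ) ≤ ENNReal.ofReal (√ (A.card * μ.real S)) := by
  classical
  let X : ι → E → ℝ := fun i => if i ∈ A then S.indicator fun _ => (1 : ℝ) else 0
  have hm1 : MemLp (S.indicator fun _ => (1 : ℝ)) 2 μ := memLp_indicator_const 2 hS 1 (by simp)
  have hm : ∀ i, MemLp (X i) 2 μ := by
    intro i
    by_cases hi : i ∈ A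
    · simpa [X, hi] using hm1
    · simp [X, hi]
  have hm' : ∀ i, MemLp (fun z : ι → E => X i (z i)) 2 (Measure.pi fun _ => μ) := fun i =>
    (hm i).comp_measurePreserving (measurePreserving_eval (fun _ => μ) i)
  have hsum : ∀ z : ι → E, (∑ i, fun z : ι → E => X i (z i)) z =
      ∑ i ∈ A, S.indicator (fun _ => (1 : ℝ)) (z i) := by
    intro z
    rw [Finset.sum_apply, ← Finset.sum_filter_add_sum_filter_not _ (· ∈ A)]
    rw [Finset.sum_eq_zero (s := Finset.univ.filter fun i => ¬ i ∈ A), add_zero]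
    · refine Finset.sum_congr (by ext; simp) fun i hi => ?_
      simp [X, hi]
    · intro i hi
      simp [X, (Finset.mem_filter.1 hi).2]
  have hmean : ∫ z, (∑ i, fun z : ι → E => X i (z i)) z ∂(Measure.pi fun _ => μ) =
      A.card * μ.real S := by
    simp only [hsum]
    rw [integral_finsetSum]
    · have : ∀ i ∈ A, ∫ z : ι → E, S.indicator (fun _ => (1 : ℝ)) (z i) ∂(Measure.pi fun _ => μ) =
          μ.real S := by
        intro i _
        have h := (measurePreserving_eval (fun _ : ι => μ) i).map_eq
        calc _ = ∫ x, S.indicator (fun _ => (1 : ℝ)) x ∂((Measure.pi fun _ => μ).map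
              (Function.eval i)) := by
              rw [integral_map (measurable_pi_apply i).aemeasurable
                (measurable_const.indicator hS).aestronglyMeasurable]
          _ = _ := by rw [h, integral_indicator_const _ hS]; simp
      rw [Finset.sum_congr rfl this]
      simp
    · intro i hi
      have := (hm' i).integrable (by norm_num)
      simpa [X, hi] using this
  have hvar : Var[∑ i, fun z : ι → E => X i (z i); Measure.pi fun _ => μ] ≤ A.card * μ.real S := by
    rw [variance_sum_pi hm]
    calc ∑ i, Var[X i; μ] ≤ ∑ i, if i ∈ A then μ.real S else 0 := by
          refine Finset.sum_le_sum fun i _ => ?_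
          by_cases hi : i ∈ A
          · simp only [X, hi, if_true]
            refine (variance_le_expectation_sq hm1.aestronglyMeasurable).trans (le_of_eq ?_)
            have : (S.indicator fun _ => (1 : ℝ)) ^ 2 = S.indicator fun _ => (1 : ℝ) := by
              ext x
              by_cases hx : x ∈ S <;> simp [hx]
            rw [this, integral_indicator_const _ hS]
            simp
          · simp [X, hi]
      _ = _ := by simp
  have h := lintegral_abs_sub_integral_le (memLp_finsetSum' Finset.univ fun i _ => hm' i)
  rw [hmean] at h
  simp only [hsum] at h
  exact h.trans (ENNReal.ofReal_le_ofReal (Real.sqrt_le_sqrt hvar))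

theorem lintegral_abs_numL_sub_le (μ : Measure E) [IsProbabilityMeasure μ] {S : Set E}
    (hS : MeasurableSet S) :
    ∫⁻ z : ι ⊕ ι' → E, ENNReal.ofReal |numL S z - Fintype.card ι * μ.real S|
      ∂(Measure.pi fun _ => μ) ≤ ENNReal.ofReal (√ (Fintype.card ι * μ.real S)) := by
  classical
  have h := lintegral_abs_sum_indicator_le (ι := ι ⊕ ι') μ hS (Finset.univ.map .inl)
  simp only [Finset.card_map, Finset.card_univ, Finset.sum_map] at h
  refine (le_of_eq (lintegral_congr fun z => ?_)).trans h
  congr 3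
  simp [numL, idxIn, Set.indicator_apply]

theorem lintegral_abs_numR_sub_le (μ : Measure E) [IsProbabilityMeasure μ] {S : Set E}
    (hS : MeasurableSet S) :
    ∫⁻ z : ι ⊕ ι' → E, ENNReal.ofReal |numR S z - Fintype.card ι' * μ.real S|
      ∂(Measure.pi fun _ => μ) ≤ ENNReal.ofReal (√ (Fintype.card ι' * μ.real S)) := by
  classical
  have h := lintegral_abs_sum_indicator_le (ι := ι ⊕ ι') μ hS (Finset.univ.map .inr)
  simp only [Finset.card_map, Finset.card_univ, Finset.sum_map] at h
  refine (le_of_eq (lintegral_congr fun z => ?_)).trans h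
  congr 3
  simp [numR, idxIn, Set.indicator_apply]

/-- The expected discrepancy between the numbers of points of two samples. -/
theorem lintegral_gap_le (n : ℕ) (μ : Measure E) [IsProbabilityMeasure μ] {S : Set E}
    (hS : MeasurableSet S) :
    ∫⁻ z : Fin n ⊕ Fin n → E, gap (numL S z) (numR S z) ∂(Measure.pi fun _ => μ) ≤
      2 * ENNReal.ofReal (√ (n * μ.real S)) := by
  have h1 := lintegral_abs_numL_sub_le (ι := Fin n) (ι' := Fin n) μ hS
  have h2 := lintegral_abs_numR_sub_le (ι := Fin n) (ι' := Fin n) μ hS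
  rw [Fintype.card_fin] at h1 h2
  rw [two_mul]
  refine le_trans ?_ (add_le_add h1 h2)
  rw [← lintegral_add_left]
  · refine lintegral_mono fun z => ?_
    rw [← ENNReal.ofReal_add (abs_nonneg _) (abs_nonneg _), gap]
    refine ENNReal.ofReal_le_ofReal ?_
    rw [abs_sub_comm (numR S z : ℝ)]
    exact abs_sub_le _ _ _
  · have := measurable_numL (ι := Fin n) (ι' := Fin n) hS
    exact (((measurable_from_top (f := fun k : ℕ => (k : ℝ))).comp this).sub_const _).norm.ennreal_ofReal

end Fluctuations

/-! ### Functions with bounded differences: change of law and concentration. -/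

section BoundedDifferences

variable {E ι : Type*} [MeasurableSpace E]

/-- Both laws have mass one, so the infimum of `g` may be subtracted. What remains lies between `0`
and `C`, and only the mass of `ρ` is lost. -/
theorem lintegral_le_of_le_add {ν ν' ρ : Measure E} [IsProbabilityMeasure ν]
    [IsProbabilityMeasure ν'] (h : ν ≤ ν' + ρ) {C : ℝ≥0∞} {g : E → ℝ≥0∞}
    (hC : ∀ x y, g x ≤ g y + C) : ∫⁻ x, g x ∂ν ≤ ∫⁻ x, g x ∂ν' + C * ρ Set.univ := by
  set m := ⨅ x, g x with hm
  have hmg : ∀ x, m ≤ g x := fun x => iInf_le _ _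
  have hgm : ∀ x, g x ≤ m + C := fun x => by
    rw [hm, ENNReal.iInf_add]
    exact le_iInf fun y => hC x y
  have e : ∀ (τ : Measure E) [IsProbabilityMeasure τ], ∫⁻ x, g x ∂τ = m + ∫⁻ x, (g x - m) ∂τ := by
    intro τ _
    have : m = ∫⁻ _, m ∂τ := by simp
    conv_rhs => rw [this]
    rw [← lintegral_add_left measurable_const]
    refine lintegral_congr fun x => ?_
    rw [← this, add_tsub_cancel_of_le (hmg x)]
  rw [e ν, e ν', add_assoc]
  gcongr
  calc ∫⁻ x, (g x - m) ∂ν ≤ ∫⁻ x, (g x - m) ∂(ν' + ρ) := lintegral_mono' h le_rfl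
    _ = ∫⁻ x, (g x - m) ∂ν' + ∫⁻ x, (g x - m) ∂ρ := lintegral_add_measure _ _ _
    _ ≤ ∫⁻ x, (g x - m) ∂ν' + ∫⁻ _, C ∂ρ := by
      gcongr with x
      exact tsub_le_iff_left.2 (hgm x)
    _ = _ := by rw [lintegral_const]

/-- Averaging over other coordinates keeps the difference bound in coordinate `i`, since both sides
use the same values of the averaged coordinates. -/
theorem lmarginal_le_update [DecidableEq ι] {μ : ι → Measure E} [∀ i, IsProbabilityMeasure (μ i)]
    {s : Finset ι} {F : (ι → E) → ℝ≥0∞} {C : ℝ≥0∞} {i : ι} (hi : i ∉ s) (z : ι → E) (x : E)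
    (hC : ∀ z, F z ≤ F (Function.update z i x) + C) :
    (∫⋯∫⁻_s, F ∂μ) z ≤ (∫⋯∫⁻_s, F ∂μ) (Function.update z i x) + C := by
  have hc : C = ∫⁻ _, C ∂(Measure.pi fun j : s => μ j) := by simp
  unfold lmarginal
  conv_rhs => rw [hc]
  rw [← lintegral_add_right _ measurable_const]
  refine lintegral_mono fun y => ?_
  refine (hC _).trans (le_of_eq ?_)
  congr 2
  ext j
  by_cases hj : j ∈ s
  · have : j ≠ i := fun h => hi (h ▸ hj)
    simp [Function.updateFinset, hj, this]
  · simp [Function.updateFinset, Function.update_apply, hj]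

variable [Fintype ι]

/-- The law is exchanged one coordinate at a time. This serves to compare a sample of a nearly
constant density with a uniform sample. -/
theorem lintegral_pi_le_of_le_add [DecidableEq ι] {ν ν' ρ : Measure E} [IsProbabilityMeasure ν]
    [IsProbabilityMeasure ν'] (h : ν ≤ ν' + ρ) {C : ℝ≥0∞} {F : (ι → E) → ℝ≥0∞} (hF : Measurable F)
    (hC : ∀ z i x, F z ≤ F (Function.update z i x) + C) :
    ∫⁻ z, F z ∂(Measure.pi fun _ => ν) ≤
      ∫⁻ z, F z ∂(Measure.pi fun _ => ν') + Fintype.card ι * (C * ρ Set.univ) := by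
  have key : ∀ (s : Finset ι) (z : ι → E), (∫⋯∫⁻_s, F ∂fun _ => ν) z ≤
      (∫⋯∫⁻_s, F ∂fun _ => ν') z + s.card * (C * ρ Set.univ) := by
    intro s
    induction s using Finset.induction_on with
    | empty => simp
    | insert i s hi ih =>
      intro z
      rw [lmarginal_insert _ hF hi, lmarginal_insert _ hF hi]
      calc _ ≤ ∫⁻ x, ((∫⋯∫⁻_s, F ∂fun _ => ν') (Function.update z i x) +
            s.card * (C * ρ Set.univ)) ∂ν := lintegral_mono fun x => ih _
        _ = ∫⁻ x, (∫⋯∫⁻_s, F ∂fun _ => ν') (Function.update z i x) ∂ν +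
            s.card * (C * ρ Set.univ) := by
          rw [lintegral_add_right _ measurable_const]; simp
        _ ≤ ∫⁻ x, (∫⋯∫⁻_s, F ∂fun _ => ν') (Function.update z i x) ∂ν' + C * ρ Set.univ +
            s.card * (C * ρ Set.univ) := by
          gcongr
          refine lintegral_le_of_le_add h fun x y => ?_
          have := lmarginal_le_update (μ := fun _ => ν') hi (Function.update z i x) y
            fun w => hC w i y
          rwa [Function.update_idem] at this
        _ = _ := by
          rw [Finset.card_insert_of_notMem hi]
          push_cast
          ring
  rcases isEmpty_or_nonempty E with hE | hE
  · exact absurd (measure_univ (μ := ν)) (by simp [Set.univ_eq_empty_iff.2 hE])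
  have := key Finset.univ fun _ => hE.some
  simpa [Finset.card_univ] using this

/-- Hoeffding's lemma: the oscillation bound puts the values of `g` in an interval of length `C`. -/
theorem lintegral_exp_mul_le {ν : Measure E} [IsProbabilityMeasure ν] {g : E → ℝ}
    (hg : Measurable g) {C : ℝ} (hC : ∀ x y, g x ≤ g y + C) (hb : ∃ B, ∀ x, |g x| ≤ B) (t : ℝ) :
    ∫⁻ x, ENNReal.ofReal (Real.exp (t * g x)) ∂ν ≤
      ENNReal.ofReal (Real.exp (t ^ 2 * C ^ 2 / 8)) *
        ENNReal.ofReal (Real.exp (t * ∫ x, g x ∂ν)) := by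
  obtain ⟨B, hB⟩ := hb
  have hE : Nonempty E := by
    by_contra h
    rw [not_nonempty_iff] at h
    exact absurd (measure_univ (μ := ν)) (by simp [Set.univ_eq_empty_iff.2 h])
  have hbdd : BddBelow (Set.range g) := ⟨-B, by rintro _ ⟨x, rfl⟩; exact (abs_le.1 (hB x)).1⟩
  set m := ⨅ x, g x
  have hmem : ∀ x, g x ∈ Set.Icc m (m + C) := fun x =>
    ⟨ciInf_le hbdd x, by
      rw [← sub_le_iff_le_add]
      exact le_ciInf fun y => by linarith [hC x y]⟩
  have hsub := hasSubgaussianMGF_of_mem_Icc (μ := ν) hg.aemeasurable (.of_forall hmem)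
  have h1 := hsub.mgf_le t
  have h2 := hsub.integrable_exp_mul t
  have hint : ∀ x, Real.exp (t * g x) =
      Real.exp (t * ∫ x, g x ∂ν) * Real.exp (t * (g x - ∫ x, g x ∂ν)) := by
    intro x; rw [← Real.exp_add]; ring_nf
  simp_rw [hint]
  rw [← ofReal_integral_eq_lintegral_ofReal (h2.const_mul _) (.of_forall fun x => by positivity),
    ← ENNReal.ofReal_mul (by positivity), integral_const_mul, mul_comm]
  refine ENNReal.ofReal_le_ofReal ?_
  gcongr
  refine h1.trans (le_of_eq ?_)
  congr 1
  simp only [NNReal.coe_pow, NNReal.coe_div, coe_nnnorm, Real.norm_eq_abs, NNReal.coe_ofNat,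
    add_sub_cancel_left, div_pow, sq_abs]
  ring

/-- **McDiarmid's inequality**: exponential moments of a function with bounded differences. -/
theorem lintegral_exp_pi_le [DecidableEq ι] {μ : Measure E} [IsProbabilityMeasure μ]
    {F : (ι → E) → ℝ} (hF : Measurable F) {B C : ℝ} (h0 : ∀ z, 0 ≤ F z) (hB : ∀ z, F z ≤ B)
    (hC0 : 0 ≤ C) (hC : ∀ z i x, F z ≤ F (Function.update z i x) + C) (t : ℝ) :
    ∫⁻ z, ENNReal.ofReal (Real.exp (t * F z)) ∂(Measure.pi fun _ => μ) ≤
      ENNReal.ofReal (Real.exp (Fintype.card ι * (t ^ 2 * C ^ 2 / 8))) *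
        ENNReal.ofReal (Real.exp (t * ∫ z, F z ∂(Measure.pi fun _ => μ))) := by
  have hE : Nonempty E := by
    by_contra h
    rw [not_nonempty_iff] at h
    exact absurd (measure_univ (μ := μ)) (by simp [Set.univ_eq_empty_iff.2 h])
  have hFm : Measurable fun z => ENNReal.ofReal (F z) := hF.ennreal_ofReal
  have hexpm : Measurable fun z => ENNReal.ofReal (Real.exp (t * F z)) :=
    (hF.const_mul t).exp.ennreal_ofReal
  let g : Finset ι → (ι → E) → ℝ≥0∞ := fun s =>
    ∫⋯∫⁻_s, (fun z => ENNReal.ofReal (F z)) ∂fun _ => μ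
  have hgm : ∀ s, Measurable (g s) := fun s => hFm.lmarginal _
  have hgB : ∀ s z, g s z ≤ ENNReal.ofReal B := by
    intro s z
    calc g s z ≤ (∫⋯∫⁻_s, (fun _ => ENNReal.ofReal B) ∂fun _ => μ) z :=
          lmarginal_mono (fun w => ENNReal.ofReal_le_ofReal (hB w)) z
      _ = _ := by simp [lmarginal]
  have hgtop : ∀ s z, g s z ≠ ⊤ := fun s z => ne_top_of_le_ne_top ENNReal.ofReal_ne_top (hgB s z)
  -- Induction on the set of integrated coordinates. The partial means `g s` inherit the difference
  -- bound, so Hoeffding's lemma contributes one factor `exp (t²C²/8)` per coordinate.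
  have key : ∀ (s : Finset ι) (z : ι → E),
      (∫⋯∫⁻_s, (fun z => ENNReal.ofReal (Real.exp (t * F z))) ∂fun _ => μ) z ≤
      ENNReal.ofReal (Real.exp (s.card * (t ^ 2 * C ^ 2 / 8))) *
        ENNReal.ofReal (Real.exp (t * (g s z).toReal)) := by
    intro s
    induction s using Finset.induction_on with
    | empty =>
      intro z
      simp [g, ENNReal.toReal_ofReal (h0 z)]
    | insert i s hi ih =>
      intro z
      rw [lmarginal_insert _ hexpm hi]
      calc _ ≤ ∫⁻ x, ENNReal.ofReal (Real.exp (s.card * (t ^ 2 * C ^ 2 / 8))) *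
            ENNReal.ofReal (Real.exp (t * (g s (Function.update z i x)).toReal)) ∂μ :=
            lintegral_mono fun x => ih _
        _ = ENNReal.ofReal (Real.exp (s.card * (t ^ 2 * C ^ 2 / 8))) * ∫⁻ x,
            ENNReal.ofReal (Real.exp (t * (g s (Function.update z i x)).toReal)) ∂μ :=
            lintegral_const_mul' _ _ ENNReal.ofReal_ne_top
        _ ≤ ENNReal.ofReal (Real.exp (s.card * (t ^ 2 * C ^ 2 / 8))) *
            (ENNReal.ofReal (Real.exp (t ^ 2 * C ^ 2 / 8)) *
            ENNReal.ofReal (Real.exp (t * ∫ x, (g s (Function.update z i x)).toReal ∂μ))) := by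
          gcongr
          refine lintegral_exp_mul_le ((hgm s).comp (measurable_update z)).ennreal_toReal ?_ ?_ t
          · intro x y
            have h := lmarginal_le_update (μ := fun _ => μ) (F := fun z => ENNReal.ofReal (F z))
              (C := ENNReal.ofReal C) hi (Function.update z i x) y fun w => by
                rw [← ENNReal.ofReal_add (h0 _) hC0]
                exact ENNReal.ofReal_le_ofReal (hC w i y)
            rw [Function.update_idem] at h
            have h' := ENNReal.toReal_mono (by simpa using hgtop s _) h
            rwa [ENNReal.toReal_add (hgtop s _) (by simp), ENNReal.toReal_ofReal hC0] at h'
          · refine ⟨(ENNReal.ofReal B).toReal, fun x => ?_⟩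
            rw [abs_of_nonneg ENNReal.toReal_nonneg]
            exact ENNReal.toReal_mono (by simp) (hgB s _)
        _ = _ := by
          rw [← mul_assoc, ← ENNReal.ofReal_mul (by positivity), ← Real.exp_add]
          congr 3
          · rw [Finset.card_insert_of_notMem hi]
            push_cast
            ring
          · congr 1
            rw [integral_toReal]
            · congr 1
              exact (lmarginal_insert (μ := fun _ => μ) _ hFm hi z).symm
            · exact ((hgm s).comp (measurable_update z)).aemeasurable
            · exact .of_forall fun x => (hgtop s _).lt_top
  have h := key Finset.univ fun _ => hE.some
  rw [lmarginal_univ, Finset.card_univ] at h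
  refine h.trans (le_of_eq ?_)
  congr 4
  simp only [g, lmarginal_univ]
  rw [integral_eq_lintegral_of_nonneg_ae (.of_forall h0) hF.aestronglyMeasurable]

/-- The exponential moments make the centred function sub-Gaussian with variance proxy `card ι * C²
/ 4`; the Chernoff bound is applied to it and to its negative. -/
theorem measure_abs_sub_integral_ge_le [DecidableEq ι] {μ : Measure E} [IsProbabilityMeasure μ]
    {F : (ι → E) → ℝ} (hF : Measurable F) {B C : ℝ} (h0 : ∀ z, 0 ≤ F z) (hB : ∀ z, F z ≤ B)
    (hC0 : 0 ≤ C) (hC : ∀ z i x, F z ≤ F (Function.update z i x) + C) {ε : ℝ} (hε : 0 ≤ ε) :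
    (Measure.pi fun _ => μ) {z | ε ≤ |F z - ∫ z, F z ∂(Measure.pi fun _ => μ)|} ≤
      ENNReal.ofReal (2 * Real.exp (-(2 * ε ^ 2 / (Fintype.card ι * C ^ 2)))) := by
  set m := ∫ z, F z ∂(Measure.pi fun _ => μ)
  have hint : ∀ t, Integrable (fun z => Real.exp (t * (F z - m))) (Measure.pi fun _ => μ) := by
    intro t
    refine Integrable.of_bound (C := Real.exp (|t| * (B + |m|)))
      ((hF.sub_const m).const_mul t).exp.aestronglyMeasurable (.of_forall fun z => ?_)
    rw [Real.norm_eq_abs, Real.abs_exp, Real.exp_le_exp]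
    refine (le_abs_self _).trans ?_
    rw [abs_mul]
    gcongr
    refine (abs_sub _ _).trans ?_
    rw [abs_of_nonneg (h0 z)]
    gcongr
    exact hB z
  have hsub : HasSubgaussianMGF (fun z => F z - m) (Real.toNNReal (Fintype.card ι * C ^ 2 / 4))
      (Measure.pi fun _ => μ) := by
    refine ⟨hint, fun t => ?_⟩
    have h := lintegral_exp_pi_le (μ := μ) hF h0 hB hC0 hC t
    have h1 : mgf (fun z => F z - m) (Measure.pi fun _ => μ) t =
        Real.exp (-(t * m)) * ∫ z, Real.exp (t * F z) ∂(Measure.pi fun _ => μ) := by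
      rw [mgf, ← integral_const_mul]
      refine integral_congr_ae (.of_forall fun z => ?_)
      simp only
      rw [← Real.exp_add]
      ring_nf
    have h2 : ∫ z, Real.exp (t * F z) ∂(Measure.pi fun _ => μ) ≤
        Real.exp (Fintype.card ι * (t ^ 2 * C ^ 2 / 8)) * Real.exp (t * m) := by
      rw [integral_eq_lintegral_of_nonneg_ae (.of_forall fun z => (Real.exp_pos _).le)
        (hF.const_mul t).exp.aestronglyMeasurable]
      refine ENNReal.toReal_le_of_le_ofReal (by positivity) ?_
      rwa [ENNReal.ofReal_mul (by positivity)]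
    rw [h1, Real.coe_toNNReal _ (by positivity)]
    calc _ ≤ Real.exp (-(t * m)) *
          (Real.exp (Fintype.card ι * (t ^ 2 * C ^ 2 / 8)) * Real.exp (t * m)) := by gcongr
      _ = _ := by
        rw [← Real.exp_add, ← Real.exp_add]
        ring_nf
  have hexp : Real.exp (-ε ^ 2 / (2 * (Real.toNNReal (Fintype.card ι * C ^ 2 / 4) : ℝ))) =
      Real.exp (-(2 * ε ^ 2 / (Fintype.card ι * C ^ 2))) := by
    rw [Real.coe_toNNReal _ (by positivity)]
    congr 1
    rw [show (2 : ℝ) * (Fintype.card ι * C ^ 2 / 4) = (Fintype.card ι * C ^ 2) / 2 by ring,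
      div_div_eq_mul_div]
    ring
  have h1 := hsub.measure_ge_le hε
  have h2 := hsub.neg.measure_ge_le hε
  rw [hexp] at h1 h2
  have hsubset : {z | ε ≤ |F z - m|} ⊆ {z | ε ≤ F z - m} ∪ {z | ε ≤ (-fun z => F z - m) z} := by
    intro z hz
    have hz' : ε ≤ |F z - m| := hz
    exact le_abs.1 hz'
  rw [two_mul, ENNReal.ofReal_add (by positivity) (by positivity)]
  refine (measure_mono hsubset).trans ((measure_union_le _ _).trans (add_le_add ?_ ?_))
  · rw [← ofReal_measureReal]
    exact ENNReal.ofReal_le_ofReal h1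
  · rw [← ofReal_measureReal]
    exact ENNReal.ofReal_le_ofReal h2

end BoundedDifferences

/-! ### Grids of half-open cubes. -/

section Cells

variable {d : ℕ}

/-- The index of the half-open cube of side `t` of the grid which contains `x`. -/
noncomputable def cellIdx (t : ℝ) (x : EuclideanSpace ℝ (Fin d)) : Fin d → ℤ := fun i => ⌊x i / t⌋

theorem measurable_cellIdx (t : ℝ) : Measurable (cellIdx (d := d) t) := by
  refine measurable_pi_lambda _ fun i => ?_
  have : Measurable fun x : EuclideanSpace ℝ (Fin d) => x i / t := by fun_prop
  exact this.floor

theorem measurableSet_cell (t : ℝ) (z : Fin d → ℤ) :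
    MeasurableSet (cellIdx (d := d) t ⁻¹' {z}) :=
  measurable_cellIdx t (measurableSet_singleton z)

/-- The dyadic grids are nested, and the index of the parent cube is given by integer division. -/
theorem cellIdx_two_mul (t : ℝ) (x : EuclideanSpace ℝ (Fin d)) :
    cellIdx (2 * t) x = fun i => cellIdx t x i / 2 := by
  ext i
  have := Int.floor_div_natCast (x i / t) 2
  rw [cellIdx, cellIdx, mul_comm 2 t, ← div_div]
  exact_mod_cast this

theorem mem_cell_iff {t : ℝ} (ht : 0 < t) {z : Fin d → ℤ} {x : EuclideanSpace ℝ (Fin d)} :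
    x ∈ cellIdx t ⁻¹' {z} ↔ ∀ i, x i ∈ Set.Ico (t * z i) (t * z i + t) := by
  simp only [Set.mem_preimage, Set.mem_singleton_iff, funext_iff, cellIdx, Int.floor_eq_iff,
    Set.mem_Ico, le_div_iff₀ ht, div_lt_iff₀ ht]
  refine forall_congr' fun i => ?_
  rw [mul_comm t, add_mul, one_mul]

theorem volume_cell {t : ℝ} (ht : 0 < t) (z : Fin d → ℤ) :
    volume (cellIdx (d := d) t ⁻¹' {z}) = ENNReal.ofReal (t ^ d) := by
  have h : cellIdx (d := d) t ⁻¹' {z} = (WithLp.ofLp) ⁻¹'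
      (Set.univ.pi fun i => Set.Ico (t * z i) (t * z i + t)) := by
    ext x
    rw [mem_cell_iff ht]
    simp
  rw [h, (PiLp.volume_preserving_ofLp (Fin d)).measure_preimage
    (MeasurableSet.univ_pi fun _ => measurableSet_Ico).nullMeasurableSet, volume_pi, Measure.pi_pi]
  simp [Real.volume_Ico, ENNReal.ofReal_pow ht.le]

theorem dist_le_of_cellIdx_eq {t : ℝ} (ht : 0 < t) {x y : EuclideanSpace ℝ (Fin d)}
    (h : cellIdx t x = cellIdx t y) : dist x y ≤ √d * t := by
  have hx := (mem_cell_iff ht (z := cellIdx t y)).1 h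
  have hy := (mem_cell_iff ht (z := cellIdx t y)).1 rfl
  rw [EuclideanSpace.dist_eq]
  calc √(∑ i, dist (x i) (y i) ^ 2) ≤ √(∑ _i : Fin d, t ^ 2) := by
        refine Real.sqrt_le_sqrt (Finset.sum_le_sum fun i _ => ?_)
        refine pow_le_pow_left₀ dist_nonneg ?_ 2
        rw [Real.dist_eq, abs_le]
        have h1 := hx i
        have h2 := hy i
        rw [Set.mem_Ico] at h1 h2
        constructor <;> linarith
    _ = √d * t := by
        rw [Finset.sum_const, Finset.card_univ, Fintype.card_fin, nsmul_eq_mul,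
          Real.sqrt_mul (by positivity), Real.sqrt_sq ht.le]

/-- The cost `|x - y| ^ p`. -/
noncomputable def powCost (d : ℕ) (p : ℝ) (x y : EuclideanSpace ℝ (Fin d)) : ℝ≥0∞ := edist x y ^ p

theorem measurable_powCost (p : ℝ) : Measurable (Function.uncurry (powCost d p)) := by
  unfold powCost Function.uncurry
  exact (measurable_edist).pow_const p

/-- An upper bound of the cost within a cube of side `t`. -/
noncomputable def cellCost (d : ℕ) (p t : ℝ) : ℝ≥0∞ := ENNReal.ofReal ((√d * t) ^ p)

theorem powCost_le_cellCost {p t : ℝ} (hp : 0 ≤ p) (ht : 0 < t) {x y : EuclideanSpace ℝ (Fin d)}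
    (h : cellIdx t x = cellIdx t y) : powCost d p x y ≤ cellCost d p t := by
  rw [powCost, cellCost, edist_dist, ENNReal.ofReal_rpow_of_nonneg dist_nonneg hp]
  exact ENNReal.ofReal_le_ofReal
    (Real.rpow_le_rpow dist_nonneg (dist_le_of_cellIdx_eq ht h) hp)

/-- The cells meeting `S` are disjoint, have volume `t ^ d`, and lie in the thickening of `S` by the
bound `√d * t` on their diameter. -/
theorem card_cells_le {t V : ℝ} (ht : 0 < t) {S : Set (EuclideanSpace ℝ (Fin d))}
    (hV : volume (Metric.cthickening (√d * t) S) ≤ ENNReal.ofReal V) (hV0 : 0 ≤ V)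
    (F : Finset (Fin d → ℤ)) (hF : ∀ z ∈ F, (S ∩ cellIdx t ⁻¹' {z}).Nonempty) :
    (F.card : ℝ) ≤ V / t ^ d := by
  rw [le_div_iff₀ (by positivity)]
  have h1 : volume (⋃ z ∈ F, cellIdx (d := d) t ⁻¹' {z}) = ENNReal.ofReal (F.card * t ^ d) := by
    rw [measure_biUnion_finset]
    · simp only [volume_cell ht, Finset.sum_const, nsmul_eq_mul]
      rw [ENNReal.ofReal_mul (by positivity), ENNReal.ofReal_natCast]
    · exact Set.pairwiseDisjoint_fiber _ _
    · exact fun z _ => measurableSet_cell t z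
  have h2 : (⋃ z ∈ F, cellIdx (d := d) t ⁻¹' {z}) ⊆ Metric.cthickening (√d * t) S := by
    refine Set.iUnion₂_subset fun z hz x hx => ?_
    obtain ⟨y, hyS, hy⟩ := hF z hz
    refine Metric.mem_cthickening_of_dist_le x y _ _ hyS (dist_le_of_cellIdx_eq ht ?_)
    rw [Set.mem_preimage, Set.mem_singleton_iff] at hx hy
    rw [hx, hy]
  have h3 := (measure_mono h2).trans hV
  rw [h1] at h3
  exact (ENNReal.ofReal_le_ofReal_iff hV0).1 h3

theorem finite_cells {t V : ℝ} (ht : 0 < t) {S : Set (EuclideanSpace ℝ (Fin d))}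
    (hV : volume (Metric.cthickening (√d * t) S) ≤ ENNReal.ofReal V) (hV0 : 0 ≤ V) :
    {z : Fin d → ℤ | (S ∩ cellIdx t ⁻¹' {z}).Nonempty}.Finite := by
  by_contra h
  obtain ⟨F, hF, hcard⟩ := Set.Infinite.exists_subset_card_eq h (⌊V / t ^ d⌋₊ + 1)
  have h1 := card_cells_le ht hV hV0 F fun z hz => hF hz
  rw [hcard] at h1
  have h2 := Nat.lt_floor_add_one (V / t ^ d)
  push_cast at h1
  linarith

/-- The sum over the cells meeting `S` of the square roots of the masses. -/
theorem tsum_sqrt_le {t V : ℝ} (ht : 0 < t) {S : Set (EuclideanSpace ℝ (Fin d))}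
    (hS : MeasurableSet S) (hV : volume (Metric.cthickening (√d * t) S) ≤ ENNReal.ofReal V)
    (hV0 : 0 ≤ V) (μ : Measure (EuclideanSpace ℝ (Fin d))) [IsFiniteMeasure μ] (n : ℕ) :
    ∑' z, ENNReal.ofReal √(n * μ.real (S ∩ cellIdx t ⁻¹' {z})) ≤
      ENNReal.ofReal √(n * μ.real S * (V / t ^ d)) := by
  have hfin := finite_cells ht hV hV0
  rw [tsum_eq_sum (s := hfin.toFinset)]
  · rw [← ENNReal.ofReal_sum_of_nonneg fun _ _ => Real.sqrt_nonneg _]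
    refine ENNReal.ofReal_le_ofReal (Real.le_sqrt_of_sq_le ?_)
    -- Cauchy–Schwarz, with the number of cells bounded by volume.
    refine sq_sum_le_card_mul_sum_sq.trans ?_
    have hcard := card_cells_le ht hV hV0 hfin.toFinset fun z hz => by simpa using hz
    have hsum : ∑ z ∈ hfin.toFinset, √(n * μ.real (S ∩ cellIdx t ⁻¹' {z})) ^ 2 ≤
        n * μ.real S := by
      simp_rw [Real.sq_sqrt (show 0 ≤ (n : ℝ) * μ.real _ by positivity), ← Finset.mul_sum]
      gcongr
      rw [← measureReal_biUnion_finset]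
      · refine measureReal_mono (Set.iUnion₂_subset fun z _ => Set.inter_subset_left)
      · exact (Set.pairwiseDisjoint_fiber _ _).mono_on fun z _ => Set.inter_subset_right
      · exact fun z _ => hS.inter (measurableSet_cell t z)
    rw [mul_comm]
    gcongr
  · intro z hz
    have : S ∩ cellIdx t ⁻¹' {z} = ∅ := by
      by_contra h
      exact hz (by simpa using Set.nonempty_iff_ne_empty.2 h)
    simp [this]

end Cells

/-! ### The multiscale bound. -/

section Hierarchy

variable {d n : ℕ} {p : ℝ}

/-- One step of the hierarchy. A cube of side `2t` is cut into its subcubes, and inside a subcube a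
pair costs no more than the old penalty. Hence raising the penalty to the level of the large cube
affects only the discrepancy. -/
theorem tsum_locCost_two_mul_le {t : ℝ} (ht : 0 < t) (hp : 0 ≤ p)
    (S : Set (EuclideanSpace ℝ (Fin d))) (z : Fin n ⊕ Fin n → EuclideanSpace ℝ (Fin d)) :
    ∑' k, locCost (powCost d p) (fun _ => cellCost d p (2 * t)) (S ∩ cellIdx (2 * t) ⁻¹' {k}) z ≤
      ∑' k, locCost (powCost d p) (fun _ => cellCost d p t) (S ∩ cellIdx t ⁻¹' {k}) z +
      cellCost d p (2 * t) * ∑' k, gap (numL (S ∩ cellIdx t ⁻¹' {k}) z)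
        (numR (S ∩ cellIdx t ⁻¹' {k}) z) := by
  calc _ ≤ ∑' k, ∑' l, locCost (powCost d p) (fun _ => cellCost d p (2 * t))
        (S ∩ cellIdx (2 * t) ⁻¹' {k} ∩ cellIdx t ⁻¹' {l}) z :=
        ENNReal.tsum_le_tsum fun k => locCost_le_tsum _
    _ = ∑' l, ∑' k, locCost (powCost d p) (fun _ => cellCost d p (2 * t))
        (S ∩ cellIdx (2 * t) ⁻¹' {k} ∩ cellIdx t ⁻¹' {l}) z := ENNReal.tsum_comm
    _ = ∑' l, locCost (powCost d p) (fun _ => cellCost d p (2 * t)) (S ∩ cellIdx t ⁻¹' {l}) z := by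
        refine tsum_congr fun l => ?_
        rw [tsum_eq_single fun i => l i / 2]
        · congr 1
          ext x
          simp only [Set.mem_inter_iff, Set.mem_preimage, Set.mem_singleton_iff, cellIdx_two_mul]
          constructor
          · rintro ⟨⟨h1, -⟩, h2⟩; exact ⟨h1, h2⟩
          · rintro ⟨h1, rfl⟩; exact ⟨⟨h1, rfl⟩, rfl⟩
        · intro k hk
          refine locCost_eq_zero fun i => ?_
          rintro ⟨⟨-, h2⟩, h3⟩
          rw [Set.mem_preimage, Set.mem_singleton_iff] at h2 h3
          rw [cellIdx_two_mul, h3] at h2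
          exact hk h2.symm
    _ ≤ ∑' l, (locCost (powCost d p) (fun _ => cellCost d p t) (S ∩ cellIdx t ⁻¹' {l}) z +
        cellCost d p (2 * t) * gap (numL (S ∩ cellIdx t ⁻¹' {l}) z)
        (numR (S ∩ cellIdx t ⁻¹' {l}) z)) := by
        refine ENNReal.tsum_le_tsum fun l => locCost_le_add_gap ?_ fun _ _ => le_rfl
        intro x hx y hy
        refine (powCost_le_cellCost hp ht ?_).trans le_self_add
        rw [show cellIdx t x = l from hx.2, show cellIdx t y = l from hy.2]
    _ = _ := by rw [ENNReal.tsum_add, ENNReal.tsum_mul_left]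

theorem tsum_locCost_two_pow_mul_le {t : ℝ} (ht : 0 < t) (hp : 0 ≤ p)
    (S : Set (EuclideanSpace ℝ (Fin d))) (z : Fin n ⊕ Fin n → EuclideanSpace ℝ (Fin d)) (K : ℕ) :
    ∑' k, locCost (powCost d p) (fun _ => cellCost d p (2 ^ K * t))
      (S ∩ cellIdx (2 ^ K * t) ⁻¹' {k}) z ≤
      ∑' k, locCost (powCost d p) (fun _ => cellCost d p t) (S ∩ cellIdx t ⁻¹' {k}) z +
      ∑ j ∈ Finset.range K, cellCost d p (2 ^ (j + 1) * t) *
        ∑' k, gap (numL (S ∩ cellIdx (2 ^ j * t) ⁻¹' {k}) z)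
        (numR (S ∩ cellIdx (2 ^ j * t) ⁻¹' {k}) z) := by
  induction K with
  | zero => simp
  | succ K ih =>
    rw [Finset.sum_range_succ, ← add_assoc, pow_succ', mul_assoc]
    exact (tsum_locCost_two_mul_le (by positivity) hp S z).trans (add_le_add_left ih _)

theorem measurable_gap {S : Set (EuclideanSpace ℝ (Fin d))} (hS : MeasurableSet S) :
    Measurable fun z : Fin n ⊕ Fin n → EuclideanSpace ℝ (Fin d) => gap (numL S z) (numR S z) := by
  have h1 := (measurable_from_top (f := fun k : ℕ => (k : ℝ))).comp
    (measurable_numL (ι := Fin n) (ι' := Fin n) hS)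
  have h2 := (measurable_from_top (f := fun k : ℕ => (k : ℝ))).comp
    (measurable_numR (ι := Fin n) (ι' := Fin n) hS)
  exact (h1.sub h2).norm.ennreal_ofReal

theorem lintegral_tsum_gap_le {t V : ℝ} (ht : 0 < t) {S : Set (EuclideanSpace ℝ (Fin d))}
    (hS : MeasurableSet S) (hV : volume (Metric.cthickening (√d * t) S) ≤ ENNReal.ofReal V)
    (hV0 : 0 ≤ V) (μ : Measure (EuclideanSpace ℝ (Fin d))) [IsProbabilityMeasure μ] (n : ℕ) :
    ∫⁻ z : Fin n ⊕ Fin n → EuclideanSpace ℝ (Fin d), ∑' k, gap (numL (S ∩ cellIdx t ⁻¹' {k}) z)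
        (numR (S ∩ cellIdx t ⁻¹' {k}) z) ∂(Measure.pi fun _ => μ) ≤
      ENNReal.ofReal (2 * √(n * μ.real S * (V / t ^ d))) := by
  rw [lintegral_tsum fun k => (measurable_gap (hS.inter (measurableSet_cell t k))).aemeasurable]
  calc _ ≤ ∑' k, 2 * ENNReal.ofReal √(n * μ.real (S ∩ cellIdx t ⁻¹' {k})) :=
        ENNReal.tsum_le_tsum fun k => lintegral_gap_le n μ (hS.inter (measurableSet_cell t k))
    _ ≤ _ := by
      rw [ENNReal.tsum_mul_left, ENNReal.ofReal_mul (by norm_num), ENNReal.ofReal_ofNat]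
      gcongr
      exact tsum_sqrt_le ht hS hV hV0 μ n

/-- Up to constants the scale `2 ^ j * t` contributes its power `p - d / 2`. The exponent is
negative because `2 * p < d`, so the finest scale dominates. -/
theorem geometric_error_le (hpd : 2 * p < d) {t W : ℝ} (ht : 0 < t) (hW : 0 ≤ W)
    (K : ℕ) :
    ∑ j ∈ Finset.range K, (√d * (2 ^ (j + 1) * t)) ^ p * (2 * √(W / (2 ^ j * t) ^ d)) ≤
      2 * (2 * √d) ^ p / (1 - 2 ^ (p - d / 2)) * √W * t ^ (p - d / 2) := by
  have hterm : ∀ j : ℕ, (√d * (2 ^ (j + 1) * t)) ^ p * (2 * √(W / (2 ^ j * t) ^ d)) =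
      (2 * (2 * √d) ^ p * √W * t ^ (p - d / 2)) * (2 ^ (p - d / 2)) ^ j := by
    intro j
    have h1 : √(W / (2 ^ j * t) ^ d) = √W * (2 ^ j * t) ^ (-(d / 2 : ℝ)) := by
      rw [Real.sqrt_div hW, div_eq_mul_inv, Real.rpow_neg (by positivity), Real.sqrt_eq_rpow
        ((2 ^ j * t) ^ d), ← Real.rpow_natCast (2 ^ j * t), ← Real.rpow_mul (by positivity)]
      ring_nf
    have h2 : (√d * (2 ^ (j + 1) * t)) ^ p = (2 * √d) ^ p * (2 ^ j * t) ^ p := by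
      rw [← Real.mul_rpow (by positivity) (by positivity)]
      ring_nf
    have h3 : ((2 : ℝ) ^ (p - d / 2)) ^ j = (2 ^ j : ℝ) ^ (p - d / 2) := by
      rw [← Real.rpow_natCast, ← Real.rpow_mul (by norm_num), mul_comm, Real.rpow_mul (by norm_num),
        Real.rpow_natCast]
    have h4 : (2 ^ j * t : ℝ) ^ p * (2 ^ j * t) ^ (-(d / 2 : ℝ)) =
        (2 ^ j : ℝ) ^ (p - d / 2) * t ^ (p - d / 2) := by
      rw [← Real.rpow_add (by positivity), ← Real.mul_rpow (by positivity) ht.le]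
      ring_nf
    rw [h1, h2, h3]
    linear_combination (2 * (2 * √d) ^ p * √W) * h4
  simp_rw [hterm]
  rw [← Finset.mul_sum]
  have hr1 : (2 : ℝ) ^ (p - d / 2) < 1 :=
    Real.rpow_lt_one_of_one_lt_of_neg (by norm_num) (by linarith)
  have hgeom : ∑ j ∈ Finset.range K, ((2 : ℝ) ^ (p - d / 2)) ^ j ≤ (1 - 2 ^ (p - d / 2))⁻¹ :=
    (summable_geometric_of_lt_one (by positivity) hr1).sum_le_tsum _ (fun _ _ => by positivity)
      |>.trans (tsum_geometric_of_lt_one (by positivity) hr1).le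
  calc _ ≤ (2 * (2 * √d) ^ p * √W * t ^ (p - d / 2)) * (1 - 2 ^ (p - d / 2))⁻¹ := by gcongr
    _ = _ := by rw [div_eq_mul_inv]; ring

/-- Multiscale comparison of the cost of matching in a region with the costs of matching within
small cubes. -/
theorem exists_hierarchical_bound (hp : 0 < p) (hpd : 2 * p < d) :
    ∃ C : ℝ, 0 < C ∧ ∀ (μ : Measure (EuclideanSpace ℝ (Fin d))) [IsProbabilityMeasure μ] (n : ℕ)
      (S : Set (EuclideanSpace ℝ (Fin d))) (V T t D : ℝ), MeasurableSet S → 0 < t → t ≤ T →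
      0 ≤ D → 0 ≤ V →
      (∀ s, 0 < s → s ≤ T → volume (Metric.cthickening (√d * s) S) ≤ ENNReal.ofReal V) →
      ∫⁻ z : Fin n ⊕ Fin n → EuclideanSpace ℝ (Fin d),
        locCost (powCost d p) (fun _ => ENNReal.ofReal D) S z ∂(Measure.pi fun _ => μ) ≤
      ∑' k, ∫⁻ z : Fin n ⊕ Fin n → EuclideanSpace ℝ (Fin d),
        locCost (powCost d p) (fun _ => cellCost d p t) (S ∩ cellIdx t ⁻¹' {k}) z
          ∂(Measure.pi fun _ => μ) +
      ENNReal.ofReal (C * √(n * μ.real S * V) * (t ^ (p - d / 2) + D * T ^ (-(d / 2 : ℝ)))) := by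
  have hr1 : (2 : ℝ) ^ (p - d / 2) < 1 :=
    Real.rpow_lt_one_of_one_lt_of_neg (by norm_num) (by linarith)
  have hd : 0 < (d : ℝ) := by linarith
  set C₁ : ℝ := 2 * (2 * √d) ^ p / (1 - 2 ^ (p - d / 2)) with hC₁
  have hC₁0 : 0 < C₁ := div_pos (by positivity) (by linarith)
  -- `C₁` comes from the geometric sum. The other constant belongs to the coarsest scale, where `2 ^
  -- (d / 2)` pays for `2 ^ K * t` being only at least `T / 2`.
  refine ⟨max C₁ (2 * 2 ^ (d / 2 : ℝ)), lt_max_of_lt_left hC₁0, ?_⟩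
  intro μ _ n S V T t D hS ht htT hD hV0 hV
  set W := n * μ.real S * V with hW
  have hW0 : 0 ≤ W := by positivity
  obtain ⟨K, hK1, hK2⟩ : ∃ K : ℕ, 2 ^ K * t ≤ T ∧ T < 2 ^ (K + 1) * t := by
    obtain ⟨K, h1, h2⟩ := exists_nat_pow_near (x := T / t) (y := 2) ((one_le_div ht).2 htT)
      (by norm_num)
    exact ⟨K, (le_div_iff₀ ht).1 h1, (div_lt_iff₀ ht).1 h2⟩
  have hVs : ∀ j ≤ K, volume (Metric.cthickening (√d * (2 ^ j * t)) S) ≤ ENNReal.ofReal V := by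
    intro j hj
    refine hV _ (by positivity) (le_trans ?_ hK1)
    gcongr
    norm_num
  have hgapm : ∀ s : ℝ, Measurable fun z : Fin n ⊕ Fin n → EuclideanSpace ℝ (Fin d) =>
      ∑' k, gap (numL (S ∩ cellIdx s ⁻¹' {k}) z) (numR (S ∩ cellIdx s ⁻¹' {k}) z) := fun s =>
    Measurable.tsum fun k => measurable_gap (hS.inter (measurableSet_cell s k))
  have hlocm : ∀ k, Measurable fun z : Fin n ⊕ Fin n → EuclideanSpace ℝ (Fin d) =>
      locCost (powCost d p) (fun _ => cellCost d p t) (S ∩ cellIdx t ⁻¹' {k}) z := fun k =>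
    measurable_locCost (measurable_powCost p) measurable_const (hS.inter (measurableSet_cell t k))
  -- A deterministic inequality: after climbing to side `2 ^ K * t`, the remaining leftovers pay the
  -- outer penalty `D`.
  have hdet : ∀ z : Fin n ⊕ Fin n → EuclideanSpace ℝ (Fin d),
      locCost (powCost d p) (fun _ => ENNReal.ofReal D) S z ≤
      ∑' k, locCost (powCost d p) (fun _ => cellCost d p t) (S ∩ cellIdx t ⁻¹' {k}) z +
      ∑ j ∈ Finset.range K, cellCost d p (2 ^ (j + 1) * t) *
        ∑' k, gap (numL (S ∩ cellIdx (2 ^ j * t) ⁻¹' {k}) z)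
        (numR (S ∩ cellIdx (2 ^ j * t) ⁻¹' {k}) z) +
      ENNReal.ofReal D * ∑' k, gap (numL (S ∩ cellIdx (2 ^ K * t) ⁻¹' {k}) z)
        (numR (S ∩ cellIdx (2 ^ K * t) ⁻¹' {k}) z) := by
    intro z
    refine le_trans ?_ (add_le_add_left (tsum_locCost_two_pow_mul_le ht hp.le S z K) _)
    rw [← ENNReal.tsum_mul_left, ← ENNReal.tsum_add]
    refine (locCost_le_tsum (cellIdx (2 ^ K * t))).trans (ENNReal.tsum_le_tsum fun k => ?_)
    refine locCost_le_add_gap ?_ fun _ _ => le_rfl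
    intro x hx y hy
    refine (powCost_le_cellCost hp.le (by positivity) ?_).trans le_self_add
    rw [show cellIdx (2 ^ K * t) x = k from hx.2, show cellIdx (2 ^ K * t) y = k from hy.2]
  refine (lintegral_mono hdet).trans ?_
  rw [lintegral_add_right _ ((hgapm _).const_mul _), lintegral_add_right _
    (Finset.measurable_sum _ fun j _ => (hgapm _).const_mul _), lintegral_tsum
    fun k => (hlocm k).aemeasurable, lintegral_finsetSum _ fun j _ => (hgapm _).const_mul _,
    lintegral_const_mul _ (hgapm _), add_assoc]
  gcongr
  have hsum : ∑ j ∈ Finset.range K, ∫⁻ z : Fin n ⊕ Fin n → EuclideanSpace ℝ (Fin d),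
      cellCost d p (2 ^ (j + 1) * t) * ∑' k, gap (numL (S ∩ cellIdx (2 ^ j * t) ⁻¹' {k}) z)
        (numR (S ∩ cellIdx (2 ^ j * t) ⁻¹' {k}) z) ∂(Measure.pi fun _ => μ) ≤
      ENNReal.ofReal (C₁ * √W * t ^ (p - d / 2)) := by
    refine le_trans ?_ (ENNReal.ofReal_le_ofReal (geometric_error_le hpd ht hW0 K))
    rw [ENNReal.ofReal_sum_of_nonneg fun j _ => by positivity]
    refine Finset.sum_le_sum fun j hj => ?_
    rw [lintegral_const_mul _ (hgapm _), ENNReal.ofReal_mul (by positivity), cellCost]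
    gcongr
    refine (lintegral_tsum_gap_le (by positivity) hS (hVs j (Finset.mem_range.1 hj).le) hV0 μ
      n).trans (le_of_eq ?_)
    rw [hW, mul_div_assoc]
  have hlast := lintegral_tsum_gap_le (by positivity) hS (hVs K le_rfl) hV0 μ n
  have hT : 0 < T := ht.trans_le htT
  have hpow : √(n * μ.real S * (V / (2 ^ K * t) ^ d)) ≤
      √W * (2 ^ (d / 2 : ℝ) * T ^ (-(d / 2 : ℝ))) := by
    rw [← mul_div_assoc, ← hW, Real.sqrt_div hW0, div_eq_mul_inv]
    gcongr
    have h1 : √((2 ^ K * t) ^ d) = (2 ^ K * t) ^ (d / 2 : ℝ) := by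
      rw [Real.sqrt_eq_rpow, ← Real.rpow_natCast, ← Real.rpow_mul (by positivity)]
      ring_nf
    rw [h1, ← Real.rpow_neg (by positivity)]
    have h2 : T / 2 ≤ 2 ^ K * t := by rw [pow_succ] at hK2; linarith
    calc (2 ^ K * t) ^ (-(d / 2 : ℝ)) ≤ (T / 2) ^ (-(d / 2 : ℝ)) :=
          Real.rpow_le_rpow_of_nonpos (by positivity) h2 (by linarith)
      _ = _ := by
        rw [Real.div_rpow hT.le (by norm_num), Real.rpow_neg (by norm_num : (0 : ℝ) ≤ 2)]
        field_simp
  calc _ ≤ ENNReal.ofReal (C₁ * √W * t ^ (p - d / 2)) + ENNReal.ofReal D *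
        ENNReal.ofReal (2 * √(n * μ.real S * (V / (2 ^ K * t) ^ d))) := by gcongr
    _ ≤ ENNReal.ofReal (C₁ * √W * t ^ (p - d / 2)) + ENNReal.ofReal D *
        ENNReal.ofReal (2 * (√W * (2 ^ (d / 2 : ℝ) * T ^ (-(d / 2 : ℝ))))) := by gcongr
    _ = ENNReal.ofReal (C₁ * √W * t ^ (p - d / 2) + D *
        (2 * (√W * (2 ^ (d / 2 : ℝ) * T ^ (-(d / 2 : ℝ)))))) := by
      rw [← ENNReal.ofReal_mul hD, ← ENNReal.ofReal_add (by positivity) (by positivity)]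
    _ ≤ _ := by
      refine ENNReal.ofReal_le_ofReal ?_
      rw [mul_add]
      gcongr ?_ + ?_
      · gcongr
        exact le_max_left _ _
      · calc D * (2 * (√W * (2 ^ (d / 2 : ℝ) * T ^ (-(d / 2 : ℝ))))) =
            (2 * 2 ^ (d / 2 : ℝ)) * √W * (D * T ^ (-(d / 2 : ℝ))) := by ring
          _ ≤ _ := by gcongr; exact le_max_right _ _

end Hierarchy

/-! ### Passing between random and fixed numbers of points. -/

section Conditioning

variable {E ι ι' : Type*} [MeasurableSpace E] [Fintype ι] [Fintype ι']

theorem lintegral_numL (μ : Measure E) [IsProbabilityMeasure μ] {S : Set E} (hS : MeasurableSet S) :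
    ∫⁻ z : ι ⊕ ι' → E, (numL S z : ℝ≥0∞) ∂(Measure.pi fun _ => μ) = Fintype.card ι * μ S := by
  classical
  have h : ∀ z : ι ⊕ ι' → E, (numL S z : ℝ≥0∞) =
      ∑ i, S.indicator (fun _ => (1 : ℝ≥0∞)) (z (Sum.inl i)) := by
    intro z
    simp [numL, idxIn, Set.indicator_apply]
  have hm : Measurable (S.indicator fun _ => (1 : ℝ≥0∞)) := measurable_const.indicator hS
  simp_rw [h]
  rw [lintegral_finsetSum _ fun i _ => by fun_prop]
  have : ∀ i : ι, ∫⁻ z : ι ⊕ ι' → E, S.indicator (fun _ => (1 : ℝ≥0∞)) (z (Sum.inl i))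
      ∂(Measure.pi fun _ => μ) = μ S := by
    intro i
    have h := (measurePreserving_eval (fun _ : ι ⊕ ι' => μ) (Sum.inl i)).lintegral_comp hm
    simpa [lintegral_indicator_const hS] using h
  simp [this]

theorem lintegral_numR (μ : Measure E) [IsProbabilityMeasure μ] {S : Set E} (hS : MeasurableSet S) :
    ∫⁻ z : ι ⊕ ι' → E, (numR S z : ℝ≥0∞) ∂(Measure.pi fun _ => μ) = Fintype.card ι' * μ S := by
  classical
  have h : ∀ z : ι ⊕ ι' → E, (numR S z : ℝ≥0∞) =
      ∑ i, S.indicator (fun _ => (1 : ℝ≥0∞)) (z (Sum.inr i)) := by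
    intro z
    simp [numR, idxIn, Set.indicator_apply]
  have hm : Measurable (S.indicator fun _ => (1 : ℝ≥0∞)) := measurable_const.indicator hS
  simp_rw [h]
  rw [lintegral_finsetSum _ fun i _ => by fun_prop]
  have : ∀ i : ι', ∫⁻ z : ι ⊕ ι' → E, S.indicator (fun _ => (1 : ℝ≥0∞)) (z (Sum.inr i))
      ∂(Measure.pi fun _ => μ) = μ S := by
    intro i
    have h := (measurePreserving_eval (fun _ : ι ⊕ ι' => μ) (Sum.inr i)).lintegral_comp hm
    simpa [lintegral_indicator_const hS] using h
  simp [this]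

theorem lintegral_locCost_le_card {κ : E → E → ℝ≥0∞} (n : ℕ) (μ : Measure E)
    [IsProbabilityMeasure μ] {S : Set E} (hS : MeasurableSet S) (D : ℝ≥0∞) :
    ∫⁻ z : Fin n ⊕ Fin n → E, locCost κ (fun _ => D) S z ∂(Measure.pi fun _ => μ) ≤
      2 * D * (n * μ S) := by
  have hm : Measurable fun z : Fin n ⊕ Fin n → E => (numL S z : ℝ≥0∞) :=
    (measurable_from_top (f := fun k : ℕ => (k : ℝ≥0∞))).comp (measurable_numL hS)
  have hm' : Measurable fun z : Fin n ⊕ Fin n → E => (numR S z : ℝ≥0∞) :=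
    (measurable_from_top (f := fun k : ℕ => (k : ℝ≥0∞))).comp (measurable_numR hS)
  refine (lintegral_mono fun z => locCost_le_card).trans (le_of_eq ?_)
  rw [lintegral_const_mul _ (by fun_prop), lintegral_add_left hm, lintegral_numL μ hS,
    lintegral_numR μ hS, Fintype.card_fin]
  ring

variable {κ : E → E → ℝ≥0∞}

theorem measurable_gap_const (n k : ℕ) {S : Set E} (hS : MeasurableSet S) :
    Measurable fun z : Fin n ⊕ Fin n → E => gap (numL S z) k + gap (numR S z) k :=
  ((measurable_from_top (f := fun j : ℕ => gap j k)).comp (measurable_numL hS)).add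
    ((measurable_from_top (f := fun j : ℕ => gap j k)).comp (measurable_numR hS))

theorem lintegral_gap_const_le (n k : ℕ) (μ : Measure E) [IsProbabilityMeasure μ] {S : Set E}
    (hS : MeasurableSet S) :
    ∫⁻ z : Fin n ⊕ Fin n → E, (gap (numL S z) k + gap (numR S z) k) ∂(Measure.pi fun _ => μ) ≤
      ENNReal.ofReal (2 * (√(n * μ.real S) + |n * μ.real S - k|)) := by
  have hm : Measurable fun z : Fin n ⊕ Fin n → E => (numL S z : ℝ) :=
    (measurable_from_top (f := fun k : ℕ => (k : ℝ))).comp (measurable_numL hS)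
  have hm' : Measurable fun z : Fin n ⊕ Fin n → E => (numR S z : ℝ) :=
    (measurable_from_top (f := fun k : ℕ => (k : ℝ))).comp (measurable_numR hS)
  have key : ∀ f : (Fin n ⊕ Fin n → E) → ℕ, ∫⁻ z, ENNReal.ofReal |f z - n * μ.real S|
      ∂(Measure.pi fun _ => μ) ≤ ENNReal.ofReal √(n * μ.real S) →
      ∫⁻ z, gap (f z) k ∂(Measure.pi fun _ => μ) ≤
        ENNReal.ofReal (√(n * μ.real S) + |n * μ.real S - k|) := by
    intro f hf
    calc _ ≤ ∫⁻ z, (ENNReal.ofReal |f z - n * μ.real S| + ENNReal.ofReal |n * μ.real S - k|)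
          ∂(Measure.pi fun _ => μ) := by
          refine lintegral_mono fun z => ?_
          rw [← ENNReal.ofReal_add (abs_nonneg _) (abs_nonneg _), gap]
          exact ENNReal.ofReal_le_ofReal (abs_sub_le _ _ _)
      _ ≤ _ := by
          rw [lintegral_add_right _ measurable_const, ENNReal.ofReal_add (Real.sqrt_nonneg _)
            (abs_nonneg _)]
          gcongr
          simp
  have h1 := lintegral_abs_numL_sub_le (ι := Fin n) (ι' := Fin n) μ hS
  have h2 := lintegral_abs_numR_sub_le (ι := Fin n) (ι' := Fin n) μ hS
  rw [Fintype.card_fin] at h1 h2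
  rw [two_mul, ENNReal.ofReal_add (by positivity) (by positivity), lintegral_add_left]
  · exact add_le_add (key _ h1) (key _ h2)
  · exact (hm.sub_const _).norm.ennreal_ofReal

/-- Given their numbers, the points in `S` are independent with the conditional law. The Lipschitz
bound then replaces the random numbers by `k`, at the price of fluctuation plus bias.
`meanCost_le_lintegral_locCost` is the reverse comparison. -/
theorem lintegral_locCost_le_meanCost (hκ : Measurable (Function.uncurry κ)) (n k : ℕ)
    (μ : Measure E) [IsProbabilityMeasure μ] {S : Set E} (hS : MeasurableSet S) (h0 : μ S ≠ 0)
    (D : ℝ≥0∞) :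
    ∫⁻ z : Fin n ⊕ Fin n → E, locCost κ (fun _ => D) S z ∂(Measure.pi fun _ => μ) ≤
      meanCost κ (fun _ => D) (μ[|S]) k k +
        D * ENNReal.ofReal (2 * (√(n * μ.real S) + |n * μ.real S - k|)) := by
  have := cond_isProbabilityMeasure h0
  rw [lintegral_locCost hκ measurable_const hS]
  calc _ ≤ ∫⁻ z : Fin n ⊕ Fin n → E, (meanCost κ (fun _ => D) (μ[|S]) k k +
        D * (gap (numL S z) k + gap (numR S z) k)) ∂(Measure.pi fun _ => μ) :=
        lintegral_mono fun z => meanCost_le_add_gap hκ _ _ _ _ _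
    _ ≤ _ := by
      rw [lintegral_add_left measurable_const, lintegral_const_mul _ (measurable_gap_const n k hS)]
      gcongr
      · simp
      · exact lintegral_gap_const_le n k μ hS

theorem meanCost_le_lintegral_locCost (hκ : Measurable (Function.uncurry κ)) (n k : ℕ)
    (μ : Measure E) [IsProbabilityMeasure μ] {S : Set E} (hS : MeasurableSet S) (h0 : μ S ≠ 0)
    (D : ℝ≥0∞) :
    meanCost κ (fun _ => D) (μ[|S]) k k ≤
      ∫⁻ z : Fin n ⊕ Fin n → E, locCost κ (fun _ => D) S z ∂(Measure.pi fun _ => μ) +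
        D * ENNReal.ofReal (2 * (√(n * μ.real S) + |n * μ.real S - k|)) := by
  have := cond_isProbabilityMeasure h0
  rw [lintegral_locCost hκ measurable_const hS]
  calc _ = ∫⁻ z : Fin n ⊕ Fin n → E, meanCost κ (fun _ => D) (μ[|S]) k k
        ∂(Measure.pi fun _ => μ) := by simp
    _ ≤ ∫⁻ z : Fin n ⊕ Fin n → E, (meanCost κ (fun _ => D) (μ[|S]) (numL S z) (numR S z) +
        D * (gap (numL S z) k + gap (numR S z) k)) ∂(Measure.pi fun _ => μ) :=
        lintegral_mono fun z => by
          rw [gap_comm, gap_comm (numR S z)]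
          exact meanCost_le_add_gap hκ _ _ _ _ _
    _ ≤ _ := by
      rw [lintegral_add_right _ ((measurable_gap_const n k hS).const_mul _),
        lintegral_const_mul _ (measurable_gap_const n k hS)]
      gcongr
      exact lintegral_gap_const_le n k μ hS

/-- The factor `4` arises from `2k` points whose displacement changes the cost by at most `2 * D`
each. -/
theorem meanCost_le_of_le_add (hκ : Measurable (Function.uncurry κ)) {ν ν' ρ : Measure E}
    [IsProbabilityMeasure ν] [IsProbabilityMeasure ν'] (h : ν ≤ ν' + ρ) (k : ℕ) (D : ℝ≥0∞) :
    meanCost κ (fun _ => D) ν k k ≤ meanCost κ (fun _ => D) ν' k k +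
      4 * D * (k * ρ Set.univ) := by
  classical
  refine (lintegral_pi_le_of_le_add h (C := 2 * D) (measurable_locCost hκ measurable_const .univ)
    fun z i x => locCost_le_update i x).trans (le_of_eq ?_)
  rw [meanCost, Fintype.card_sum, Fintype.card_fin]
  push_cast
  ring

end Conditioning

/-! ### Scaling and translation; the cost of a uniform cube. -/

section Scaling

variable {α β : Type*}

theorem pmCost_const_mul {c : α → β → ℝ≥0∞} {a : α → ℝ≥0∞} {b : β → ℝ≥0∞} {r : ℝ≥0∞}
    (hr : r ≠ 0) (hr' : r ≠ ⊤) (A : Multiset α) (B : Multiset β) :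
    pmCost (fun x y => r * c x y) (fun x => r * a x) (fun y => r * b y) A B =
      r * pmCost c a b A B := by
  unfold pmCost
  simp only [ENNReal.mul_iInf_of_ne hr hr', Multiset.sum_map_mul_left, mul_add]

variable {d : ℕ} {p : ℝ}

theorem powCost_affine (hp : 0 ≤ p) {t : ℝ} (ht : 0 < t) (v x y : EuclideanSpace ℝ (Fin d)) :
    powCost d p (t • x + v) (t • y + v) = ENNReal.ofReal (t ^ p) * powCost d p x y := by
  rw [powCost, powCost, edist_add_right, edist_smul₀, ENNReal.smul_def, smul_eq_mul,
    ENNReal.mul_rpow_of_nonneg _ _ hp]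
  congr 1
  rw [← ENNReal.ofReal_rpow_of_pos ht]
  congr 1
  rw [ENNReal.ofReal, Real.toNNReal_eq_nnnorm_of_nonneg ht.le]

theorem meanCost_map_affine (hp : 0 ≤ p) {t : ℝ} (ht : 0 < t) (v : EuclideanSpace ℝ (Fin d))
    (ν : Measure (EuclideanSpace ℝ (Fin d))) [IsProbabilityMeasure ν] (D : ℝ≥0∞) (k l : ℕ) :
    meanCost (powCost d p) (fun _ => ENNReal.ofReal (t ^ p) * D) (ν.map fun x => t • x + v) k l =
      ENNReal.ofReal (t ^ p) * meanCost (powCost d p) (fun _ => D) ν k l := by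
  have hφ : Measurable fun x : EuclideanSpace ℝ (Fin d) => t • x + v := by fun_prop
  have : IsProbabilityMeasure (ν.map fun x => t • x + v) :=
    Measure.isProbabilityMeasure_map hφ.aemeasurable
  have hpi := Measure.pi_map_pi (ι := Fin k ⊕ Fin l) (μ := fun _ => ν)
    (f := fun _ x => t • x + v) fun _ => hφ.aemeasurable
  rw [meanCost, ← hpi, lintegral_map (measurable_locCost (measurable_powCost p)
    measurable_const .univ) (by fun_prop), meanCost, ← lintegral_const_mul _
    (measurable_locCost (measurable_powCost p) measurable_const .univ)]
  refine lintegral_congr fun z => ?_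
  simp only [locCost, powCost_affine hp ht, idxIn_univ]
  exact pmCost_const_mul (by simpa using Real.rpow_pos_of_pos ht p) ENNReal.ofReal_ne_top _ _

/-- The affine map multiplies Lebesgue measure by a constant, which cancels in the conditional law.
-/
theorem cond_map_affine {t : ℝ} (ht : 0 < t) (v : EuclideanSpace ℝ (Fin d))
    {Q : Set (EuclideanSpace ℝ (Fin d))} (hQ : MeasurableSet Q) :
    (volume[|(fun x => t • x + v) ⁻¹' Q]).map (fun x => t • x + v) = volume[|Q] := by
  have hφ : Measurable fun x : EuclideanSpace ℝ (Fin d) => t • x + v := by fun_prop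
  have hmap : (volume : Measure (EuclideanSpace ℝ (Fin d))).map (fun x => t • x + v) =
      ENNReal.ofReal |(t ^ d)⁻¹| • volume := by
    have h := Measure.map_addHaar_smul (volume : Measure (EuclideanSpace ℝ (Fin d))) ht.ne'
    rw [finrank_euclideanSpace_fin] at h
    have hcomp : (fun x : EuclideanSpace ℝ (Fin d) => t • x + v) = (fun x => x + v) ∘ (t • ·) := rfl
    rw [hcomp, ← Measure.map_map (by fun_prop) (by fun_prop), h, Measure.map_smul,
      map_add_right_eq_self]
  have hc0 : ENNReal.ofReal |(t ^ d)⁻¹| ≠ 0 :=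
    (ENNReal.ofReal_pos.2 (abs_pos.2 (by positivity))).ne'
  have hvol : volume ((fun x : EuclideanSpace ℝ (Fin d) => t • x + v) ⁻¹' Q) =
      ENNReal.ofReal |(t ^ d)⁻¹| * volume Q := by
    rw [← Measure.map_apply hφ hQ, hmap, Measure.smul_apply, smul_eq_mul]
  rw [ProbabilityTheory.cond, ProbabilityTheory.cond, Measure.map_smul, ← Measure.restrict_map hφ hQ, hmap,
    Measure.restrict_smul, smul_smul, hvol, ENNReal.mul_inv (.inl hc0) (.inl ENNReal.ofReal_ne_top),
    mul_comm, ← mul_assoc, ENNReal.mul_inv_cancel hc0 ENNReal.ofReal_ne_top, one_mul]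

/-- The expected cost of matching two samples of `k` uniform points in the unit cube. -/
noncomputable def cubeCost (d : ℕ) (p : ℝ) (k : ℕ) : ℝ≥0∞ :=
  meanCost (powCost d p) (fun _ => cellCost d p 1) (volume[|cellIdx (d := d) 1 ⁻¹' {0}]) k k

theorem isProbabilityMeasure_cell {t : ℝ} (ht : 0 < t) (z : Fin d → ℤ) :
    IsProbabilityMeasure (volume[|cellIdx (d := d) t ⁻¹' {z}]) := by
  refine cond_isProbabilityMeasure_of_finite ?_ ?_
  · rw [volume_cell ht]
    simpa using pow_pos ht d
  · rw [volume_cell ht]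
    exact ENNReal.ofReal_ne_top

theorem cellCost_eq {t : ℝ} (ht : 0 < t) :
    cellCost d p t = ENNReal.ofReal (t ^ p) * cellCost d p 1 := by
  rw [cellCost, cellCost, ← ENNReal.ofReal_mul (by positivity), mul_one,
    Real.mul_rpow (by positivity) ht.le, mul_comm]

theorem meanCost_cell (hp : 0 ≤ p) {t : ℝ} (ht : 0 < t) (z : Fin d → ℤ) (k : ℕ) :
    meanCost (powCost d p) (fun _ => cellCost d p t) (volume[|cellIdx (d := d) t ⁻¹' {z}]) k k =
      ENNReal.ofReal (t ^ p) * cubeCost d p k := by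
  have := isProbabilityMeasure_cell (d := d) one_pos 0
  -- The corner of the cube of index `z`, so that `x ↦ t • x + v` carries the unit cube onto it.
  let v : EuclideanSpace ℝ (Fin d) := WithLp.toLp 2 fun i => t * z i
  have hpre : (fun x : EuclideanSpace ℝ (Fin d) => t • x + v) ⁻¹' (cellIdx t ⁻¹' {z}) =
      cellIdx 1 ⁻¹' {0} := by
    ext x
    simp only [Set.mem_preimage, Set.mem_singleton_iff, funext_iff, cellIdx]
    refine forall_congr' fun i => ?_
    have h : (t • x + v) i / t = x i / 1 + z i := by
      simp [v]
      field_simp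
    rw [h, Int.floor_add_intCast]
    simp
  have h := cond_map_affine ht v (measurableSet_cell t z)
  rw [hpre] at h
  rw [← h, cellCost_eq ht, cubeCost, meanCost_map_affine hp ht]

end Scaling

/-! ### A priori bounds for bounded sets and for compact null sets. -/

section MeanBounds

variable {d : ℕ} {p : ℝ}

theorem tsum_measure_inter_cell (μ : Measure (EuclideanSpace ℝ (Fin d))) (t : ℝ)
    (S : Set (EuclideanSpace ℝ (Fin d))) :
    ∑' k, μ (S ∩ cellIdx t ⁻¹' {k}) = μ S := by
  simp_rw [Set.inter_comm S, ← Measure.restrict_apply (measurableSet_cell t _)]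
  rw [← measure_iUnion, ← Set.preimage_iUnion, Set.iUnion_of_singleton, Set.preimage_univ,
    Measure.restrict_apply_univ]
  · exact fun k l hkl => Set.disjoint_left.2 fun x hx hx' =>
      hkl ((show cellIdx t x = k from hx) ▸ (show cellIdx t x = l from hx'))
  · exact measurableSet_cell t

/-- For `s ≤ R` the thickening stays in the ball of radius `(1 + √d) * R`. This supplies the volume
hypothesis of the multiscale bound. -/
theorem exists_volume_cthickening_le (d : ℕ) : ∃ v : ℝ, 0 < v ∧
    ∀ (S : Set (EuclideanSpace ℝ (Fin d))) (R s : ℝ), S ⊆ Metric.closedBall 0 R → 0 < s →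
      s ≤ R → volume (Metric.cthickening (√d * s) S) ≤ ENNReal.ofReal (v * R ^ d) := by
  refine ⟨(1 + √d) ^ d * (volume (Metric.ball (0 : EuclideanSpace ℝ (Fin d)) 1)).toReal, ?_, ?_⟩
  · have := Metric.measure_ball_pos (volume : Measure (EuclideanSpace ℝ (Fin d))) 0 one_pos
    have h2 := measure_ball_lt_top (μ := (volume : Measure (EuclideanSpace ℝ (Fin d))))
      (x := 0) (r := 1)
    have := ENNReal.toReal_pos this.ne' h2.ne
    positivity
  · intro S R s hS hs hsR
    have hR : 0 < R := hs.trans_le hsR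
    have h1 : Metric.cthickening (√d * s) S ⊆ Metric.closedBall 0 (R + √d * R) := by
      refine (Metric.cthickening_subset_of_subset _ hS).trans ?_
      refine (cthickening_closedBall (by positivity) hR.le _).subset.trans ?_
      refine Metric.closedBall_subset_closedBall ?_
      rw [add_comm]
      gcongr
    refine (measure_mono h1).trans (le_of_eq ?_)
    rw [Measure.addHaar_closedBall _ _ (by positivity), finrank_euclideanSpace_fin,
      show R + √d * R = (1 + √d) * R by ring, mul_pow, mul_assoc, mul_comm (ENNReal.toReal _),
      ← mul_assoc, ENNReal.ofReal_mul (by positivity), mul_right_comm ((1 + √d) ^ d),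
      ENNReal.ofReal_mul (by positivity), ENNReal.ofReal_mul (by positivity),
      ENNReal.ofReal_toReal measure_ball_lt_top.ne, mul_right_comm]

/-- The expected cost of matching in a bounded region is of order `(n μ(S)) ^ (1 - p / d)`. -/
theorem exists_lintegral_locCost_le (hp : 0 < p) (hpd : 2 * p < d) :
    ∃ C : ℝ, 0 < C ∧ ∀ (μ : Measure (EuclideanSpace ℝ (Fin d))) [IsProbabilityMeasure μ] (n : ℕ)
      (S : Set (EuclideanSpace ℝ (Fin d))) (R D : ℝ), MeasurableSet S → 0 < R →
      S ⊆ Metric.closedBall 0 R → 0 ≤ D → D ≤ (4 * R) ^ p →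
      ∫⁻ z : Fin n ⊕ Fin n → EuclideanSpace ℝ (Fin d),
        locCost (powCost d p) (fun _ => ENNReal.ofReal D) S z ∂(Measure.pi fun _ => μ) ≤
      ENNReal.ofReal (C * R ^ p * (n * μ.real S) ^ (1 - p / d)) := by
  have hd : 0 < (d : ℝ) := by linarith
  obtain ⟨C₀, hC₀, hH⟩ := exists_hierarchical_bound hp hpd
  obtain ⟨v, hv, hV⟩ := exists_volume_cthickening_le d
  have hpd' : p / d < 1 / 2 := by rw [div_lt_div_iff₀ hd (by norm_num)]; linarith
  refine ⟨2 * √d ^ p + C₀ * √v * (1 + 4 ^ p) + 2 * 4 ^ p, by positivity, ?_⟩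
  intro μ _ n S R D hS hR hSR hD hDR
  set W := n * μ.real S with hW
  have hW0 : 0 ≤ W := by positivity
  have hnW : (n : ℝ≥0∞) * μ S = ENNReal.ofReal W := by
    rw [hW, ENNReal.ofReal_mul (by positivity), ENNReal.ofReal_natCast, ofReal_measureReal]
  have h4R : (4 * R) ^ p = 4 ^ p * R ^ p := Real.mul_rpow (by norm_num) hR.le
  -- With at most one expected point, leaving all points unmatched is enough, since then `W ≤ W ^ (1
  -- - p / d)`.
  rcases le_or_gt W 1 with hW1 | hW1
  · refine (lintegral_locCost_le_card n μ hS _).trans ?_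
    rw [hnW, ← ENNReal.ofReal_ofNat 2, ← ENNReal.ofReal_mul (by norm_num),
      ← ENNReal.ofReal_mul (by positivity)]
    refine ENNReal.ofReal_le_ofReal ?_
    have hWp : W ≤ W ^ (1 - p / d) := by
      rcases hW0.eq_or_lt with h | h
      · rw [← h, Real.zero_rpow (by linarith)]
      · conv_lhs => rw [← Real.rpow_one W]
        have : 0 < p / d := by positivity
        exact Real.rpow_le_rpow_of_exponent_ge h hW1 (by linarith)
    calc 2 * D * W ≤ 2 * (4 ^ p * R ^ p) * W ^ (1 - p / d) := by
          rw [← h4R]; gcongr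
      _ = (0 + 2 * 4 ^ p) * R ^ p * W ^ (1 - p / d) := by ring
      _ ≤ _ := by gcongr; positivity
  · have hWpos : 0 < W := by linarith
    -- The scale at which about `W` cubes fill a region of size `R`, that is, about one point per
    -- cube on average. The finest-scale cost and the multiscale error then have the same order.
    set t := R * W ^ (-(1 / d : ℝ)) with ht
    have ht0 : 0 < t := by positivity
    have htR : t ≤ R := by
      refine mul_le_of_le_one_right hR.le (Real.rpow_le_one_of_one_le_of_nonpos hW1.le ?_)
      have : 0 < 1 / (d : ℝ) := by positivity
      linarith
    refine (hH μ n S (v * R ^ d) R t D hS ht0 htR hD (by positivity)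
      fun s hs hsR => hV S R s hSR hs hsR).trans ?_
    have hsum : ∑' k, ∫⁻ z : Fin n ⊕ Fin n → EuclideanSpace ℝ (Fin d),
        locCost (powCost d p) (fun _ => cellCost d p t) (S ∩ cellIdx t ⁻¹' {k}) z
          ∂(Measure.pi fun _ => μ) ≤ ENNReal.ofReal (2 * (√d * t) ^ p * W) := by
      calc _ ≤ ∑' k, 2 * cellCost d p t * (n * μ (S ∩ cellIdx t ⁻¹' {k})) :=
            ENNReal.tsum_le_tsum fun k =>
              lintegral_locCost_le_card n μ (hS.inter (measurableSet_cell t k)) _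
        _ = 2 * cellCost d p t * (n * μ S) := by
            rw [ENNReal.tsum_mul_left, ENNReal.tsum_mul_left, tsum_measure_inter_cell]
        _ = _ := by
            rw [hnW, cellCost, ← ENNReal.ofReal_ofNat 2, ← ENNReal.ofReal_mul (by norm_num),
              ← ENNReal.ofReal_mul (by positivity)]
    refine (add_le_add_left hsum _).trans ?_
    rw [← ENNReal.ofReal_add (by positivity) (by positivity)]
    refine ENNReal.ofReal_le_ofReal ?_
    have e1 : (√d * t) ^ p * W = √d ^ p * R ^ p * W ^ (1 - p / d) := by
      rw [ht, Real.mul_rpow (by positivity) (by positivity), Real.mul_rpow hR.le (by positivity),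
        ← Real.rpow_mul hW0, sub_eq_neg_add, Real.rpow_add hWpos, Real.rpow_one]
      ring_nf
    have e2 : √(W * (v * R ^ d)) = √v * W ^ (1 / 2 : ℝ) * R ^ (d / 2 : ℝ) := by
      rw [Real.sqrt_mul hW0, Real.sqrt_mul hv.le, Real.sqrt_eq_rpow W, Real.sqrt_eq_rpow (R ^ d),
        ← Real.rpow_natCast R, ← Real.rpow_mul hR.le]
      ring_nf
    have e3 : W ^ (1 / 2 : ℝ) * R ^ (d / 2 : ℝ) * t ^ (p - d / 2) = R ^ p * W ^ (1 - p / d) := by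
      rw [ht, Real.mul_rpow hR.le (by positivity), ← Real.rpow_mul hW0]
      have h1 : R ^ p = R ^ (d / 2 : ℝ) * R ^ (p - d / 2) := by
        rw [← Real.rpow_add hR]; ring_nf
      have h2 : W ^ (1 - p / d) = W ^ (1 / 2 : ℝ) * W ^ (-(1 / d : ℝ) * (p - d / 2)) := by
        rw [← Real.rpow_add hWpos]; congr 1; field_simp; ring
      rw [h1, h2]; ring
    have e4 : W ^ (1 / 2 : ℝ) * R ^ (d / 2 : ℝ) * (D * R ^ (-(d / 2 : ℝ))) ≤
        4 ^ p * (R ^ p * W ^ (1 - p / d)) := by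
      calc _ = D * W ^ (1 / 2 : ℝ) * (R ^ (d / 2 : ℝ) * R ^ (-(d / 2 : ℝ))) := by ring
        _ = D * W ^ (1 / 2 : ℝ) := by rw [← Real.rpow_add hR]; simp
        _ ≤ (4 ^ p * R ^ p) * W ^ (1 - p / d) := by
          rw [← h4R]
          gcongr
          · exact hW1.le
          · linarith
        _ = _ := by ring
    have e5 : C₀ * √(W * (v * R ^ d)) * (t ^ (p - d / 2) + D * R ^ (-(d / 2 : ℝ))) ≤
        C₀ * √v * (1 + 4 ^ p) * (R ^ p * W ^ (1 - p / d)) := by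
      rw [e2]
      calc _ = C₀ * √v * (W ^ (1 / 2 : ℝ) * R ^ (d / 2 : ℝ) * t ^ (p - d / 2) +
            W ^ (1 / 2 : ℝ) * R ^ (d / 2 : ℝ) * (D * R ^ (-(d / 2 : ℝ)))) := by ring
        _ ≤ C₀ * √v * (R ^ p * W ^ (1 - p / d) + 4 ^ p * (R ^ p * W ^ (1 - p / d))) := by
          rw [e3]; gcongr
        _ = _ := by ring
    calc _ ≤ 2 * (√d ^ p * R ^ p * W ^ (1 - p / d)) +
          C₀ * √v * (1 + 4 ^ p) * (R ^ p * W ^ (1 - p / d)) := by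
          rw [mul_assoc 2, e1]; gcongr
      _ = (2 * √d ^ p + C₀ * √v * (1 + 4 ^ p) + 0) * R ^ p * W ^ (1 - p / d) := by ring
      _ ≤ _ := by gcongr; positivity

/-- For a compact set, the volumes of shrinking closed thickenings converge to the volume of the set
itself. -/
theorem tendsto_volume_cthickening {K : Set (EuclideanSpace ℝ (Fin d))} (hK : IsCompact K)
    (h0 : volume K = 0) {ε : ℝ} (hε : 0 < ε) :
    ∃ T, 0 < T ∧ ∀ s, 0 < s → s ≤ T →
      volume (Metric.cthickening (√d * s) K) ≤ ENNReal.ofReal ε := by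
  have h := tendsto_measure_cthickening_of_isCompact (μ := volume) hK
  rw [h0] at h
  have h1 : Tendsto (fun s : ℝ => √d * s) (𝓝 0) (𝓝 0) := by
    have : Continuous fun s : ℝ => √d * s := by fun_prop
    simpa using this.tendsto 0
  have h2 := (h.comp h1).eventually (ge_mem_nhds (ENNReal.ofReal_pos.2 hε))
  obtain ⟨T, hT, h3⟩ := Metric.eventually_nhds_iff.1 h2
  refine ⟨T / 2, by positivity, fun s hs hsT => h3 ?_⟩
  rw [Real.dist_eq, sub_zero, abs_of_pos hs]
  linarith

/-- Points falling in a compact Lebesgue-null set are matched at a negligible cost. -/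
theorem tendsto_lintegral_locCost_null (hp : 0 < p) (hpd : 2 * p < d)
    (μ : Measure (EuclideanSpace ℝ (Fin d))) [IsProbabilityMeasure μ]
    {K : Set (EuclideanSpace ℝ (Fin d))} (hK : IsCompact K) (h0 : volume K = 0) {D : ℝ}
    (hD : 0 ≤ D) :
    Tendsto (fun n : ℕ => ENNReal.ofReal ((n : ℝ) ^ (p / d - 1)) *
      ∫⁻ z : Fin n ⊕ Fin n → EuclideanSpace ℝ (Fin d),
        locCost (powCost d p) (fun _ => ENNReal.ofReal D) K z ∂(Measure.pi fun _ => μ))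
      atTop (𝓝 0) := by
  have hd : 0 < (d : ℝ) := by linarith
  have hpd' : p / d < 1 / 2 := by rw [div_lt_div_iff₀ hd (by norm_num)]; linarith
  obtain ⟨C₀, hC₀, hH⟩ := exists_hierarchical_bound hp hpd
  -- A bound with a free parameter `δ`.
  have key : ∀ δ : ℝ, 0 < δ → ∃ T, 0 < T ∧ ∀ n : ℕ, 0 < n → δ * (n : ℝ) ^ (-(1 / d : ℝ)) ≤ T →
      ENNReal.ofReal ((n : ℝ) ^ (p / d - 1)) *
      ∫⁻ z : Fin n ⊕ Fin n → EuclideanSpace ℝ (Fin d),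
        locCost (powCost d p) (fun _ => ENNReal.ofReal D) K z ∂(Measure.pi fun _ => μ) ≤
      ENNReal.ofReal ((2 * √d ^ p + C₀) * δ ^ p +
        C₀ * δ ^ (d / 2 : ℝ) * D * T ^ (-(d / 2 : ℝ)) * (n : ℝ) ^ (p / d - 1 / 2)) := by
    intro δ hδ
    -- With volume `δ ^ d` and side `δ * n ^ (-1/d)`, the scaled finest cost and the scaled
    -- multiscale error are both of order `δ ^ p`. The term containing `T` carries a negative power
    -- of `n`.
    obtain ⟨T, hT, hV⟩ := tendsto_volume_cthickening hK h0 (ε := δ ^ d) (by positivity)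
    refine ⟨T, hT, fun n hn htT => ?_⟩
    have hn' : (0 : ℝ) < n := by exact_mod_cast hn
    set t := δ * (n : ℝ) ^ (-(1 / d : ℝ)) with ht
    have ht0 : 0 < t := by positivity
    have h1 := hH μ n K (δ ^ d) T t D hK.measurableSet ht0 htT hD (by positivity) hV
    have hsum : ∑' k, ∫⁻ z : Fin n ⊕ Fin n → EuclideanSpace ℝ (Fin d),
        locCost (powCost d p) (fun _ => cellCost d p t) (K ∩ cellIdx t ⁻¹' {k}) z
          ∂(Measure.pi fun _ => μ) ≤ ENNReal.ofReal (2 * (√d * t) ^ p * n) := by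
      calc _ ≤ ∑' k, 2 * cellCost d p t * (n * μ (K ∩ cellIdx t ⁻¹' {k})) :=
            ENNReal.tsum_le_tsum fun k => lintegral_locCost_le_card n μ
              (hK.measurableSet.inter (measurableSet_cell t k)) _
        _ = 2 * cellCost d p t * (n * μ K) := by
            rw [ENNReal.tsum_mul_left, ENNReal.tsum_mul_left, tsum_measure_inter_cell]
        _ ≤ 2 * cellCost d p t * (n * 1) := by gcongr; exact prob_le_one
        _ = _ := by
            rw [mul_one, cellCost, ← ENNReal.ofReal_ofNat 2, ← ENNReal.ofReal_mul (by norm_num),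
              ← ENNReal.ofReal_natCast n, ← ENNReal.ofReal_mul (by positivity)]
    have h2 := h1.trans (add_le_add_left hsum _)
    rw [← ENNReal.ofReal_add (by positivity) (by positivity)] at h2
    refine (mul_le_mul_right h2 _).trans ?_
    rw [← ENNReal.ofReal_mul (by positivity)]
    refine ENNReal.ofReal_le_ofReal ?_
    have e1 : (n : ℝ) ^ (p / d - 1) * (t ^ p * n) = δ ^ p := by
      have : (n : ℝ) ^ (p / d - 1) * ((n : ℝ) ^ (-(1 / d : ℝ) * p) * (n : ℝ) ^ (1 : ℝ)) = 1 := by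
        rw [← Real.rpow_add hn', ← Real.rpow_add hn']
        rw [show p / d - 1 + (-(1 / d : ℝ) * p + 1) = 0 by ring, Real.rpow_zero]
      rw [Real.rpow_one] at this
      rw [ht, Real.mul_rpow hδ.le (by positivity), ← Real.rpow_mul hn'.le]
      linear_combination δ ^ p * this
    have e2 : √(n * μ.real K * δ ^ d) ≤ (n : ℝ) ^ (1 / 2 : ℝ) * δ ^ (d / 2 : ℝ) := by
      calc _ ≤ √(n * 1 * δ ^ d) := by gcongr; exact measureReal_le_one
        _ = _ := by
          rw [mul_one, Real.sqrt_mul hn'.le, Real.sqrt_eq_rpow, Real.sqrt_eq_rpow,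
            ← Real.rpow_natCast δ, ← Real.rpow_mul hδ.le]
          ring_nf
    have e3 : (n : ℝ) ^ (p / d - 1) * ((n : ℝ) ^ (1 / 2 : ℝ) * δ ^ (d / 2 : ℝ) *
        t ^ (p - d / 2)) = δ ^ p := by
      have h1 : (n : ℝ) ^ (p / d - 1) * ((n : ℝ) ^ (1 / 2 : ℝ) *
          (n : ℝ) ^ (-(1 / d : ℝ) * (p - d / 2))) = 1 := by
        rw [← Real.rpow_add hn', ← Real.rpow_add hn']
        rw [show p / d - 1 + (1 / 2 + -(1 / d : ℝ) * (p - d / 2)) = 0 by field_simp; ring,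
          Real.rpow_zero]
      have h2 : δ ^ (d / 2 : ℝ) * δ ^ (p - d / 2) = δ ^ p := by
        rw [← Real.rpow_add hδ]; ring_nf
      rw [ht, Real.mul_rpow hδ.le (by positivity), ← Real.rpow_mul hn'.le]
      linear_combination δ ^ (d / 2 : ℝ) * δ ^ (p - d / 2) * h1 + h2
    have e4 : (n : ℝ) ^ (p / d - 1) * (n : ℝ) ^ (1 / 2 : ℝ) = (n : ℝ) ^ (p / d - 1 / 2) := by
      rw [← Real.rpow_add hn']; ring_nf
    calc (n : ℝ) ^ (p / d - 1) * (2 * (√d * t) ^ p * n + C₀ * √(n * μ.real K * δ ^ d) *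
          (t ^ (p - d / 2) + D * T ^ (-(d / 2 : ℝ)))) ≤
          (n : ℝ) ^ (p / d - 1) * (2 * (√d ^ p * t ^ p) * n + C₀ * ((n : ℝ) ^ (1 / 2 : ℝ) *
          δ ^ (d / 2 : ℝ)) * (t ^ (p - d / 2) + D * T ^ (-(d / 2 : ℝ)))) := by
          rw [Real.mul_rpow (by positivity) ht0.le]
          gcongr
      _ = 2 * √d ^ p * ((n : ℝ) ^ (p / d - 1) * (t ^ p * n)) +
          C₀ * ((n : ℝ) ^ (p / d - 1) * ((n : ℝ) ^ (1 / 2 : ℝ) * δ ^ (d / 2 : ℝ) *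
          t ^ (p - d / 2))) + C₀ * δ ^ (d / 2 : ℝ) * D * T ^ (-(d / 2 : ℝ)) *
          ((n : ℝ) ^ (p / d - 1) * (n : ℝ) ^ (1 / 2 : ℝ)) := by ring
      _ = _ := by rw [e1, e3, e4]; ring
  rw [ENNReal.tendsto_nhds_zero]
  intro ε hε
  obtain ⟨ε', hε'0, hε'⟩ : ∃ ε' : ℝ, 0 < ε' ∧ ENNReal.ofReal ε' ≤ ε := by
    rcases eq_or_ne ε ⊤ with rfl | h
    · exact ⟨1, one_pos, le_top⟩
    · exact ⟨ε.toReal, ENNReal.toReal_pos hε.ne' h, ENNReal.ofReal_toReal_le⟩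
  obtain ⟨δ, hδ0, hδ⟩ : ∃ δ : ℝ, 0 < δ ∧ (2 * √d ^ p + C₀) * δ ^ p < ε' := by
    have hc : Tendsto (fun δ : ℝ => (2 * √d ^ p + C₀) * δ ^ p) (𝓝[>] 0) (𝓝 0) := by
      have h : ContinuousAt (fun δ : ℝ => (2 * √d ^ p + C₀) * δ ^ p) 0 :=
        continuousAt_const.mul (Real.continuousAt_rpow_const _ _ (Or.inr hp.le))
      have h' := h.tendsto.mono_left (nhdsWithin_le_nhds (s := Set.Ioi 0))
      simpa [Real.zero_rpow hp.ne'] using h'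
    obtain ⟨δ, h1, h2⟩ := ((hc.eventually (gt_mem_nhds hε'0)).and self_mem_nhdsWithin).exists
    exact ⟨δ, h2, h1⟩
  obtain ⟨T, hT, hkey⟩ := key δ hδ0
  have hlim1 : Tendsto (fun n : ℕ => δ * (n : ℝ) ^ (-(1 / d : ℝ))) atTop (𝓝 0) := by
    have := (tendsto_rpow_neg_atTop (show 0 < 1 / (d : ℝ) by positivity)).comp
      tendsto_natCast_atTop_atTop
    simpa using this.const_mul δ
  have hlim2 : Tendsto (fun n : ℕ => (2 * √d ^ p + C₀) * δ ^ p + C₀ * δ ^ (d / 2 : ℝ) * D *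
      T ^ (-(d / 2 : ℝ)) * (n : ℝ) ^ (p / d - 1 / 2)) atTop (𝓝 ((2 * √d ^ p + C₀) * δ ^ p)) := by
    have := (tendsto_rpow_neg_atTop (show 0 < 1 / 2 - p / (d : ℝ) by linarith)).comp
      tendsto_natCast_atTop_atTop
    have h2 := (this.const_mul (C₀ * δ ^ (d / 2 : ℝ) * D * T ^ (-(d / 2 : ℝ)))).const_add
      ((2 * √d ^ p + C₀) * δ ^ p)
    simpa [Function.comp_def] using h2
  filter_upwards [hlim1.eventually (ge_mem_nhds hT), hlim2.eventually (gt_mem_nhds hδ),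
    eventually_gt_atTop 0] with n h1 h2 h3
  exact (hkey n h3 h1).trans ((ENNReal.ofReal_le_ofReal h2.le).trans hε')

end MeanBounds

/-! ### Comparison with uniform points in small cubes. -/

section Prelimit

variable {d : ℕ} {p : ℝ}

@[simp] theorem cubeCost_zero : cubeCost d p 0 = 0 := by
  have : ∀ z : Fin 0 ⊕ Fin 0 → EuclideanSpace ℝ (Fin d),
      locCost (powCost d p) (fun _ => cellCost d p 1) Set.univ z = 0 := by
    intro z
    simp only [locCost, idxIn_univ, Finset.univ_eq_empty, Finset.empty_val]
    exact pmCost_zero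
  simp [cubeCost, meanCost, this]

open Classical in
/-- A bound on the number of cubes of side `t` that meet `S`. -/
theorem tsum_ite_nonempty_le {t V : ℝ} (ht : 0 < t) {S : Set (EuclideanSpace ℝ (Fin d))}
    (hV : volume (Metric.cthickening (√d * t) S) ≤ ENNReal.ofReal V) (hV0 : 0 ≤ V) :
    ∑' k, (if (S ∩ cellIdx t ⁻¹' {k}).Nonempty then (1 : ℝ≥0∞) else 0) ≤
      ENNReal.ofReal (V / t ^ d) := by
  have hfin := finite_cells ht hV hV0
  rw [tsum_eq_sum (s := hfin.toFinset)]
  · rw [Finset.sum_congr rfl (g := fun _ => (1 : ℝ≥0∞))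
      fun k hk => if_pos (by simpa using hk), Finset.sum_const, nsmul_eq_mul, mul_one,
      ← ENNReal.ofReal_natCast]
    exact ENNReal.ofReal_le_ofReal (card_cells_le ht hV hV0 _ fun k hk => by simpa using hk)
  · intro k hk
    exact if_neg (by simpa using hk)

open Classical in
/-- Comparison of a small cube with a small cube with uniform points. -/
theorem lintegral_locCost_cell_le (hp : 0 ≤ p) (μ : Measure (EuclideanSpace ℝ (Fin d)))
    [IsProbabilityMeasure μ] (n : ℕ) {S : Set (EuclideanSpace ℝ (Fin d))} (hS : MeasurableSet S)
    {t : ℝ} (ht : 0 < t) {h : EuclideanSpace ℝ (Fin d) → ℝ≥0∞}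
    (hμ : μ.restrict S = volume.withDensity h) (k : Fin d → ℤ) :
    ∫⁻ z : Fin n ⊕ Fin n → EuclideanSpace ℝ (Fin d),
      locCost (powCost d p) (fun _ => cellCost d p t) (S ∩ cellIdx t ⁻¹' {k}) z
        ∂(Measure.pi fun _ => μ) ≤
    ENNReal.ofReal (t ^ p) * cubeCost d p ⌊n * μ.real (S ∩ cellIdx t ⁻¹' {k})⌋₊ +
    4 * cellCost d p t * (n * ∫⁻ x in cellIdx t ⁻¹' {k},
      (h x - μ (S ∩ cellIdx t ⁻¹' {k}) / ENNReal.ofReal (t ^ d))) +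
    cellCost d p t * ENNReal.ofReal (2 * (√(n * μ.real (S ∩ cellIdx t ⁻¹' {k})) +
      if (S ∩ cellIdx t ⁻¹' {k}).Nonempty then 1 else 0)) := by
  set Q := cellIdx (d := d) t ⁻¹' {k} with hQ
  have hQm : MeasurableSet Q := measurableSet_cell t k
  have hSQ : MeasurableSet (S ∩ Q) := hS.inter hQm
  by_cases h0 : μ (S ∩ Q) = 0
  · refine (lintegral_locCost_le_card n μ hSQ _).trans ?_
    simp [h0]
  have hne : (S ∩ Q).Nonempty := nonempty_of_measure_ne_zero h0
  have hvQ : volume Q = ENNReal.ofReal (t ^ d) := volume_cell ht k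
  have htd : ENNReal.ofReal (t ^ d) ≠ 0 := by simpa using pow_pos ht d
  have := isProbabilityMeasure_cell (d := d) ht k
  have := cond_isProbabilityMeasure h0
  set w := μ.real (S ∩ Q) with hw
  have hfl : |(n : ℝ) * w - ⌊(n : ℝ) * w⌋₊| ≤ 1 := by
    have h1 := Nat.floor_le (show 0 ≤ (n : ℝ) * w by positivity)
    have h2 := Nat.lt_floor_add_one ((n : ℝ) * w)
    rw [abs_le]
    constructor <;> linarith
  refine (lintegral_locCost_le_meanCost (measurable_powCost p) n ⌊(n : ℝ) * w⌋₊ μ hSQ h0 _).trans ?_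
  rw [← hw]
  gcongr
  -- The excess of the conditional law over the uniform law of the cube: the positive part of the
  -- density minus its mean, normalised. The truncated subtraction of `ℝ≥0∞` is intended.
  · let ρ : Measure (EuclideanSpace ℝ (Fin d)) := (μ (S ∩ Q))⁻¹ •
      (volume.restrict Q).withDensity fun x => h x - μ (S ∩ Q) / ENNReal.ofReal (t ^ d)
    have hρ : μ[|S ∩ Q] ≤ volume[|Q] + ρ := by
      have e1 : μ[|S ∩ Q] = (μ (S ∩ Q))⁻¹ • (volume.restrict Q).withDensity h := by
        rw [ProbabilityTheory.cond, Set.inter_comm S, ← Measure.restrict_restrict hQm, hμ,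
          restrict_withDensity hQm]
      have e2 : volume[|Q] = (μ (S ∩ Q))⁻¹ • (volume.restrict Q).withDensity
          fun _ => μ (S ∩ Q) / ENNReal.ofReal (t ^ d) := by
        rw [ProbabilityTheory.cond, withDensity_const, smul_smul, hvQ, div_eq_mul_inv, ← mul_assoc,
          ENNReal.inv_mul_cancel h0 (measure_ne_top _ _), one_mul]
      rw [e1, e2]
      simp only [ρ]
      rw [← smul_add, ← withDensity_add_left measurable_const]
      refine Measure.le_intro fun s hs _ => ?_
      rw [Measure.smul_apply, Measure.smul_apply, smul_eq_mul, smul_eq_mul,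
        withDensity_apply _ hs, withDensity_apply _ hs]
      gcongr with x
      exact le_add_tsub
    refine (meanCost_le_of_le_add (measurable_powCost p) hρ _ _).trans ?_
    rw [hQ, meanCost_cell hp ht, ← hQ]
    gcongr _ + _ * ?_
    simp only [ρ, Measure.smul_apply, smul_eq_mul]
    rw [withDensity_apply _ .univ, Measure.restrict_univ, ← mul_assoc]
    gcongr
    -- The number of points is at most `n` times the mass of the cell, so the normalisation of `ρ`
    -- disappears and the errors can be summed over cells.
    calc ((⌊(n : ℝ) * w⌋₊ : ℕ) : ℝ≥0∞) * (μ (S ∩ Q))⁻¹ ≤ (n * μ (S ∩ Q)) * (μ (S ∩ Q))⁻¹ := by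
          gcongr
          rw [← ENNReal.ofReal_natCast, ← ofReal_measureReal (measure_ne_top _ _),
            ← ENNReal.ofReal_natCast n, ← ENNReal.ofReal_mul (by positivity)]
          exact ENNReal.ofReal_le_ofReal (Nat.floor_le (by positivity))
      _ = n := by rw [mul_assoc, ENNReal.mul_inv_cancel h0 (measure_ne_top _ _), mul_one]
  · rw [if_pos hne]
    exact hfl

/-- The cost of matching in a region is bounded by the sum of the costs of matching uniform points
in small cubes, up to explicit errors. -/
theorem exists_lintegral_locCost_le_tsum (hp : 0 < p) (hpd : 2 * p < d) :
    ∃ C : ℝ, 0 < C ∧ ∀ (μ : Measure (EuclideanSpace ℝ (Fin d))) [IsProbabilityMeasure μ] (n : ℕ)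
      (S : Set (EuclideanSpace ℝ (Fin d))) (V T t D : ℝ)
      (h : EuclideanSpace ℝ (Fin d) → ℝ≥0∞), MeasurableSet S → 0 < t → t ≤ T →
      0 ≤ D → 0 ≤ V →
      (∀ s, 0 < s → s ≤ T → volume (Metric.cthickening (√d * s) S) ≤ ENNReal.ofReal V) →
      μ.restrict S = volume.withDensity h →
      ∫⁻ z : Fin n ⊕ Fin n → EuclideanSpace ℝ (Fin d),
        locCost (powCost d p) (fun _ => ENNReal.ofReal D) S z ∂(Measure.pi fun _ => μ) ≤
      ∑' k, ENNReal.ofReal (t ^ p) * cubeCost d p ⌊n * μ.real (S ∩ cellIdx t ⁻¹' {k})⌋₊ +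
      ENNReal.ofReal (C * n * t ^ p) * (∑' k, ∫⁻ x in cellIdx t ⁻¹' {k},
        (h x - μ (S ∩ cellIdx t ⁻¹' {k}) / ENNReal.ofReal (t ^ d))) +
      ENNReal.ofReal (C * (√(n * V) * (t ^ (p - d / 2) + D * T ^ (-(d / 2 : ℝ))) +
        V * t ^ (p - d))) := by
  classical
  obtain ⟨C₀, hC₀, hH⟩ := exists_hierarchical_bound hp hpd
  refine ⟨C₀ + 4 * √d ^ p, by positivity, ?_⟩
  intro μ _ n S V T t D h hS ht htT hD hV0 hV hμ
  have hT : 0 < T := ht.trans_le htT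
  have h1 := hH μ n S V T t D hS ht htT hD hV0 hV
  have hcard := tsum_ite_nonempty_le ht (hV t ht htT) hV0
  have hsum : ∑' k, ∫⁻ z : Fin n ⊕ Fin n → EuclideanSpace ℝ (Fin d),
        locCost (powCost d p) (fun _ => cellCost d p t) (S ∩ cellIdx t ⁻¹' {k}) z
          ∂(Measure.pi fun _ => μ) ≤
      ∑' k, ENNReal.ofReal (t ^ p) * cubeCost d p ⌊n * μ.real (S ∩ cellIdx t ⁻¹' {k})⌋₊ +
      4 * cellCost d p t * (n * ∑' k, ∫⁻ x in cellIdx t ⁻¹' {k},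
        (h x - μ (S ∩ cellIdx t ⁻¹' {k}) / ENNReal.ofReal (t ^ d))) +
      cellCost d p t * ENNReal.ofReal (2 * (√(n * V / t ^ d) + V / t ^ d)) := by
    refine (ENNReal.tsum_le_tsum fun k =>
      lintegral_locCost_cell_le hp.le μ n hS ht hμ k).trans ?_
    rw [ENNReal.tsum_add, ENNReal.tsum_add, ENNReal.tsum_mul_left (a := 4 * cellCost d p t),
      ENNReal.tsum_mul_left (a := (n : ℝ≥0∞)), ENNReal.tsum_mul_left (a := cellCost d p t)]
    gcongr
    have e : ∀ k, ENNReal.ofReal (2 * (√(n * μ.real (S ∩ cellIdx t ⁻¹' {k})) +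
        if (S ∩ cellIdx t ⁻¹' {k}).Nonempty then 1 else 0)) =
        2 * (ENNReal.ofReal √(n * μ.real (S ∩ cellIdx t ⁻¹' {k})) +
        if (S ∩ cellIdx t ⁻¹' {k}).Nonempty then 1 else 0) := by
      intro k
      have : (0 : ℝ) ≤ if (S ∩ cellIdx t ⁻¹' {k}).Nonempty then 1 else 0 := by
        split_ifs <;> norm_num
      rw [ENNReal.ofReal_mul (by norm_num), ENNReal.ofReal_add (by positivity) this]
      split_ifs <;> simp
    simp_rw [e]
    rw [ENNReal.tsum_mul_left, ENNReal.tsum_add, ENNReal.ofReal_mul (by norm_num),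
      ENNReal.ofReal_add (by positivity) (by positivity), ENNReal.ofReal_ofNat]
    gcongr
    refine (tsum_sqrt_le ht hS (hV t ht htT) hV0 μ n).trans
      (ENNReal.ofReal_le_ofReal (Real.sqrt_le_sqrt ?_))
    rw [mul_div_assoc]
    gcongr
    exact mul_le_of_le_one_right (by positivity) measureReal_le_one
  refine (h1.trans (add_le_add_left hsum _)).trans ?_
  have hdp : (√d * t) ^ p = √d ^ p * t ^ p := Real.mul_rpow (by positivity) ht.le
  have e1 : 4 * cellCost d p t * (n * ∑' k, ∫⁻ x in cellIdx t ⁻¹' {k},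
        (h x - μ (S ∩ cellIdx t ⁻¹' {k}) / ENNReal.ofReal (t ^ d))) ≤
      ENNReal.ofReal ((C₀ + 4 * √d ^ p) * n * t ^ p) * ∑' k, ∫⁻ x in cellIdx t ⁻¹' {k},
        (h x - μ (S ∩ cellIdx t ⁻¹' {k}) / ENNReal.ofReal (t ^ d)) := by
    rw [← mul_assoc]
    gcongr
    rw [cellCost, ← ENNReal.ofReal_ofNat 4, ← ENNReal.ofReal_mul (by norm_num),
      ← ENNReal.ofReal_natCast n, ← ENNReal.ofReal_mul (by positivity)]
    refine ENNReal.ofReal_le_ofReal ?_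
    rw [hdp]
    calc 4 * (√d ^ p * t ^ p) * n = (0 + 4 * √d ^ p) * n * t ^ p := by ring
      _ ≤ _ := by gcongr
  refine (add_assoc _ _ _).trans_le (add_le_add (add_le_add_right e1 _) ?_)
  · rw [cellCost, ← ENNReal.ofReal_mul (by positivity),
      ← ENNReal.ofReal_add (by positivity) (by positivity)]
    refine ENNReal.ofReal_le_ofReal ?_
    have e2 : t ^ p * √(n * V / t ^ d) = √(n * V) * t ^ (p - d / 2) := by
      rw [Real.sqrt_div (by positivity), Real.sqrt_eq_rpow (t ^ d), ← Real.rpow_natCast t,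
        ← Real.rpow_mul ht.le, Real.rpow_sub ht]
      ring_nf
    have e3 : t ^ p * (V / t ^ d) = V * t ^ (p - d) := by
      rw [Real.rpow_sub ht, Real.rpow_natCast]
      ring
    have e4 : √(n * μ.real S * V) ≤ √(n * V) := by
      refine Real.sqrt_le_sqrt ?_
      gcongr
      exact mul_le_of_le_one_right (by positivity) measureReal_le_one
    calc (√d * t) ^ p * (2 * (√(n * V / t ^ d) + V / t ^ d)) +
          C₀ * √(n * μ.real S * V) * (t ^ (p - d / 2) + D * T ^ (-(d / 2 : ℝ))) ≤
          (√d * t) ^ p * (2 * (√(n * V / t ^ d) + V / t ^ d)) +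
          C₀ * √(n * V) * (t ^ (p - d / 2) + D * T ^ (-(d / 2 : ℝ))) := by gcongr
      _ = 2 * √d ^ p * (t ^ p * √(n * V / t ^ d) + t ^ p * (V / t ^ d)) +
          C₀ * √(n * V) * (t ^ (p - d / 2) + D * T ^ (-(d / 2 : ℝ))) := by rw [hdp]; ring
      _ = 2 * √d ^ p * (√(n * V) * t ^ (p - d / 2) + V * t ^ (p - d)) +
          C₀ * √(n * V) * (t ^ (p - d / 2) + D * T ^ (-(d / 2 : ℝ))) := by rw [e2, e3]
      _ ≤ 4 * √d ^ p * (√(n * V) * (t ^ (p - d / 2) + D * T ^ (-(d / 2 : ℝ))) +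
          V * t ^ (p - d)) + C₀ * (√(n * V) * (t ^ (p - d / 2) + D * T ^ (-(d / 2 : ℝ))) +
          V * t ^ (p - d)) := by
          refine add_le_add ?_ ?_
          · gcongr
            · norm_num
            · exact le_add_of_nonneg_right (by positivity)
          · rw [mul_assoc]
            gcongr
            exact le_add_of_nonneg_right (by positivity)
      _ = _ := by ring

end Prelimit

/-! ### Existence of the limit for the uniform cube. -/

section CubeLimit

variable {d : ℕ} {p : ℝ}

theorem lintegral_locCost_congr_of_measure_diff {E : Type*} [MeasurableSpace E] {κ : E → E → ℝ≥0∞}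
    {a : E → ℝ≥0∞} {ι ι' : Type*} [Fintype ι] [Fintype ι'] (μ : Measure E) [IsProbabilityMeasure μ]
    {S T : Set E} (h : S =ᵐ[μ] T) :
    ∫⁻ z : ι ⊕ ι' → E, locCost κ a S z ∂(Measure.pi fun _ => μ) =
      ∫⁻ z : ι ⊕ ι' → E, locCost κ a T z ∂(Measure.pi fun _ => μ) := by
  refine lintegral_congr_ae ?_
  have : ∀ᵐ z : ι ⊕ ι' → E ∂(Measure.pi fun _ => μ), ∀ i, z i ∈ S ↔ z i ∈ T := by
    rw [ae_all_iff]
    intro i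
    have := (Measure.quasiMeasurePreserving_eval (μ := fun _ : ι ⊕ ι' => μ) i).ae
      (Filter.eventuallyEq_set.1 h)
    exact this
  filter_upwards [this] with z hz using locCost_congr_set hz

theorem cubeCost_le (d : ℕ) (p : ℝ) (n : ℕ) : cubeCost d p n ≤ 2 * cellCost d p 1 * n := by
  have := isProbabilityMeasure_cell (d := d) one_pos 0
  refine (lintegral_locCost_le_card n _ .univ _).trans ?_
  rw [measure_univ, mul_one]

theorem cubeCost_ne_top (d : ℕ) (p : ℝ) (n : ℕ) : cubeCost d p n ≠ ∞ :=
  ((cubeCost_le d p n).trans_lt (ENNReal.mul_lt_top (ENNReal.mul_lt_top (by simp)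
    (by simp [cellCost])) (by simp))).ne

/-- The cubes of side `1 / N` that meet the unit cube are contained in it. -/
theorem cell_inter_unitCell (N : ℕ) (hN : 0 < N) (k : Fin d → ℤ) :
    cellIdx (d := d) 1 ⁻¹' {0} ∩ cellIdx (1 / N : ℝ) ⁻¹' {k} = ∅ ∨
    cellIdx (d := d) (1 / N : ℝ) ⁻¹' {k} ⊆ cellIdx 1 ⁻¹' {0} := by
  rw [or_iff_not_imp_left]
  intro h x hx
  obtain ⟨y, hy0, hy⟩ := Set.nonempty_iff_ne_empty.2 h
  have hxy : cellIdx (1 / N : ℝ) x = cellIdx (1 / N : ℝ) y := hx.trans hy.symm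
  have hy0 : cellIdx 1 y = 0 := hy0
  have key : ∀ w : EuclideanSpace ℝ (Fin d), ∀ i, cellIdx 1 w i = cellIdx (1 / N : ℝ) w i / N := by
    intro w i
    simp only [cellIdx, div_one]
    rw [← Int.floor_div_natCast]
    congr 1
    field_simp
  show cellIdx 1 x = 0
  rw [← hy0]
  ext i
  rw [key, key, hxy]

theorem unitCell_subset_closedBall (d : ℕ) :
    cellIdx (d := d) 1 ⁻¹' {0} ⊆ Metric.closedBall 0 √d := by
  intro x hx
  have h0 : cellIdx 1 (0 : EuclideanSpace ℝ (Fin d)) = 0 := by ext i; simp [cellIdx]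
  have := dist_le_of_cellIdx_eq one_pos (x := x) (y := 0) (hx.trans h0.symm)
  simpa using this

/-- The unit cube is cut into `N ^ d` cubes of side `1 / N`. The density is constant on each, so the
oscillation error vanishes and only the multiscale error remains. -/
theorem exists_cubeCost_le (hp : 0 < p) (hpd : 2 * p < d) :
    ∃ C : ℝ, 0 < C ∧ ∀ n N : ℕ, 0 < N →
      cubeCost d p n ≤ ENNReal.ofReal ((N : ℝ) ^ (d - p)) * cubeCost d p ⌊(n : ℝ) / N ^ d⌋₊ +
        ENNReal.ofReal (C * (√n * (N ^ (d / 2 - p) + 1) + N ^ (d - p))) := by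
  have hd : 0 < (d : ℝ) := by linarith
  have hd' : 0 < d := by exact_mod_cast hd
  obtain ⟨C, hC, hP⟩ := exists_lintegral_locCost_le_tsum hp hpd
  obtain ⟨v, hv, hV⟩ := exists_volume_cthickening_le d
  set U := cellIdx (d := d) 1 ⁻¹' {0} with hU
  set V := v * √d ^ d with hVdef
  have hV0 : 0 < V := by positivity
  have hUm : MeasurableSet U := measurableSet_cell 1 0
  have hU1 : volume U = 1 := by rw [hU, volume_cell one_pos]; simp
  have hcond : volume[|U] = volume.restrict U := by
    rw [ProbabilityTheory.cond, hU1, inv_one, one_smul]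
  have := isProbabilityMeasure_cell (d := d) one_pos 0
  refine ⟨C * (√V * (1 + √d ^ p) + V), by positivity, fun n N hN => ?_⟩
  have hN' : (1 : ℝ) ≤ N := by exact_mod_cast hN
  have ht : (0 : ℝ) < 1 / N := by positivity
  have htd : (0 : ℝ) < (1 / N : ℝ) ^ d := by positivity
  have htN : ∀ r : ℝ, (1 / N : ℝ) ^ r = (N : ℝ) ^ (-r) := by
    intro r
    rw [one_div, Real.inv_rpow (by positivity), Real.rpow_neg (by positivity)]
  have hsd : 1 ≤ √(d : ℝ) := by
    rw [Real.one_le_sqrt]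
    exact_mod_cast hd'
  have h1 := hP (volume[|U]) n U V 1 (1 / N) (√d ^ p) (U.indicator 1) hUm ht
    (by rw [div_le_one (by positivity)]; exact hN') (by positivity) hV0.le
    (fun s hs hs1 => hV U √d s (unitCell_subset_closedBall d) hs (hs1.trans hsd))
    (by rw [hcond, Measure.restrict_restrict hUm, Set.inter_self, withDensity_indicator_one hUm])
  have hw : ∀ k, (volume[|U]) (U ∩ cellIdx (1 / N : ℝ) ⁻¹' {k}) = 0 ∧
        U ∩ cellIdx (1 / N : ℝ) ⁻¹' {k} = ∅ ∨
      (volume[|U]) (U ∩ cellIdx (1 / N : ℝ) ⁻¹' {k}) = ENNReal.ofReal ((1 / N : ℝ) ^ d) := by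
    intro k
    rcases cell_inter_unitCell N hN k with h | h
    · left
      rw [h]
      simp
    · right
      rw [hcond, Measure.restrict_apply (hUm.inter (measurableSet_cell _ _)),
        Set.inter_eq_right.2 h, Set.inter_eq_left.2 h, volume_cell ht]
  have hsum1 : ∑' k, ENNReal.ofReal ((1 / N : ℝ) ^ p) *
      cubeCost d p ⌊n * (volume[|U]).real (U ∩ cellIdx (1 / N : ℝ) ⁻¹' {k})⌋₊ ≤
      ENNReal.ofReal ((N : ℝ) ^ (d - p)) * cubeCost d p ⌊(n : ℝ) / N ^ d⌋₊ := by
    have : ∀ k, ENNReal.ofReal ((1 / N : ℝ) ^ p) *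
      cubeCost d p ⌊n * (volume[|U]).real (U ∩ cellIdx (1 / N : ℝ) ⁻¹' {k})⌋₊ =
      ENNReal.ofReal ((N : ℝ) ^ (d - p)) * cubeCost d p ⌊(n : ℝ) / N ^ d⌋₊ *
        (volume[|U]) (U ∩ cellIdx (1 / N : ℝ) ⁻¹' {k}) := by
      intro k
      rcases hw k with ⟨h, -⟩ | h
      · rw [Measure.real, h]
        simp
      · rw [Measure.real, h, ENNReal.toReal_ofReal htd.le, mul_right_comm,
          ← ENNReal.ofReal_mul (by positivity), ← Real.rpow_natCast (1 / N : ℝ), htN, htN,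
          ← Real.rpow_add (by positivity), Real.rpow_neg (by positivity) (d : ℝ),
          Real.rpow_natCast, ← div_eq_mul_inv]
        congr 3
        ring
    simp_rw [this]
    rw [ENNReal.tsum_mul_left, tsum_measure_inter_cell]
    exact mul_le_of_le_one_right' prob_le_one
  have hsum2 : ∑' k, ∫⁻ x in cellIdx (1 / N : ℝ) ⁻¹' {k}, (U.indicator 1 x -
      (volume[|U]) (U ∩ cellIdx (1 / N : ℝ) ⁻¹' {k}) / ENNReal.ofReal ((1 / N : ℝ) ^ d)) = 0 := by
    rw [ENNReal.tsum_eq_zero]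
    intro k
    rw [setLIntegral_congr_fun (g := 0) (measurableSet_cell _ _)]
    · simp
    · intro x hx
      rcases hw k with ⟨-, h⟩ | h
      · have : x ∉ U := fun hxU => by
          have : x ∈ U ∩ cellIdx (1 / N : ℝ) ⁻¹' {k} := ⟨hxU, hx⟩
          rw [h] at this
          exact this
        simp [this]
      · rw [h, ENNReal.div_self (by simpa using htd) (by simp)]
        by_cases hxU : x ∈ U <;> simp [hxU]
  have e : cubeCost d p n = ∫⁻ z : Fin n ⊕ Fin n → EuclideanSpace ℝ (Fin d),
      locCost (powCost d p) (fun _ => ENNReal.ofReal (√d ^ p)) U z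
        ∂(Measure.pi fun _ => volume[|U]) := by
    rw [cubeCost, meanCost, cellCost, mul_one]
    refine lintegral_locCost_congr_of_measure_diff _ ?_
    rw [hcond]
    filter_upwards [ae_restrict_mem hUm] with x hx
    exact (eq_true hx : (x ∈ U) = True).symm
  rw [e]
  refine h1.trans ?_
  rw [hsum2, mul_zero, add_zero]
  refine add_le_add hsum1 (ENNReal.ofReal_le_ofReal ?_)
  rw [Real.one_rpow, mul_one, htN, htN, Real.sqrt_mul (by positivity)]
  have q1 : -(p - (d : ℝ) / 2) = d / 2 - p := by ring
  have q2 : -(p - (d : ℝ)) = d - p := by ring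
  rw [q1, q2]
  set A := (N : ℝ) ^ ((d : ℝ) / 2 - p)
  set B := (N : ℝ) ^ ((d : ℝ) - p)
  have hA : 0 ≤ A := by positivity
  have hB : 0 ≤ B := by positivity
  rw [mul_assoc C (_ + V)]
  refine mul_le_mul_of_nonneg_left ?_ hC.le
  have h2 : A + √d ^ p ≤ (1 + √d ^ p) * (A + 1) := by nlinarith [show 0 ≤ √(d : ℝ) ^ p by positivity]
  calc √n * √V * (A + √d ^ p) + V * B ≤ √n * √V * ((1 + √d ^ p) * (A + 1)) + V * B := by gcongr
    _ = √V * (1 + √d ^ p) * (√n * (A + 1)) + V * B := by ring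
    _ ≤ √V * (1 + √d ^ p) * (√n * (A + 1)) + V * B +
        (V * (√n * (A + 1)) + √V * (1 + √d ^ p) * B) := le_add_of_nonneg_right (by positivity)
    _ = _ := by ring

/-- The number of cubes per side used to split a cube with `n` points into cubes with about `k`
points each. -/
theorem eventually_exists_pow_le {d : ℕ} (hd : 0 < d) {k : ℕ} (hk : 0 < k) :
    ∀ᶠ n : ℕ in atTop, ∃ N : ℕ, 0 < N ∧ k * N ^ d ≤ n ∧ n < (k + 1) * N ^ d := by
  have h1 : Tendsto (fun N : ℕ => (k : ℝ) * (1 + 1 / (N : ℝ)) ^ d) atTop (𝓝 (k * (1 + 0) ^ d)) :=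
    ((tendsto_one_div_atTop_nhds_zero_nat.const_add 1).pow d).const_mul _
  rw [add_zero, one_pow, mul_one] at h1
  obtain ⟨M, hM⟩ := eventually_atTop.1 (h1.eventually (gt_mem_nhds (lt_add_one (k : ℝ))))
  filter_upwards [eventually_ge_atTop (k * (M + 1) ^ d)] with n hn
  -- For the largest admissible `N` one has `n < k * (N + 1) ^ d`. This is below `(k + 1) * N ^ d`
  -- once `k * (1 + 1 / N) ^ d < k + 1`.
  set N := Nat.findGreatest (fun N => k * N ^ d ≤ n) n with hN
  have hle : ∀ N : ℕ, k * N ^ d ≤ n → N ≤ n := fun N h =>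
    (Nat.le_self_pow hd.ne' N).trans ((Nat.le_mul_of_pos_left _ hk).trans h)
  have hMN : M + 1 ≤ N := Nat.le_findGreatest (hle _ hn) hn
  have hN1 : k * N ^ d ≤ n := Nat.findGreatest_spec (P := fun N => k * N ^ d ≤ n) (hle _ hn) hn
  have hN2 : n < k * (N + 1) ^ d := by
    by_contra! h
    have := Nat.le_findGreatest (P := fun N => k * N ^ d ≤ n) (hle _ h) h
    omega
  have hN0 : 0 < N := by omega
  refine ⟨N, hN0, hN1, ?_⟩
  have h3 := hM N (by omega)
  have hN0' : (0 : ℝ) < N := by exact_mod_cast hN0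
  have h4 : (k : ℝ) * (N + 1) ^ d < (k + 1) * N ^ d := by
    have : (N + 1 : ℝ) ^ d = (1 + 1 / N) ^ d * N ^ d := by
      rw [← mul_pow]
      congr 1
      field_simp
    rw [this, ← mul_assoc]
    gcongr
  exact hN2.trans (by exact_mod_cast h4)

/-- Choosing `N` with `⌊n / N ^ d⌋ = k`, the normalisation cancels the factor `N ^ (d - p)`. The
error depends on `k` alone and vanishes as `k → ∞`; this approximate subadditivity plays the role of
Fekete's lemma. -/
theorem exists_scaled_cubeCost_le (hp : 0 < p) (hpd : 2 * p < d) :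
    ∃ C : ℝ, 0 < C ∧ ∀ k : ℕ, 0 < k → ∀ᶠ n : ℕ in atTop,
      ENNReal.ofReal ((n : ℝ) ^ (p / d - 1)) * cubeCost d p n ≤
        ENNReal.ofReal ((k : ℝ) ^ (p / d - 1)) * cubeCost d p k +
          ENNReal.ofReal (C * (k : ℝ) ^ (p / d - 1 / 2)) := by
  have hd : 0 < (d : ℝ) := by linarith
  have hpd' : p / d < 1 / 2 := by rw [div_lt_div_iff₀ hd (by norm_num)]; linarith
  obtain ⟨C, hC, hP⟩ := exists_cubeCost_le hp hpd
  refine ⟨3 * C, by positivity, fun k hk => ?_⟩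
  filter_upwards [eventually_exists_pow_le (by exact_mod_cast hd) hk] with n ⟨N, hN, h1, h2⟩
  have hk1 : (1 : ℝ) ≤ k := by exact_mod_cast hk
  have hN1 : (1 : ℝ) ≤ N := by exact_mod_cast hN
  have hNd : (0 : ℝ) < (N : ℝ) ^ d := by positivity
  have h1' : (k : ℝ) * N ^ d ≤ n := by exact_mod_cast h1
  have h2' : (n : ℝ) < (k + 1) * N ^ d := by exact_mod_cast h2
  set m : ℝ := n / N ^ d with hm
  have hkm : (k : ℝ) ≤ m := by rwa [hm, le_div_iff₀ hNd]
  have hmk : m < k + 1 := by rwa [hm, div_lt_iff₀ hNd]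
  have hfl : ⌊m⌋₊ = k := by
    rw [Nat.floor_eq_iff (by positivity)]
    exact ⟨hkm, hmk⟩
  have hm1 : 1 ≤ m := hk1.trans hkm
  have hn : (n : ℝ) = m * N ^ (d : ℝ) := by
    rw [Real.rpow_natCast, hm, div_mul_cancel₀ _ hNd.ne']
  have hnr : ∀ r : ℝ, (n : ℝ) ^ r = m ^ r * (N : ℝ) ^ (d * r) := by
    intro r
    rw [hn, Real.mul_rpow (by positivity) (by positivity), ← Real.rpow_mul (by positivity)]
  have hmono : ∀ r : ℝ, r ≤ 0 → m ^ r ≤ (k : ℝ) ^ r := fun r hr =>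
    Real.rpow_le_rpow_of_nonpos (by positivity) hkm hr
  have hN0 : (0 : ℝ) < N := by positivity
  have hm0 : (0 : ℝ) < m := by positivity
  have e1 : (n : ℝ) ^ (p / d - 1) * (N : ℝ) ^ (d - p) ≤ (k : ℝ) ^ (p / d - 1) := by
    rw [hnr, mul_assoc, ← Real.rpow_add hN0]
    have : (d : ℝ) * (p / d - 1) + (d - p) = 0 := by field_simp; ring
    rw [this, Real.rpow_zero, mul_one]
    exact hmono _ (by linarith)
  have e2 : (n : ℝ) ^ (p / d - 1) * √n = (n : ℝ) ^ (p / d - 1 / 2) := by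
    have hn0 : (0 : ℝ) < n := by rw [hn]; positivity
    rw [Real.sqrt_eq_rpow, ← Real.rpow_add hn0]
    congr 1
    ring
  have e3 : (n : ℝ) ^ (p / d - 1 / 2) * (N : ℝ) ^ (d / 2 - p) ≤ (k : ℝ) ^ (p / d - 1 / 2) := by
    rw [hnr, mul_assoc, ← Real.rpow_add hN0]
    have : (d : ℝ) * (p / d - 1 / 2) + (d / 2 - p) = 0 := by field_simp; ring
    rw [this, Real.rpow_zero, mul_one]
    exact hmono _ (by linarith)
  have e4 : (n : ℝ) ^ (p / d - 1 / 2) ≤ (k : ℝ) ^ (p / d - 1 / 2) := by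
    refine Real.rpow_le_rpow_of_nonpos (by positivity) ?_ (by linarith)
    exact (le_mul_of_one_le_right (by positivity) (one_le_pow₀ hN1)).trans h1'
  have e5 : (k : ℝ) ^ (p / d - 1) ≤ (k : ℝ) ^ (p / d - 1 / 2) :=
    Real.rpow_le_rpow_of_exponent_le hk1 (by linarith)
  have h := hP n N hN
  rw [hfl] at h
  calc _ ≤ ENNReal.ofReal ((n : ℝ) ^ (p / d - 1)) *
        (ENNReal.ofReal ((N : ℝ) ^ (d - p)) * cubeCost d p k +
        ENNReal.ofReal (C * (√n * (N ^ (d / 2 - p) + 1) + N ^ (d - p)))) := by gcongr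
    _ = ENNReal.ofReal ((n : ℝ) ^ (p / d - 1) * (N : ℝ) ^ (d - p)) * cubeCost d p k +
        ENNReal.ofReal ((n : ℝ) ^ (p / d - 1) *
          (C * (√n * (N ^ (d / 2 - p) + 1) + N ^ (d - p)))) := by
        rw [mul_add, ← mul_assoc, ← ENNReal.ofReal_mul (by positivity),
          ← ENNReal.ofReal_mul (by positivity)]
    _ ≤ _ := by
        refine add_le_add (by gcongr) (ENNReal.ofReal_le_ofReal ?_)
        calc (n : ℝ) ^ (p / d - 1) * (C * (√n * (N ^ (d / 2 - p) + 1) + N ^ (d - p))) =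
              C * (((n : ℝ) ^ (p / d - 1) * √n) * N ^ (d / 2 - p) + (n : ℝ) ^ (p / d - 1) * √n +
                (n : ℝ) ^ (p / d - 1) * N ^ (d - p)) := by ring
          _ ≤ C * ((k : ℝ) ^ (p / d - 1 / 2) + (k : ℝ) ^ (p / d - 1 / 2) +
                (k : ℝ) ^ (p / d - 1 / 2)) := by
              rw [e2]
              gcongr
              exact e1.trans e5
          _ = _ := by ring

/-- The limit of the scaled mean cost for uniform points in the unit cube. -/
theorem exists_tendsto_cubeCost (hp : 0 < p) (hpd : 2 * p < d) :
    ∃ β : ℝ≥0∞, β ≠ ∞ ∧ Tendsto (fun n : ℕ => ENNReal.ofReal ((n : ℝ) ^ (p / d - 1)) *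
      cubeCost d p n) atTop (𝓝 β) := by
  have hd : 0 < (d : ℝ) := by linarith
  have hpd' : p / d < 1 / 2 := by rw [div_lt_div_iff₀ hd (by norm_num)]; linarith
  obtain ⟨C, hC, h⟩ := exists_scaled_cubeCost_le hp hpd
  set a := fun n : ℕ => ENNReal.ofReal ((n : ℝ) ^ (p / d - 1)) * cubeCost d p n with ha
  -- Letting `n → ∞` bounds the upper limit by each term `a k` up to a vanishing error; letting then
  -- `k → ∞` bounds it by the lower limit.
  have hL : ∀ k : ℕ, 0 < k → limsup a atTop ≤ a k + ENNReal.ofReal (C * (k : ℝ) ^ (p / d - 1 / 2)) :=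
    fun k hk => limsup_le_of_le (by isBoundedDefault) (h k hk)
  have hfin : limsup a atTop ≠ ∞ := by
    refine ((hL 1 one_pos).trans_lt (ENNReal.add_lt_top.2 ⟨?_, ENNReal.ofReal_lt_top⟩)).ne
    exact ENNReal.mul_lt_top ENNReal.ofReal_lt_top (cubeCost_ne_top d p 1).lt_top
  refine ⟨limsup a atTop, hfin, tendsto_of_le_liminf_of_limsup_le ?_ le_rfl⟩
  refine ENNReal.le_of_forall_pos_le_add fun ε hε _ => ?_
  have h0 : Tendsto (fun k : ℕ => C * (k : ℝ) ^ (p / d - 1 / 2)) atTop (𝓝 0) := by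
    have := (tendsto_rpow_neg_atTop (y := 1 / 2 - p / d) (by linarith)).comp
      (tendsto_natCast_atTop_atTop (R := ℝ))
    simpa using this.const_mul C
  rw [← tsub_le_iff_right]
  refine le_liminf_of_le (by isBoundedDefault) ?_
  filter_upwards [eventually_gt_atTop 0, h0.eventually (ge_mem_nhds (show (0 : ℝ) < ε from hε))]
    with k hk hkε
  rw [tsub_le_iff_right]
  refine (hL k hk).trans ?_
  gcongr
  exact (ENNReal.ofReal_le_ofReal hkε).trans (by simp)

end CubeLimit

/-! ### Averages over cells. -/

section CellAverage

variable {d : ℕ}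

/-- The average of `h` on the cube of side `t` containing `x`. -/
noncomputable def cellAvg (t : ℝ) (h : EuclideanSpace ℝ (Fin d) → ℝ≥0∞)
    (x : EuclideanSpace ℝ (Fin d)) : ℝ≥0∞ :=
  (∫⁻ y in cellIdx t ⁻¹' {cellIdx t x}, h y) / ENNReal.ofReal (t ^ d)

theorem measurable_cellAvg (t : ℝ) (h : EuclideanSpace ℝ (Fin d) → ℝ≥0∞) :
    Measurable (cellAvg t h) :=
  (measurable_of_countable (f := fun k : Fin d → ℤ =>
    (∫⁻ y in cellIdx t ⁻¹' {k}, h y) / ENNReal.ofReal (t ^ d))).comp (measurable_cellIdx t)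

theorem cellAvg_of_mem {t : ℝ} {h : EuclideanSpace ℝ (Fin d) → ℝ≥0∞} {k : Fin d → ℤ}
    {x : EuclideanSpace ℝ (Fin d)} (hx : x ∈ cellIdx t ⁻¹' {k}) :
    cellAvg t h x = (∫⁻ y in cellIdx t ⁻¹' {k}, h y) / ENNReal.ofReal (t ^ d) := by
  have hx : cellIdx t x = k := hx
  rw [cellAvg, hx]

theorem lintegral_eq_tsum_cell (μ : Measure (EuclideanSpace ℝ (Fin d))) (t : ℝ)
    (f : EuclideanSpace ℝ (Fin d) → ℝ≥0∞) :
    ∫⁻ x, f x ∂μ = ∑' k, ∫⁻ x in cellIdx t ⁻¹' {k}, f x ∂μ := by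
  rw [← lintegral_iUnion (measurableSet_cell t), ← Set.preimage_iUnion, Set.iUnion_of_singleton,
    Set.preimage_univ, setLIntegral_univ]
  exact fun k l hkl => Set.disjoint_left.2 fun x hx hx' =>
      hkl ((show cellIdx t x = k from hx) ▸ (show cellIdx t x = l from hx'))

/-- The oscillation of a function around its average on a cube is bounded by the oscillation around
any constant. -/
theorem setLIntegral_sub_cellAvg_le {t : ℝ} (ht : 0 < t) {h : EuclideanSpace ℝ (Fin d) → ℝ≥0∞}
    (hm : Measurable h) (k : Fin d → ℤ) (c : ℝ≥0∞) :
    ∫⁻ x in cellIdx t ⁻¹' {k}, (h x - cellAvg t h x) ≤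
        ∫⁻ x in cellIdx t ⁻¹' {k}, ((h x - c) + (c - h x)) ∧
      ∫⁻ x in cellIdx t ⁻¹' {k}, (cellAvg t h x - h x) ≤
        ∫⁻ x in cellIdx t ⁻¹' {k}, ((h x - c) + (c - h x)) := by
  set Q := cellIdx (d := d) t ⁻¹' {k} with hQ
  have hQm : MeasurableSet Q := measurableSet_cell t k
  set v := ENNReal.ofReal (t ^ d) with hv
  have hvQ : volume Q = v := volume_cell ht k
  have hv0 : v ≠ 0 := by simpa [hv] using pow_pos ht d
  have hvt : v ≠ ∞ := ENNReal.ofReal_ne_top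
  set a := (∫⁻ y in Q, h y) / v with ha
  have hav : a * v = ∫⁻ y in Q, h y := ENNReal.div_mul_cancel hv0 hvt
  -- Jensen's inequality for the positive part: the distance from `c` to the mean is controlled by
  -- the oscillation around `c`.
  have h1 : (c - a) * v ≤ ∫⁻ x in Q, (c - h x) := by
    rw [ENNReal.sub_mul fun _ _ => hvt, hav, tsub_le_iff_left, ← lintegral_add_left hm, ← hvQ,
      ← setLIntegral_const]
    exact lintegral_mono fun x => le_add_tsub
  have h2 : (a - c) * v ≤ ∫⁻ x in Q, (h x - c) := by
    rw [ENNReal.sub_mul fun _ _ => hvt, hav, tsub_le_iff_left, ← hvQ, ← setLIntegral_const,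
      ← lintegral_add_left measurable_const]
    exact lintegral_mono fun x => le_add_tsub
  rw [lintegral_add_left (hm.sub_const c)]
  constructor
  · calc ∫⁻ x in Q, (h x - cellAvg t h x) ≤ ∫⁻ x in Q, ((h x - c) + (c - a)) := by
          refine setLIntegral_mono' hQm fun x hx => ?_
          rw [cellAvg_of_mem hx]
          exact tsub_le_tsub_add_tsub
      _ = (∫⁻ x in Q, (h x - c)) + (c - a) * v := by
          rw [lintegral_add_left (hm.sub_const c), setLIntegral_const, hvQ]
      _ ≤ _ := by gcongr
  · calc ∫⁻ x in Q, (cellAvg t h x - h x) ≤ ∫⁻ x in Q, ((a - c) + (c - h x)) := by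
          refine setLIntegral_mono' hQm fun x hx => ?_
          rw [cellAvg_of_mem hx]
          exact tsub_le_tsub_add_tsub
      _ = (a - c) * v + ∫⁻ x in Q, (c - h x) := by
          rw [lintegral_add_left measurable_const, setLIntegral_const, hvQ]
      _ ≤ _ := by gcongr

/-- Cell averages of an integrable function converge in `L¹`. -/
theorem exists_forall_lintegral_sub_cellAvg_le {h : EuclideanSpace ℝ (Fin d) → ℝ≥0∞}
    (hm : Measurable h) (hh : ∫⁻ x, h x ≠ ∞) {ε : ℝ} (hε : 0 < ε) :
    ∃ δ : ℝ, 0 < δ ∧ ∀ t : ℝ, 0 < t → t < δ →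
      ∫⁻ x, (h x - cellAvg t h x) ≤ ENNReal.ofReal ε ∧
      ∫⁻ x, (cellAvg t h x - h x) ≤ ENNReal.ofReal ε := by
  -- `h` is approximated in `L¹` by a continuous `g` with compact support, whose variation on small
  -- cells is uniformly small and confined to a bounded set.
  obtain ⟨g, hgc, hg, hgcont, -⟩ := (integrable_toReal_of_lintegral_ne_top hm.aemeasurable
    hh).exists_hasCompactSupport_lintegral_sub_le (ε := ENNReal.ofReal (ε / 2))
    (by simpa using hε)
  set B := Metric.cthickening 1 (tsupport g) with hB
  have hBt : volume B < ∞ := (hgc.isCompact.cthickening).measure_lt_top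
  set η : ℝ := ε / (2 * ((volume B).toReal + 1)) with hη
  have hη0 : 0 < η := by positivity
  obtain ⟨δ, hδ, hunif⟩ := Metric.uniformContinuous_iff.1
    (hgc.uniformContinuous_of_continuous hgcont) η hη0
  have hd0 : (0 : ℝ) < √d + 1 := by positivity
  refine ⟨min δ 1 / (√d + 1), by positivity, fun t ht htδ => ?_⟩
  have hlt : √d * t < min δ 1 := by
    rw [lt_div_iff₀ hd0] at htδ
    nlinarith
  have key : ∀ x y, cellIdx t x = cellIdx t y → ‖g x - g y‖ₑ ≤
      B.indicator (fun _ => ENNReal.ofReal η) x := by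
    intro x y hxy
    have hd := (dist_le_of_cellIdx_eq ht hxy).trans_lt hlt
    by_cases hx : x ∈ B
    · rw [Set.indicator_of_mem hx, ← ofReal_norm, ← dist_eq_norm]
      exact ENNReal.ofReal_le_ofReal (hunif (hd.trans_le (min_le_left _ _))).le
    · have h1 : g x = 0 := by
        by_contra h
        exact hx (Metric.self_subset_cthickening _ (subset_tsupport g h))
      have h2 : g y = 0 := by
        by_contra h
        exact hx (Metric.mem_cthickening_of_dist_le x y 1 _ (subset_tsupport g h)
          (hd.trans_le (min_le_right _ _)).le)
      simp [h1, h2]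
  have hfin : ∀ᵐ x, h x < ∞ := ae_lt_top hm hh
  have hbound : ∀ k : Fin d → ℤ, ∃ c : ℝ≥0∞,
      ∫⁻ x in cellIdx t ⁻¹' {k}, ((h x - c) + (c - h x)) ≤
      ∫⁻ x in cellIdx t ⁻¹' {k}, (‖(h x).toReal - g x‖ₑ +
        B.indicator (fun _ => ENNReal.ofReal η) x) := by
    intro k
    obtain ⟨y, hy⟩ : (cellIdx (d := d) t ⁻¹' {k}).Nonempty := by
      refine nonempty_of_measure_ne_zero (μ := volume) ?_
      rw [volume_cell ht]
      simpa using pow_pos ht d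
    -- The value of `g` at any point of the cell serves as reference constant. Since `g` may be
    -- negative, its positive part is used, which only brings it closer to `h`.
    refine ⟨ENNReal.ofReal (g y), ?_⟩
    refine lintegral_mono_ae ?_
    filter_upwards [ae_restrict_mem (measurableSet_cell t k), ae_restrict_of_ae hfin] with x hx hx'
    refine le_trans ?_ (add_le_add_right (key x y (hx.trans hy.symm)) _)
    refine le_trans ?_ (enorm_add_le _ _)
    rw [sub_add_sub_cancel]
    lift h x to ℝ≥0 using hx'.ne with b
    rw [ENNReal.coe_toReal, ← ENNReal.ofReal_coe_nnreal, ← ofReal_norm, Real.norm_eq_abs]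
    rcases le_total (b : ℝ) (g y) with hb | hb
    · rw [tsub_eq_zero_of_le (ENNReal.ofReal_le_ofReal hb), zero_add,
        ← ENNReal.ofReal_sub _ (NNReal.coe_nonneg b), abs_sub_comm]
      exact ENNReal.ofReal_le_ofReal (le_abs_self _)
    · rw [tsub_eq_zero_of_le (ENNReal.ofReal_le_ofReal hb), add_zero]
      rcases le_total 0 (g y) with h0 | h0
      · rw [← ENNReal.ofReal_sub _ h0]
        exact ENNReal.ofReal_le_ofReal (le_abs_self _)
      · rw [ENNReal.ofReal_of_nonpos h0, tsub_zero]
        refine ENNReal.ofReal_le_ofReal (le_trans ?_ (le_abs_self _))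
        linarith
  have htot : ∑' k, ∫⁻ x in cellIdx t ⁻¹' {k}, (‖(h x).toReal - g x‖ₑ +
        B.indicator (fun _ => ENNReal.ofReal η) x) ≤ ENNReal.ofReal ε := by
    have hBm : MeasurableSet B := Metric.isClosed_cthickening.measurableSet
    rw [← lintegral_eq_tsum_cell, lintegral_add_right _ (measurable_const.indicator hBm),
      lintegral_indicator_const hBm]
    refine (add_le_add_left hg _).trans ?_
    rw [← ENNReal.ofReal_toReal hBt.ne, ← ENNReal.ofReal_mul hη0.le,
      ← ENNReal.ofReal_add (by positivity) (by positivity)]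
    refine ENNReal.ofReal_le_ofReal ?_
    have : η * ((volume B).toReal + 1) = ε / 2 := by
      rw [hη]
      field_simp
    nlinarith
  constructor
  · rw [lintegral_eq_tsum_cell _ t]
    refine le_trans (ENNReal.tsum_le_tsum fun k => ?_) htot
    obtain ⟨c, hc⟩ := hbound k
    exact (setLIntegral_sub_cellAvg_le ht hm k c).1.trans hc
  · rw [lintegral_eq_tsum_cell _ t]
    refine le_trans (ENNReal.tsum_le_tsum fun k => ?_) htot
    obtain ⟨c, hc⟩ := hbound k
    exact (setLIntegral_sub_cellAvg_le ht hm k c).2.trans hc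

/-- Hölder's inequality on a set. -/
theorem setLIntegral_rpow_le {E : Type*} [MeasurableSpace E] (μ : Measure E) {S : Set E}
    {f : E → ℝ≥0∞} (hf : AEMeasurable f (μ.restrict S)) {s : ℝ} (hs : 0 ≤ s) (hs1 : s ≤ 1) :
    ∫⁻ x in S, f x ^ s ∂μ ≤ (∫⁻ x in S, f x ∂μ) ^ s * μ S ^ (1 - s) := by
  have := ENNReal.lintegral_mul_norm_pow_le (μ := μ.restrict S) hf (aemeasurable_const (b := 1)) hs
    (sub_nonneg.2 hs1) (by ring)
  simpa using this

/-- For exponents at most `1` the power is subadditive, so the average exceeds `h` by at most a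
power of the positive part of the difference. That part lives in a thickening of `S`, where Hölder's
inequality applies. -/
theorem lintegral_cellAvg_rpow_le {h : EuclideanSpace ℝ (Fin d) → ℝ≥0∞} (hm : Measurable h)
    {t s : ℝ} (ht : 0 < t) (hs : 0 ≤ s) (hs1 : s ≤ 1) {S : Set (EuclideanSpace ℝ (Fin d))}
    (hS : ∀ᵐ x, x ∉ S → h x = 0) (hs0 : s ≠ 0) :
    ∫⁻ x, cellAvg t h x ^ s ≤ (∫⁻ x, h x ^ s) + (∫⁻ x, (cellAvg t h x - h x)) ^ s *
      volume (Metric.cthickening (√d * t) S) ^ (1 - s) := by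
  set B := Metric.cthickening (√d * t) S with hB
  have hBm : MeasurableSet B := Metric.isClosed_cthickening.measurableSet
  have hzero : ∀ x, x ∉ B → cellAvg t h x = 0 := by
    intro x hx
    rw [cellAvg, setLIntegral_congr_fun_ae (g := 0) (measurableSet_cell _ _)]
    · simp
    · filter_upwards [hS] with y hy hyx
      refine hy fun hyS => hx ?_
      exact Metric.mem_cthickening_of_dist_le x y _ _ hyS
        (dist_le_of_cellIdx_eq ht (Eq.symm hyx))
  calc ∫⁻ x, cellAvg t h x ^ s ≤ ∫⁻ x, (h x ^ s + (cellAvg t h x - h x) ^ s) := by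
        refine lintegral_mono fun x => ?_
        refine le_trans ?_ (ENNReal.rpow_add_le_add_rpow _ _ hs hs1)
        exact ENNReal.rpow_le_rpow le_add_tsub hs
    _ = (∫⁻ x, h x ^ s) + ∫⁻ x, (cellAvg t h x - h x) ^ s := lintegral_add_left (hm.pow_const s) _
    _ = (∫⁻ x, h x ^ s) + ∫⁻ x in B, (cellAvg t h x - h x) ^ s := by
        congr 1
        refine (setLIntegral_eq_of_support_subset ?_).symm
        intro x hx
        by_contra hxB
        refine hx ?_
        simp only [hzero x hxB, zero_tsub]
        exact ENNReal.zero_rpow_of_pos (lt_of_le_of_ne hs hs0.symm)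
    _ ≤ _ := by
        gcongr
        refine (setLIntegral_rpow_le volume ((measurable_cellAvg t h).sub hm).aemeasurable
          hs hs1).trans ?_
        gcongr
        · exact Measure.restrict_le_self
        · exact le_rfl

end CellAverage

/-! ### The upper bound for a density on a bounded set. -/

section AbsolutelyContinuous

variable {d : ℕ} {p : ℝ}

/-- The limit handles large `m`, and the additive constant `M` absorbs the finitely many small ones.
-/
theorem cubeCost_le_of_tendsto {β : ℝ≥0∞}
    (hβ : Tendsto (fun n : ℕ => ENNReal.ofReal ((n : ℝ) ^ (p / d - 1)) * cubeCost d p n) atTop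
      (𝓝 β)) {b : ℝ≥0∞} (hb : β < b) :
    ∃ M : ℝ, 0 ≤ M ∧ ∀ m : ℕ, cubeCost d p m ≤
      b * ENNReal.ofReal ((m : ℝ) ^ (1 - p / d)) + ENNReal.ofReal M := by
  obtain ⟨m₀, hm₀⟩ := eventually_atTop.1 (hβ.eventually (ge_mem_nhds hb))
  refine ⟨2 * (√d * 1) ^ p * (m₀ + 1), by positivity, fun m => ?_⟩
  rcases lt_or_ge m (m₀ + 1) with hm | hm
  · refine le_trans (cubeCost_le d p m) (le_trans ?_ le_add_self)
    rw [cellCost, ← ENNReal.ofReal_natCast, ← ENNReal.ofReal_ofNat 2,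
      ← ENNReal.ofReal_mul (by norm_num), ← ENNReal.ofReal_mul (by positivity)]
    refine ENNReal.ofReal_le_ofReal ?_
    gcongr
    exact_mod_cast hm.le
  · refine le_trans ?_ le_self_add
    have hm0 : (0 : ℝ) < m := by
      have : 0 < m := by omega
      exact_mod_cast this
    calc cubeCost d p m = ENNReal.ofReal ((m : ℝ) ^ (1 - p / d)) *
          (ENNReal.ofReal ((m : ℝ) ^ (p / d - 1)) * cubeCost d p m) := by
          rw [← mul_assoc, ← ENNReal.ofReal_mul (by positivity), ← Real.rpow_add hm0]
          simp
      _ ≤ ENNReal.ofReal ((m : ℝ) ^ (1 - p / d)) * b := by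
          gcongr
          exact hm₀ m (by omega)
      _ = _ := mul_comm _ _

/-- The sum of the costs of small cubes is bounded by the integral of a power of the cell
averages. -/
theorem tsum_cubeCost_le (hp : 0 < p) (hpd : 2 * p < d) {b : ℝ≥0∞} {M : ℝ} (hM : 0 ≤ M)
    (hb : ∀ m : ℕ, cubeCost d p m ≤
      b * ENNReal.ofReal ((m : ℝ) ^ (1 - p / d)) + ENNReal.ofReal M)
    {μ : Measure (EuclideanSpace ℝ (Fin d))} [IsProbabilityMeasure μ]
    {S : Set (EuclideanSpace ℝ (Fin d))} {h : EuclideanSpace ℝ (Fin d) → ℝ≥0∞}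
    (hμ : μ.restrict S = volume.withDensity h) {t V : ℝ} (ht : 0 < t) (hV0 : 0 ≤ V)
    (hV : volume (Metric.cthickening (√d * t) S) ≤ ENNReal.ofReal V) (n : ℕ) :
    ∑' k, ENNReal.ofReal (t ^ p) * cubeCost d p ⌊n * μ.real (S ∩ cellIdx t ⁻¹' {k})⌋₊ ≤
      b * ENNReal.ofReal ((n : ℝ) ^ (1 - p / d)) * (∫⁻ x, cellAvg t h x ^ (1 - p / d)) +
        ENNReal.ofReal (M * V * t ^ (p - d)) := by
  classical
  have hd : 0 < (d : ℝ) := by linarith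
  have hpd' : p / d < 1 / 2 := by rw [div_lt_div_iff₀ hd (by norm_num)]; linarith
  have hs : 0 ≤ 1 - p / d := by linarith
  have hμk : ∀ k, μ (S ∩ cellIdx t ⁻¹' {k}) = ∫⁻ y in cellIdx t ⁻¹' {k}, h y := by
    intro k
    rw [Set.inter_comm, ← Measure.restrict_apply (measurableSet_cell t k), hμ,
      withDensity_apply _ (measurableSet_cell t k)]
  have key : ∀ k, ENNReal.ofReal (t ^ p) *
      cubeCost d p ⌊n * μ.real (S ∩ cellIdx t ⁻¹' {k})⌋₊ ≤
      b * ENNReal.ofReal ((n : ℝ) ^ (1 - p / d)) *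
        (∫⁻ x in cellIdx t ⁻¹' {k}, cellAvg t h x ^ (1 - p / d)) +
      ENNReal.ofReal (M * t ^ p) * (if (S ∩ cellIdx t ⁻¹' {k}).Nonempty then 1 else 0) := by
    intro k
    by_cases hk : (S ∩ cellIdx t ⁻¹' {k}).Nonempty
    · rw [if_pos hk, mul_one]
      set w := μ.real (S ∩ cellIdx t ⁻¹' {k}) with hw
      -- The powers of `t` match: `t ^ d * (w / t ^ d) ^ (1 - p / d)` equals `t ^ p * w ^ (1 - p /
      -- d)`, the scaling of the cost of a cube with about `n * w` points.
      have hint : ∫⁻ x in cellIdx t ⁻¹' {k}, cellAvg t h x ^ (1 - p / d) =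
          ENNReal.ofReal (t ^ p * w ^ (1 - p / d)) := by
        rw [setLIntegral_congr_fun (g := fun _ => ENNReal.ofReal ((w / t ^ d) ^ (1 - p / d)))
          (measurableSet_cell _ _), setLIntegral_const, volume_cell ht,
          ← ENNReal.ofReal_mul (by positivity)]
        · congr 1
          rw [Real.div_rpow (by positivity) (by positivity), div_mul_eq_mul_div, mul_div_assoc,
            mul_comm]
          congr 1
          rw [← Real.rpow_natCast, ← Real.rpow_mul ht.le, ← Real.rpow_sub ht]
          congr 1
          field_simp
          ring
        · intro x hx
          simp only
          rw [cellAvg_of_mem hx, ← hμk, ← ENNReal.ofReal_rpow_of_nonneg (by positivity) hs,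
            ENNReal.ofReal_div_of_pos (by positivity), hw, ofReal_measureReal]
      rw [hint]
      calc ENNReal.ofReal (t ^ p) * cubeCost d p ⌊n * w⌋₊ ≤ ENNReal.ofReal (t ^ p) *
            (b * ENNReal.ofReal ((n * w) ^ (1 - p / d)) + ENNReal.ofReal M) := by
            gcongr
            refine (hb _).trans ?_
            gcongr
            exact Nat.floor_le (by positivity)
        _ = _ := by
            rw [mul_add, Real.mul_rpow (by positivity) (by positivity),
              ENNReal.ofReal_mul (by positivity), ENNReal.ofReal_mul (by positivity),
              ENNReal.ofReal_mul hM]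
            ring
    · have : S ∩ cellIdx t ⁻¹' {k} = ∅ := Set.not_nonempty_iff_eq_empty.1 hk
      rw [this]
      simp
  refine (ENNReal.tsum_le_tsum key).trans ?_
  rw [ENNReal.tsum_add, ENNReal.tsum_mul_left, ENNReal.tsum_mul_left, ← lintegral_eq_tsum_cell]
  gcongr
  refine (mul_le_mul_right (tsum_ite_nonempty_le ht hV hV0) _).trans ?_
  rw [← ENNReal.ofReal_mul (by positivity)]
  refine ENNReal.ofReal_le_ofReal (le_of_eq ?_)
  rw [Real.rpow_sub ht, Real.rpow_natCast]
  ring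

/-- Cubes of side `r * n ^ (-1/d)` are used with `r` fixed. The errors come from the constant `M`
per cube, from the oscillation of `h` (at most `ε` for large `n`), and from the multiscale bound.
The outer term with `D` and `T` is eventually below the final `ε`. -/
theorem limsup_lintegral_locCost_le_add (hp : 0 < p) (hpd : 2 * p < d) :
    ∃ C : ℝ, 0 < C ∧ ∀ (b : ℝ≥0∞) (M : ℝ), 0 ≤ M → (∀ m : ℕ, cubeCost d p m ≤
      b * ENNReal.ofReal ((m : ℝ) ^ (1 - p / d)) + ENNReal.ofReal M) →
      ∀ (μ : Measure (EuclideanSpace ℝ (Fin d))) [IsProbabilityMeasure μ]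
      (S : Set (EuclideanSpace ℝ (Fin d))) (T V D : ℝ) (h : EuclideanSpace ℝ (Fin d) → ℝ≥0∞),
      MeasurableSet S → Measurable h → μ.restrict S = volume.withDensity h → 0 < T → 0 ≤ V →
      0 ≤ D →
      (∀ s, 0 < s → s ≤ T → volume (Metric.cthickening (√d * s) S) ≤ ENNReal.ofReal V) →
      ∀ r ε : ℝ, 0 < r → 0 < ε →
      limsup (fun n : ℕ => ENNReal.ofReal ((n : ℝ) ^ (p / d - 1)) *
        ∫⁻ z : Fin n ⊕ Fin n → EuclideanSpace ℝ (Fin d),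
          locCost (powCost d p) (fun _ => ENNReal.ofReal D) S z ∂(Measure.pi fun _ => μ)) atTop ≤
      b * ((∫⁻ x, h x ^ (1 - p / d)) +
        ENNReal.ofReal ε ^ (1 - p / d) * ENNReal.ofReal V ^ (p / d)) +
      ENNReal.ofReal (M * V * r ^ (p - d) + C * r ^ p * ε +
        C * (√V * r ^ (p - d / 2) + V * r ^ (p - d)) + ε) := by
  have hd : 0 < (d : ℝ) := by linarith
  have hpd' : p / d < 1 / 2 := by rw [div_lt_div_iff₀ hd (by norm_num)]; linarith
  obtain ⟨C, hC, hP⟩ := exists_lintegral_locCost_le_tsum hp hpd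
  refine ⟨C, hC, ?_⟩
  intro b M hM hb μ _ S T V D h hS hm hμ hT hV0 hD hV r ε hr hε
  have hh1 : ∫⁻ x, h x ≠ ∞ := by
    rw [← setLIntegral_univ, ← withDensity_apply _ .univ, ← hμ]
    exact measure_ne_top _ _
  have hsupp : ∀ᵐ x, x ∉ S → h x = 0 := by
    have : ∫⁻ x in Sᶜ, h x = 0 := by
      rw [← withDensity_apply _ hS.compl, ← hμ, Measure.restrict_apply hS.compl]
      simp
    rwa [lintegral_eq_zero_iff hm, EventuallyEq, ae_restrict_iff' hS.compl] at this
  obtain ⟨δ, hδ, hosc⟩ := exists_forall_lintegral_sub_cellAvg_le hm hh1 hε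
  have ht0 : Tendsto (fun n : ℕ => r * (n : ℝ) ^ (-(1 / d : ℝ))) atTop (𝓝 0) := by
    have := (tendsto_rpow_neg_atTop (y := 1 / d) (by positivity)).comp
      (tendsto_natCast_atTop_atTop (R := ℝ))
    simpa using this.const_mul r
  have hn0 : Tendsto (fun n : ℕ => C * √V * D * T ^ (-(d / 2 : ℝ)) * (n : ℝ) ^ (p / d - 1 / 2))
      atTop (𝓝 0) := by
    have := (tendsto_rpow_neg_atTop (y := 1 / 2 - p / d) (by linarith)).comp
      (tendsto_natCast_atTop_atTop (R := ℝ))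
    simpa using this.const_mul (C * √V * D * T ^ (-(d / 2 : ℝ)))
  refine limsup_le_of_le (by isBoundedDefault) ?_
  filter_upwards [eventually_gt_atTop 0, ht0.eventually (gt_mem_nhds (lt_min hδ hT)),
    hn0.eventually (gt_mem_nhds hε)] with n hn htn hnε
  have hn' : (0 : ℝ) < n := by exact_mod_cast hn
  set t := r * (n : ℝ) ^ (-(1 / d : ℝ)) with ht_def
  have ht : 0 < t := by positivity
  have htT : t ≤ T := (htn.trans_le (min_le_right _ _)).le
  obtain ⟨ho1, ho2⟩ := hosc t ht (htn.trans_le (min_le_left _ _))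
  have htr : ∀ s : ℝ, t ^ s = r ^ s * (n : ℝ) ^ (-(s / d)) := by
    intro s
    rw [ht_def, Real.mul_rpow hr.le (by positivity), ← Real.rpow_mul hn'.le]
    congr 2
    field_simp
  have h1 := hP μ n S V T t D h hS ht htT hD hV0 hV hμ
  have h2 := tsum_cubeCost_le hp hpd hM hb hμ ht hV0 (hV t ht htT) n
  have h3 : ∑' k, ∫⁻ x in cellIdx t ⁻¹' {k},
      (h x - μ (S ∩ cellIdx t ⁻¹' {k}) / ENNReal.ofReal (t ^ d)) ≤ ENNReal.ofReal ε := by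
    refine le_trans (le_of_eq ?_) ho1
    rw [lintegral_eq_tsum_cell _ t]
    congr 1
    ext k
    refine setLIntegral_congr_fun (measurableSet_cell t k) fun x hx => ?_
    rw [cellAvg_of_mem hx, Set.inter_comm, ← Measure.restrict_apply (measurableSet_cell t k), hμ,
      withDensity_apply _ (measurableSet_cell t k)]
  have h4 : ∫⁻ x, cellAvg t h x ^ (1 - p / d) ≤ (∫⁻ x, h x ^ (1 - p / d)) +
      ENNReal.ofReal ε ^ (1 - p / d) * ENNReal.ofReal V ^ (p / d) := by
    refine (lintegral_cellAvg_rpow_le hm ht (by linarith)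
      (by linarith [show 0 ≤ p / d by positivity]) hsupp (by linarith)).trans ?_
    rw [sub_sub_cancel]
    gcongr
    · linarith
    · exact hV t ht htT
  have e0 : (n : ℝ) ^ (p / d - 1) * (n : ℝ) ^ (1 - p / d) = 1 := by
    rw [← Real.rpow_add hn']
    simp
  have e1 : (n : ℝ) ^ (p / d - 1) * t ^ (p - d) = r ^ (p - d) := by
    rw [htr, mul_left_comm, ← Real.rpow_add hn']
    have : p / d - 1 + -((p - d) / d) = 0 := by field_simp; ring
    rw [this, Real.rpow_zero, mul_one]
  have e2 : (n : ℝ) ^ (p / d - 1) * (n * t ^ p) = r ^ p := by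
    rw [htr, mul_left_comm (n : ℝ), mul_left_comm, ← Real.rpow_one_add' hn'.le,
      ← Real.rpow_add hn']
    · have : p / d - 1 + (1 + -(p / d)) = 0 := by ring
      rw [this, Real.rpow_zero, mul_one]
    · linarith
  have e3 : (n : ℝ) ^ (p / d - 1) * √n = (n : ℝ) ^ (p / d - 1 / 2) := by
    rw [Real.sqrt_eq_rpow, ← Real.rpow_add hn']
    congr 1
    ring
  have e4 : (n : ℝ) ^ (p / d - 1 / 2) * t ^ (p - d / 2) = r ^ (p - d / 2) := by
    rw [htr, mul_left_comm, ← Real.rpow_add hn']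
    have : p / d - 1 / 2 + -((p - d / 2) / d) = 0 := by field_simp; ring
    rw [this, Real.rpow_zero, mul_one]
  set I := ∫⁻ x, cellAvg t h x ^ (1 - p / d)
  calc _ ≤ ENNReal.ofReal ((n : ℝ) ^ (p / d - 1)) *
        (b * ENNReal.ofReal ((n : ℝ) ^ (1 - p / d)) * I + ENNReal.ofReal (M * V * t ^ (p - d)) +
          ENNReal.ofReal (C * n * t ^ p) * ENNReal.ofReal ε +
          ENNReal.ofReal (C * (√(n * V) * (t ^ (p - d / 2) + D * T ^ (-(d / 2 : ℝ))) +
            V * t ^ (p - d)))) := by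
        gcongr
        refine h1.trans ?_
        gcongr
    _ = b * I + ENNReal.ofReal ((n : ℝ) ^ (p / d - 1) * (M * V * t ^ (p - d) + C * n * t ^ p * ε +
          C * (√(n * V) * (t ^ (p - d / 2) + D * T ^ (-(d / 2 : ℝ))) + V * t ^ (p - d)))) := by
        rw [← ENNReal.ofReal_mul (by positivity), add_assoc, add_assoc,
          ← ENNReal.ofReal_add (by positivity) (by positivity),
          ← ENNReal.ofReal_add (by positivity) (by positivity), mul_add, ← add_assoc,
          ← ENNReal.ofReal_mul (by positivity)]
        congr 1
        rw [mul_comm b, mul_assoc, ← mul_assoc, ← ENNReal.ofReal_mul (by positivity), e0,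
          ENNReal.ofReal_one, one_mul]
    _ ≤ _ := by
        refine add_le_add (mul_le_mul_right h4 _) (ENNReal.ofReal_le_ofReal ?_)
        rw [Real.sqrt_mul hn'.le]
        calc _ = M * V * ((n : ℝ) ^ (p / d - 1) * t ^ (p - d)) +
              C * ((n : ℝ) ^ (p / d - 1) * (n * t ^ p)) * ε +
              C * (√V * ((((n : ℝ) ^ (p / d - 1)) * √n) * t ^ (p - d / 2)) +
                V * ((n : ℝ) ^ (p / d - 1) * t ^ (p - d))) +
              C * √V * D * T ^ (-(d / 2 : ℝ)) * ((n : ℝ) ^ (p / d - 1) * √n) := by ring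
          _ ≤ _ := by
              rw [e1, e2, e3, e4]
              gcongr

/-- The upper bound for the absolutely continuous part on a bounded set. -/
theorem limsup_lintegral_locCost_le_of_withDensity (hp : 0 < p) (hpd : 2 * p < d) {β : ℝ≥0∞}
    (hβ' : β ≠ ∞)
    (hβ : Tendsto (fun n : ℕ => ENNReal.ofReal ((n : ℝ) ^ (p / d - 1)) * cubeCost d p n) atTop
      (𝓝 β)) (μ : Measure (EuclideanSpace ℝ (Fin d))) [IsProbabilityMeasure μ]
    {S : Set (EuclideanSpace ℝ (Fin d))} {h : EuclideanSpace ℝ (Fin d) → ℝ≥0∞}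
    (hS : MeasurableSet S) (hSb : Bornology.IsBounded S) (hm : Measurable h)
    (hμ : μ.restrict S = volume.withDensity h) {D : ℝ} (hD : 0 ≤ D) :
    limsup (fun n : ℕ => ENNReal.ofReal ((n : ℝ) ^ (p / d - 1)) *
        ∫⁻ z : Fin n ⊕ Fin n → EuclideanSpace ℝ (Fin d),
          locCost (powCost d p) (fun _ => ENNReal.ofReal D) S z ∂(Measure.pi fun _ => μ)) atTop ≤
      β * ∫⁻ x, h x ^ (1 - p / d) := by
  have hd : 0 < (d : ℝ) := by linarith
  have hpd' : p / d < 1 / 2 := by rw [div_lt_div_iff₀ hd (by norm_num)]; linarith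
  have hpd0 : 0 < p / d := by positivity
  obtain ⟨R, hR0, hR⟩ : ∃ R : ℝ, 0 < R ∧ S ⊆ Metric.closedBall 0 R := by
    obtain ⟨R, hR⟩ := hSb.subset_closedBall 0
    exact ⟨max R 1, by positivity, hR.trans (Metric.closedBall_subset_closedBall (le_max_left _ _))⟩
  obtain ⟨v, hv, hV⟩ := exists_volume_cthickening_le d
  obtain ⟨C, hC, hlim⟩ := limsup_lintegral_locCost_le_add hp hpd
  set L := limsup (fun n : ℕ => ENNReal.ofReal ((n : ℝ) ^ (p / d - 1)) *
        ∫⁻ z : Fin n ⊕ Fin n → EuclideanSpace ℝ (Fin d),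
          locCost (powCost d p) (fun _ => ENNReal.ofReal D) S z ∂(Measure.pi fun _ => μ)) atTop
  set A := ∫⁻ x, h x ^ (1 - p / d) with hA
  set V := v * R ^ d with hVdef
  have hV0 : 0 ≤ V := by positivity
  have hAtop : A ≠ ∞ := by
    have hsupp : ∀ᵐ x, x ∉ S → h x = 0 := by
      have : ∫⁻ x in Sᶜ, h x = 0 := by
        rw [← withDensity_apply _ hS.compl, ← hμ, Measure.restrict_apply hS.compl]
        simp
      rwa [lintegral_eq_zero_iff hm, EventuallyEq, ae_restrict_iff' hS.compl] at this
    have e : A = ∫⁻ x in S, h x ^ (1 - p / d) := by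
      rw [hA, ← lintegral_indicator hS]
      refine lintegral_congr_ae ?_
      filter_upwards [hsupp] with x hx
      by_cases hxS : x ∈ S
      · rw [Set.indicator_of_mem hxS]
      · rw [Set.indicator_of_notMem hxS, hx hxS, ENNReal.zero_rpow_of_pos (by linarith)]
    rw [e]
    refine ((setLIntegral_rpow_le volume hm.aemeasurable (by linarith)
      (by linarith)).trans_lt ?_).ne
    refine ENNReal.mul_lt_top (ENNReal.rpow_lt_top_of_nonneg (by linarith) ?_)
      (ENNReal.rpow_lt_top_of_nonneg (by linarith) hSb.measure_lt_top.ne)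
    rw [← withDensity_apply _ hS, ← hμ]
    exact measure_ne_top _ _
  have h1 : ∀ b : ℝ≥0∞, β < b → b ≠ ∞ → L ≤ b * A := by
    intro b hb hbt
    obtain ⟨M, hM, hbM⟩ := cubeCost_le_of_tendsto hβ hb
    have h2 : ∀ r : ℝ, 0 < r → L ≤ b * (A + 0) + ENNReal.ofReal (M * V * r ^ (p - d) +
        C * (√V * r ^ (p - d / 2) + V * r ^ (p - d))) := by
      intro r hr
      have h3 : ∀ ε : ℝ, 0 < ε → L ≤ _ := fun ε hε => hlim b M hM hbM μ S R V D h hS hm hμ hR0 hV0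
        hD (fun s hs hsR => hV S R s hR hs hsR) r ε hr hε
      -- The order of limits matters: first `ε → 0` with `r` fixed, because of the term `C * r ^ p *
      -- ε`; next `r → ∞`; finally `b` decreases to `β`.
      refine ge_of_tendsto (x := 𝓝[>] (0 : ℝ)) ?_
        (eventually_mem_nhdsWithin.mono fun ε hε => h3 ε hε)
      refine Tendsto.add ?_ ?_
      · refine ENNReal.Tendsto.const_mul (tendsto_const_nhds.add ?_) (Or.inr hbt)
        have : Tendsto (fun ε : ℝ => ENNReal.ofReal ε ^ (1 - p / d) * ENNReal.ofReal V ^ (p / d))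
            (𝓝 0) (𝓝 (ENNReal.ofReal 0 ^ (1 - p / d) * ENNReal.ofReal V ^ (p / d))) := by
          refine ENNReal.Tendsto.mul_const ?_ (Or.inr ?_)
          · exact ((ENNReal.continuous_rpow_const).comp ENNReal.continuous_ofReal).tendsto 0
          · exact ENNReal.rpow_ne_top_of_nonneg hpd0.le ENNReal.ofReal_ne_top
        rw [ENNReal.ofReal_zero, ENNReal.zero_rpow_of_pos (by linarith), zero_mul] at this
        exact this.mono_left nhdsWithin_le_nhds
      · have : Continuous fun ε : ℝ => ENNReal.ofReal (M * V * r ^ (p - d) + C * r ^ p * ε +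
          C * (√V * r ^ (p - d / 2) + V * r ^ (p - d)) + ε) :=
          ENNReal.continuous_ofReal.comp (by fun_prop)
        have := this.tendsto 0
        rw [mul_zero, add_zero, add_zero] at this
        exact this.mono_left nhdsWithin_le_nhds
    have h4 : Tendsto (fun r : ℝ => b * (A + 0) + ENNReal.ofReal (M * V * r ^ (p - d) +
        C * (√V * r ^ (p - d / 2) + V * r ^ (p - d)))) atTop
        (𝓝 (b * (A + 0) + ENNReal.ofReal (M * V * 0 + C * (√V * 0 + V * 0)))) := by
      refine tendsto_const_nhds.add (ENNReal.tendsto_ofReal ?_)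
      have t1 : Tendsto (fun r : ℝ => r ^ (p - d)) atTop (𝓝 0) := by
        have := tendsto_rpow_neg_atTop (y := d - p) (by linarith)
        simpa using this
      have t2 : Tendsto (fun r : ℝ => r ^ (p - d / 2)) atTop (𝓝 0) := by
        have := tendsto_rpow_neg_atTop (y := d / 2 - p) (by linarith)
        simpa using this
      exact (t1.const_mul _).add (((t2.const_mul _).add (t1.const_mul _)).const_mul C)
    have h5 := ge_of_tendsto h4 ((eventually_gt_atTop 0).mono h2)
    simpa using h5
  have h6 : Tendsto (fun b : ℝ≥0∞ => b * A) (𝓝[>] β) (𝓝 (β * A)) :=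
    (ENNReal.Tendsto.mul_const tendsto_id (Or.inr hAtop)).mono_left nhdsWithin_le_nhds
  have : (𝓝[>] β).NeBot := nhdsGT_neBot_of_exists_gt ⟨∞, hβ'.lt_top⟩
  refine ge_of_tendsto h6 ?_
  filter_upwards [Ioo_mem_nhdsGT hβ'.lt_top] with b hb using h1 b hb.1 hb.2.ne

end AbsolutelyContinuous

/-! ### Scaled costs of regions, norm penalties and control of the tail. -/

section RegionCost

variable {d : ℕ} {p : ℝ}

theorem ENNReal.limsup_le_add {ι : Type*} {f : Filter ι} {u v w : ι → ℝ≥0∞}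
    {a b : ℝ≥0∞} (h : ∀ᶠ i in f, u i ≤ v i + w i) (hv : limsup v f ≤ a) (hw : limsup w f ≤ b) :
    limsup u f ≤ a + b := by
  refine ENNReal.le_of_forall_pos_le_add fun ε hε hab => ?_
  have hab := ENNReal.add_lt_top.1 hab
  have hε2 : ((ε / 2 : ℝ≥0) : ℝ≥0∞) ≠ 0 := by simpa using hε.ne'
  have h1 := eventually_lt_of_limsup_lt (hv.trans_lt (ENNReal.lt_add_right hab.1.ne hε2))
  have h2 := eventually_lt_of_limsup_lt (hw.trans_lt (ENNReal.lt_add_right hab.2.ne hε2))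
  refine limsup_le_of_le (by isBoundedDefault) ?_
  filter_upwards [h, h1, h2] with i hi h1 h2
  calc u i ≤ (a + (ε / 2 : ℝ≥0)) + (b + (ε / 2 : ℝ≥0)) := hi.trans (add_le_add h1.le h2.le)
    _ = a + b + ((ε / 2 : ℝ≥0) + (ε / 2 : ℝ≥0)) := by ring
    _ = a + b + ε := by rw [← ENNReal.coe_add, add_halves]

/-- The scaled mean cost of a partial matching of the points in `S`. -/
noncomputable def regionCost (p : ℝ)
    (κ : EuclideanSpace ℝ (Fin d) → EuclideanSpace ℝ (Fin d) → ℝ≥0∞)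
    (a : EuclideanSpace ℝ (Fin d) → ℝ≥0∞) (μ : Measure (EuclideanSpace ℝ (Fin d)))
    (S : Set (EuclideanSpace ℝ (Fin d))) (n : ℕ) : ℝ≥0∞ :=
  ENNReal.ofReal ((n : ℝ) ^ (p / d - 1)) * ∫⁻ z : Fin n ⊕ Fin n → EuclideanSpace ℝ (Fin d),
    locCost κ a S z ∂(Measure.pi fun _ => μ)

variable {κ κ' : EuclideanSpace ℝ (Fin d) → EuclideanSpace ℝ (Fin d) → ℝ≥0∞}
  {a a' : EuclideanSpace ℝ (Fin d) → ℝ≥0∞} {μ : Measure (EuclideanSpace ℝ (Fin d))}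
  {S T : Set (EuclideanSpace ℝ (Fin d))}

theorem regionCost_union_le (hκ : Measurable (Function.uncurry κ)) (ha : Measurable a)
    (hS : MeasurableSet S) (hST : Disjoint S T) (n : ℕ) :
    regionCost p κ a μ (S ∪ T) n ≤ regionCost p κ a μ S n + regionCost p κ a μ T n := by
  unfold regionCost
  rw [← mul_add, ← lintegral_add_left (measurable_locCost hκ ha hS)]
  gcongr
  exact locCost_union_le hST

theorem regionCost_mono (hκ : ∀ x ∈ S, ∀ y ∈ S, κ x y ≤ κ' x y) (ha : ∀ x ∈ S, a x ≤ a' x)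
    (n : ℕ) : regionCost p κ a μ S n ≤ regionCost p κ' a' μ S n := by
  unfold regionCost
  gcongr
  exact locCost_mono hκ ha

theorem regionCost_le_tsum (hκ : Measurable (Function.uncurry κ)) (ha : Measurable a)
    (hS : MeasurableSet S) {τ : Type*} [Countable τ] [MeasurableSpace τ]
    [MeasurableSingletonClass τ] {ℓ : EuclideanSpace ℝ (Fin d) → τ} (hℓ : Measurable ℓ) (n : ℕ) :
    regionCost p κ a μ S n ≤ ∑' k, regionCost p κ a μ (S ∩ ℓ ⁻¹' {k}) n := by
  unfold regionCost
  rw [ENNReal.tsum_mul_left, ← lintegral_tsum fun k => (measurable_locCost hκ ha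
    (hS.inter (hℓ (measurableSet_singleton k)))).aemeasurable]
  gcongr
  exact locCost_le_tsum ℓ

theorem regionCost_congr_ae [IsProbabilityMeasure μ] (h : S =ᵐ[μ] T) (n : ℕ) :
    regionCost p κ a μ S n = regionCost p κ a μ T n := by
  rw [regionCost, regionCost, lintegral_locCost_congr_of_measure_diff μ h]

/-- The penalty for leaving a point unmatched; two penalties bound the cost of a pair. -/
noncomputable def normPenalty (d : ℕ) (p : ℝ) (x : EuclideanSpace ℝ (Fin d)) : ℝ≥0∞ :=
  ENNReal.ofReal ((2 * ‖x‖) ^ p)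

theorem measurable_normPenalty (d : ℕ) (p : ℝ) : Measurable (normPenalty d p) :=
  ENNReal.measurable_ofReal.comp ((measurable_norm.const_mul 2).pow_const p)

theorem powCost_le_normPenalty_add (hp : 0 ≤ p) (x y : EuclideanSpace ℝ (Fin d)) :
    powCost d p x y ≤ normPenalty d p x + normPenalty d p y := by
  rw [powCost, normPenalty, normPenalty, edist_dist, ENNReal.ofReal_rpow_of_nonneg dist_nonneg hp]
  have h1 := dist_le_norm_add_norm x y
  rcases le_total ‖x‖ ‖y‖ with h | h
  · refine le_trans (ENNReal.ofReal_le_ofReal ?_) le_add_self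
    exact Real.rpow_le_rpow dist_nonneg (by linarith) hp
  · refine le_trans (ENNReal.ofReal_le_ofReal ?_) le_self_add
    exact Real.rpow_le_rpow dist_nonneg (by linarith) hp

theorem normPenalty_le (hp : 0 ≤ p) {R : ℝ} {x : EuclideanSpace ℝ (Fin d)} (hx : ‖x‖ ≤ R) :
    normPenalty d p x ≤ ENNReal.ofReal ((2 * R) ^ p) :=
  ENNReal.ofReal_le_ofReal (Real.rpow_le_rpow (by positivity) (by linarith) hp)

/-- The bound is uniform in `n`. It disposes of sets of small mass and, summed over shells, of the
part near infinity. -/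
theorem regionCost_le_of_subset_closedBall (hp : 0 < p) (hpd : 2 * p < d) :
    ∃ C : ℝ, 0 < C ∧ ∀ (μ : Measure (EuclideanSpace ℝ (Fin d))) [IsProbabilityMeasure μ]
      (S : Set (EuclideanSpace ℝ (Fin d))) (R : ℝ), MeasurableSet S → 0 < R →
      S ⊆ Metric.closedBall 0 R → ∀ n,
      regionCost p (powCost d p) (normPenalty d p) μ S n ≤
        ENNReal.ofReal (C * R ^ p) * μ S ^ (1 - p / d) := by
  have hd : 0 < (d : ℝ) := by linarith
  have hpd' : p / d < 1 / 2 := by rw [div_lt_div_iff₀ hd (by norm_num)]; linarith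
  obtain ⟨C, hC, hH⟩ := exists_lintegral_locCost_le hp hpd
  refine ⟨C, hC, fun μ _ S R hS hR hSR n => ?_⟩
  refine (regionCost_mono (a' := fun _ => ENNReal.ofReal ((2 * R) ^ p)) (fun _ _ _ _ => le_rfl)
    (fun x hx => normPenalty_le hp.le (by simpa using hSR hx)) n).trans ?_
  have h1 := hH μ n S R ((2 * R) ^ p) hS hR hSR (by positivity)
    (Real.rpow_le_rpow (by positivity) (by linarith) hp.le)
  refine (mul_le_mul_right h1 _).trans ?_
  rw [← ENNReal.ofReal_mul (by positivity), ← ofReal_measureReal,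
    ENNReal.ofReal_rpow_of_nonneg measureReal_nonneg (by linarith),
    ← ENNReal.ofReal_mul (by positivity)]
  refine ENNReal.ofReal_le_ofReal ?_
  rw [Real.mul_rpow (by positivity) (by positivity)]
  have e : (n : ℝ) ^ (p / d - 1) * (n : ℝ) ^ (1 - p / d) ≤ 1 := by
    rcases Nat.eq_zero_or_pos n with rfl | hn
    · rw [Nat.cast_zero, Real.zero_rpow (by linarith)]
      simp
    · have : (0 : ℝ) < n := by exact_mod_cast hn
      rw [← Real.rpow_add this]
      simp
  calc _ = ((n : ℝ) ^ (p / d - 1) * (n : ℝ) ^ (1 - p / d)) *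
        (C * R ^ p * μ.real S ^ (1 - p / d)) := by ring
    _ ≤ 1 * (C * R ^ p * μ.real S ^ (1 - p / d)) := by gcongr
    _ = _ := one_mul _

/-- The index of the dyadic shell containing `x`. -/
noncomputable def shellIdx (x : EuclideanSpace ℝ (Fin d)) : ℕ := Nat.clog 2 ⌈‖x‖⌉₊

theorem measurable_shellIdx : Measurable (shellIdx (d := d)) :=
  (measurable_of_countable (Nat.clog 2)).comp (Nat.measurable_ceil.comp measurable_norm)

theorem norm_le_of_shellIdx {x : EuclideanSpace ℝ (Fin d)} : ‖x‖ ≤ 2 ^ shellIdx x := by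
  refine (Nat.le_ceil _).trans ?_
  exact_mod_cast Nat.le_pow_clog one_lt_two ⌈‖x‖⌉₊

theorem lt_norm_of_shellIdx {x : EuclideanSpace ℝ (Fin d)} {j : ℕ} (h : j < shellIdx x) :
    2 ^ j < ‖x‖ := by
  have := (Nat.lt_clog_iff_pow_lt one_lt_two).1 h
  have := Nat.lt_ceil.1 this
  exact_mod_cast this

/-- Markov's inequality bounds the mass of shell `j + 1` by a multiple of `2 ^ (-α * j)`, so the
terms decay with ratio `2 ^ (p - α * s) < 1`. Shell `0`, the unit ball, is treated apart. -/
theorem tsum_shell_ne_top [IsProbabilityMeasure μ] {α s : ℝ} (hs : 0 ≤ s)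
    (hα0 : 0 ≤ α) (hα : p < α * s) (hμ : ∫⁻ x, ENNReal.ofReal (‖x‖ ^ α) ∂μ ≠ ∞) :
    ∑' j : ℕ, ENNReal.ofReal ((2 ^ j) ^ p) * μ (shellIdx ⁻¹' {j}) ^ s ≠ ∞ := by
  set m := ∫⁻ x, ENNReal.ofReal (‖x‖ ^ α) ∂μ with hm
  have hmark : ∀ j : ℕ, ENNReal.ofReal ((2 ^ j : ℝ) ^ α) * μ (shellIdx ⁻¹' {j + 1}) ≤ m := by
    intro j
    refine le_trans ?_ (mul_meas_ge_le_lintegral₀ (μ := μ)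
      (f := fun x : EuclideanSpace ℝ (Fin d) => ENNReal.ofReal (‖x‖ ^ α)) ?_
      (ENNReal.ofReal ((2 ^ j : ℝ) ^ α)))
    · gcongr
      intro x hx
      have hx : shellIdx x = j + 1 := hx
      exact ENNReal.ofReal_le_ofReal (Real.rpow_le_rpow (by positivity)
        (lt_norm_of_shellIdx (by omega)).le hα0)
    · exact (ENNReal.measurable_ofReal.comp (measurable_norm.pow_const α)).aemeasurable
  have hq : (2 : ℝ) ^ (p - α * s) < 1 := Real.rpow_lt_one_of_one_lt_of_neg one_lt_two (by linarith)
  have hterm : ∀ j : ℕ, ENNReal.ofReal ((2 ^ (j + 1) : ℝ) ^ p) * μ (shellIdx ⁻¹' {j + 1}) ^ s ≤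
      ENNReal.ofReal (2 ^ p) * m ^ s * ENNReal.ofReal ((2 : ℝ) ^ (p - α * s)) ^ j := by
    intro j
    have h1 : μ (shellIdx ⁻¹' {j + 1}) ≤ ENNReal.ofReal ((2 ^ j : ℝ) ^ (-α)) * m := by
      calc μ (shellIdx ⁻¹' {j + 1}) = ENNReal.ofReal ((2 ^ j : ℝ) ^ (-α)) *
            (ENNReal.ofReal ((2 ^ j : ℝ) ^ α) * μ (shellIdx ⁻¹' {j + 1})) := by
            rw [← mul_assoc, ← ENNReal.ofReal_mul (by positivity),
              ← Real.rpow_add (by positivity)]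
            simp
        _ ≤ _ := by
            gcongr
            exact hmark j
    calc _ ≤ ENNReal.ofReal ((2 ^ (j + 1) : ℝ) ^ p) *
          (ENNReal.ofReal ((2 ^ j : ℝ) ^ (-α)) * m) ^ s := by gcongr
      _ = ENNReal.ofReal ((2 ^ (j + 1) : ℝ) ^ p * ((2 ^ j : ℝ) ^ (-α)) ^ s) * m ^ s := by
          rw [ENNReal.mul_rpow_of_nonneg _ _ hs, ENNReal.ofReal_rpow_of_nonneg (by positivity) hs,
            ← mul_assoc, ← ENNReal.ofReal_mul (by positivity)]
      _ = ENNReal.ofReal (2 ^ p * ((2 : ℝ) ^ (p - α * s)) ^ j) * m ^ s := by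
          congr 2
          rw [pow_succ, Real.mul_rpow (by positivity) (by positivity), ← Real.rpow_natCast,
            ← Real.rpow_natCast, ← Real.rpow_mul (by positivity), ← Real.rpow_mul (by positivity),
            ← Real.rpow_mul (by positivity), ← Real.rpow_mul (by positivity), mul_comm, ← mul_assoc,
            ← Real.rpow_add (by positivity), mul_comm]
          congr 2
          ring
      _ = _ := by
          rw [ENNReal.ofReal_mul (by positivity), ENNReal.ofReal_pow (by positivity)]
          ring
  rw [tsum_eq_zero_add' ENNReal.summable]
  refine ENNReal.add_ne_top.2 ⟨?_, ?_⟩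
  · refine ENNReal.mul_ne_top ENNReal.ofReal_ne_top ?_
    exact ENNReal.rpow_ne_top_of_nonneg hs (measure_ne_top _ _)
  · refine ((ENNReal.tsum_le_tsum hterm).trans_lt ?_).ne
    rw [ENNReal.tsum_mul_left, ENNReal.tsum_geometric]
    refine ENNReal.mul_lt_top (ENNReal.mul_lt_top ENNReal.ofReal_lt_top
      (ENNReal.rpow_lt_top_of_nonneg hs hμ)) ?_
    rw [ENNReal.inv_lt_top, tsub_pos_iff_lt]
    exact ENNReal.ofReal_lt_one.2 hq

/-- On shell `j` the uniform bound has radius `2 ^ j`, and the resulting series converges. Its tail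
is small for all `n` at once. -/
theorem exists_regionCost_tail_le [IsProbabilityMeasure μ] (hp : 0 < p) (hpd : 2 * p < d) {α : ℝ}
    (hα0 : 0 ≤ α) (hα : p < α * (1 - p / d)) (hμ : ∫⁻ x, ENNReal.ofReal (‖x‖ ^ α) ∂μ ≠ ∞)
    {ε : ℝ≥0∞} (hε : 0 < ε) :
    ∃ R : ℝ, 0 < R ∧ ∀ S, MeasurableSet S → (∀ x ∈ S, R < ‖x‖) → ∀ n,
      regionCost p (powCost d p) (normPenalty d p) μ S n ≤ ε := by
  have hd : 0 < (d : ℝ) := by linarith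
  have hpd' : p / d < 1 / 2 := by rw [div_lt_div_iff₀ hd (by norm_num)]; linarith
  obtain ⟨C, hC, hH⟩ := regionCost_le_of_subset_closedBall hp hpd
  have hsum := tsum_shell_ne_top (μ := μ) (p := p) (by linarith) hα0 hα hμ
  set g := fun j : ℕ => ENNReal.ofReal ((2 ^ j) ^ p) * μ (shellIdx ⁻¹' {j}) ^ (1 - p / d) with hg
  have h0 : Tendsto (fun i => ENNReal.ofReal C * ∑' k, g (k + i)) atTop (𝓝 (ENNReal.ofReal C * 0)) :=
    ENNReal.Tendsto.const_mul (ENNReal.tendsto_sum_nat_add g hsum) (Or.inr ENNReal.ofReal_ne_top)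
  rw [mul_zero] at h0
  obtain ⟨J, hJ⟩ := (h0.eventually (ge_mem_nhds hε)).exists
  refine ⟨2 ^ J, by positivity, fun S hS hSR n => ?_⟩
  refine (regionCost_le_tsum (measurable_powCost p) (measurable_normPenalty d p) hS
    measurable_shellIdx n).trans (le_trans ?_ hJ)
  rw [← (ENNReal.summable (f := fun j : ℕ => regionCost p (powCost d p) (normPenalty d p) μ
    (S ∩ shellIdx ⁻¹' {j + J}) n)).sum_add_tsum_nat_add' (f := fun j : ℕ => regionCost p
    (powCost d p) (normPenalty d p) μ (S ∩ shellIdx ⁻¹' {j}) n), Finset.sum_eq_zero, zero_add,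
    ← ENNReal.tsum_mul_left]
  · refine ENNReal.tsum_le_tsum fun j => ?_
    refine (hH μ _ (2 ^ (j + J)) (hS.inter (measurable_shellIdx (measurableSet_singleton _)))
      (by positivity) ?_ n).trans ?_
    · rintro x ⟨-, hx⟩
      have hx : shellIdx x = j + J := hx
      rw [mem_closedBall_zero_iff, ← hx]
      exact norm_le_of_shellIdx
    · rw [ENNReal.ofReal_mul hC.le, mul_assoc]
      simp only [hg]
      gcongr
      · linarith
      · exact Set.inter_subset_right
  · intro j hj
    have : S ∩ shellIdx ⁻¹' {j} = ∅ := by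
      ext x
      simp only [Set.mem_inter_iff, Set.mem_preimage, Set.mem_singleton_iff, Set.mem_empty_iff_false,
        iff_false, not_and]
      intro hx hxj
      have h1 := hSR x hx
      have h2 := norm_le_of_shellIdx (x := x)
      rw [hxj] at h2
      have h3 : (2 : ℝ) ^ j ≤ 2 ^ J := pow_le_pow_right₀ one_le_two (Finset.mem_range.1 hj).le
      linarith
    rw [this, regionCost]
    simp [locCost_eq_zero]

/-- The integral in the limit is finite under a moment condition. -/
theorem densityPowerIntegral_lt_top [IsProbabilityMeasure μ] (hp : 0 < p) (hpd : 2 * p < d) {α : ℝ}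
    (hα0 : 0 ≤ α) (hα : p < α * (1 - p / d)) (hμ : ∫⁻ x, ENNReal.ofReal (‖x‖ ^ α) ∂μ ≠ ∞) :
    densityPowerIntegral p μ < ∞ := by
  have hd : 0 < (d : ℝ) := by linarith
  have hpd' : p / d < 1 / 2 := by rw [div_lt_div_iff₀ hd (by norm_num)]; linarith
  have hpd0 : 0 < p / d := by positivity
  set v := volume (Metric.ball (0 : EuclideanSpace ℝ (Fin d)) 1) with hv
  have hsum := tsum_shell_ne_top (μ := μ) (p := p) (by linarith) hα0 hα hμ
  have hle : ∀ j : ℕ, ∫⁻ x in shellIdx ⁻¹' {j}, (μ.rnDeriv volume x) ^ (1 - p / d) ≤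
      v ^ (p / d) * (ENNReal.ofReal ((2 ^ j) ^ p) * μ (shellIdx ⁻¹' {j}) ^ (1 - p / d)) := by
    intro j
    -- Hölder on a shell: the power `p / d` of its volume is of order `2 ^ (j * p)`, the weight in
    -- `tsum_shell_ne_top`.
    refine (setLIntegral_rpow_le volume (Measure.measurable_rnDeriv _ _).aemeasurable (by linarith)
      (by linarith)).trans ?_
    rw [sub_sub_cancel, ← mul_assoc, mul_comm]
    have h1 : volume (shellIdx (d := d) ⁻¹' {j}) ≤ ENNReal.ofReal ((2 ^ j) ^ d) * v := by
      refine (measure_mono (t := Metric.closedBall 0 (2 ^ j)) fun x hx => ?_).trans ?_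
      · have hx : shellIdx x = j := hx
        rw [mem_closedBall_zero_iff, ← hx]
        exact norm_le_of_shellIdx
      · rw [Measure.addHaar_closedBall _ _ (by positivity), finrank_euclideanSpace, Fintype.card_fin]
    gcongr
    · calc volume (shellIdx (d := d) ⁻¹' {j}) ^ (p / d) ≤
            (ENNReal.ofReal ((2 ^ j) ^ d) * v) ^ (p / d) := by gcongr
        _ = v ^ (p / d) * ENNReal.ofReal ((2 ^ j) ^ p) := by
            rw [ENNReal.mul_rpow_of_nonneg _ _ hpd0.le, mul_comm,
              ENNReal.ofReal_rpow_of_nonneg (by positivity) hpd0.le, ← Real.rpow_natCast _ d,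
              ← Real.rpow_mul (by positivity), mul_div_cancel₀ _ hd.ne']
    · linarith
    · exact Measure.setLIntegral_rnDeriv_le _
  have hmeas : ∀ j, MeasurableSet (shellIdx (d := d) ⁻¹' {j}) :=
    fun j => measurable_shellIdx (measurableSet_singleton j)
  have e : densityPowerIntegral p μ =
      ∑' j, ∫⁻ x in shellIdx ⁻¹' {j}, (μ.rnDeriv volume x) ^ (1 - p / d) := by
    rw [densityPowerIntegral, ← lintegral_iUnion hmeas, ← Set.preimage_iUnion,
      Set.iUnion_of_singleton, Set.preimage_univ, setLIntegral_univ]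
    exact fun k l hkl => Set.disjoint_left.2 fun x hx hx' =>
      hkl ((show shellIdx x = k from hx) ▸ (show shellIdx x = l from hx'))
  rw [e]
  refine (ENNReal.tsum_le_tsum hle).trans_lt ?_
  rw [ENNReal.tsum_mul_left]
  exact ENNReal.mul_lt_top (ENNReal.rpow_lt_top_of_nonneg hpd0.le measure_ball_lt_top.ne)
    hsum.lt_top

end RegionCost

/-! ### The upper bound for arbitrary measures. -/

section UpperBound

variable {d : ℕ} {p : ℝ} {μ : Measure (EuclideanSpace ℝ (Fin d))} [IsProbabilityMeasure μ]

/-- By inner regularity all but `ε` of the mass of `S` sits on a compact null set, whose cost is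
negligible. The rest costs at most a power of `ε`, uniformly in `n`. -/
theorem limsup_regionCost_null (hp : 0 < p) (hpd : 2 * p < d)
    {S : Set (EuclideanSpace ℝ (Fin d))} (hS : MeasurableSet S) (hSb : Bornology.IsBounded S)
    (h0 : volume S = 0) :
    limsup (regionCost p (powCost d p) (normPenalty d p) μ S) atTop ≤ 0 := by
  have hd : 0 < (d : ℝ) := by linarith
  have hpd' : p / d < 1 / 2 := by rw [div_lt_div_iff₀ hd (by norm_num)]; linarith
  obtain ⟨R, hR0, hR⟩ : ∃ R : ℝ, 0 < R ∧ S ⊆ Metric.closedBall 0 R := by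
    obtain ⟨R, hR⟩ := hSb.subset_closedBall 0
    exact ⟨max R 1, by positivity, hR.trans (Metric.closedBall_subset_closedBall (le_max_left _ _))⟩
  obtain ⟨C, hC, hH⟩ := regionCost_le_of_subset_closedBall hp hpd
  have h1 : ∀ ε : ℝ≥0∞, 0 < ε → limsup (regionCost p (powCost d p) (normPenalty d p) μ S) atTop ≤
      ENNReal.ofReal (C * R ^ p) * ε ^ (1 - p / d) := by
    intro ε hε
    obtain ⟨K, hKS, hK, hKε⟩ := hS.exists_isCompact_sdiff_lt (measure_ne_top μ S) hε.ne'
    rw [← zero_add (ENNReal.ofReal (C * R ^ p) * ε ^ (1 - p / d))]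
    refine ENNReal.limsup_le_add (v := regionCost p (powCost d p)
      (fun _ => ENNReal.ofReal ((2 * R) ^ p)) μ K)
      (w := fun _ => ENNReal.ofReal (C * R ^ p) * ε ^ (1 - p / d)) (.of_forall fun n => ?_) ?_ ?_
    · rw [← Set.union_sdiff_cancel hKS]
      refine (regionCost_union_le (measurable_powCost p) (measurable_normPenalty d p)
        hK.measurableSet Set.disjoint_sdiff_right n).trans ?_
      refine add_le_add (regionCost_mono (fun _ _ _ _ => le_rfl)
        (fun x hx => normPenalty_le hp.le (by simpa using hR (hKS hx))) n) ?_
      refine (hH μ _ R (hS.diff hK.measurableSet) hR0 (Set.sdiff_subset.trans hR) n).trans ?_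
      gcongr
      linarith
    · exact (tendsto_lintegral_locCost_null hp hpd μ hK (measure_mono_null hKS h0)
        (by positivity)).limsup_eq.le
    · simp
  have h2 : Tendsto (fun ε : ℝ≥0∞ => ENNReal.ofReal (C * R ^ p) * ε ^ (1 - p / d)) (𝓝[>] 0)
      (𝓝 (ENNReal.ofReal (C * R ^ p) * 0 ^ (1 - p / d))) := by
    refine ENNReal.Tendsto.const_mul ?_ (Or.inr ENNReal.ofReal_ne_top)
    exact (ENNReal.continuous_rpow_const.tendsto 0).mono_left nhdsWithin_le_nhds
  rw [ENNReal.zero_rpow_of_pos (by linarith), mul_zero] at h2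
  exact ge_of_tendsto h2 (eventually_mem_nhdsWithin.mono fun ε hε => h1 ε hε)

-- `N` is a Lebesgue-null set carrying the singular part of `μ`, so only the density is seen off
-- `N`.
omit [IsProbabilityMeasure μ] in
theorem exists_null_restrict_eq_withDensity [SigmaFinite μ] :
    ∃ N : Set (EuclideanSpace ℝ (Fin d)), MeasurableSet N ∧ volume N = 0 ∧
      ∀ S, MeasurableSet S → Disjoint S N →
        μ.restrict S = volume.withDensity (S.indicator (μ.rnDeriv volume)) := by
  have hs := Measure.mutuallySingular_singularPart μ volume
  refine ⟨hs.nullSetᶜ, hs.measurableSet_nullSet.compl, hs.measure_compl_nullSet, ?_⟩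
  intro S hS hdisj
  rw [withDensity_indicator hS, ← restrict_withDensity hS]
  nth_rewrite 1 [← Measure.singularPart_add_rnDeriv μ volume]
  rw [Measure.restrict_add]
  have : (μ.singularPart volume).restrict S = 0 := by
    rw [Measure.restrict_eq_zero]
    refine measure_mono_null (fun x hx => ?_) hs.measure_nullSet
    by_contra h
    exact Set.disjoint_left.1 hdisj hx h
  rw [this, zero_add]

/-- The upper bound for the mean cost of a partial matching in an arbitrary region. -/
theorem limsup_regionCost_le (hp : 0 < p) (hpd : 2 * p < d) {β : ℝ≥0∞} (hβ' : β ≠ ∞)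
    (hβ : Tendsto (fun n : ℕ => ENNReal.ofReal ((n : ℝ) ^ (p / d - 1)) * cubeCost d p n) atTop
      (𝓝 β)) {α : ℝ} (hα0 : 0 ≤ α) (hα : p < α * (1 - p / d))
    (hμ : ∫⁻ x, ENNReal.ofReal (‖x‖ ^ α) ∂μ ≠ ∞)
    {S : Set (EuclideanSpace ℝ (Fin d))} (hS : MeasurableSet S) :
    limsup (regionCost p (powCost d p) (normPenalty d p) μ S) atTop ≤
      β * ∫⁻ x in S, (μ.rnDeriv volume x) ^ (1 - p / d) := by
  have hd : 0 < (d : ℝ) := by linarith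
  have hpd' : p / d < 1 / 2 := by rw [div_lt_div_iff₀ hd (by norm_num)]; linarith
  refine ENNReal.le_of_forall_pos_le_add fun ε hε _ => ?_
  obtain ⟨R, hR, htail⟩ := exists_regionCost_tail_le hp hpd hα0 hα hμ (ε := ε) (by simpa using hε)
  obtain ⟨N, hN, hN0, hdens⟩ := exists_null_restrict_eq_withDensity (μ := μ)
  set B : Set (EuclideanSpace ℝ (Fin d)) := Metric.closedBall 0 R with hB
  have hBm : MeasurableSet B := Metric.isClosed_closedBall.measurableSet
  -- Three pieces: the bounded absolutely continuous part, which produces the integral, a bounded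
  -- null part, and the tail.
  set S₁ := (S ∩ B) \ N with hS₁
  set S₂ := (S ∩ B) ∩ N with hS₂
  set S₃ := S \ B with hS₃
  have hm₁ : MeasurableSet S₁ := (hS.inter hBm).diff hN
  have hm₂ : MeasurableSet S₂ := (hS.inter hBm).inter hN
  have hm₃ : MeasurableSet S₃ := hS.diff hBm
  have hS₁B : S₁ ⊆ B := fun x hx => hx.1.2
  have h1 : limsup (regionCost p (powCost d p) (normPenalty d p) μ S₁) atTop ≤
      β * ∫⁻ x in S, (μ.rnDeriv volume x) ^ (1 - p / d) := by
    have := limsup_lintegral_locCost_le_of_withDensity hp hpd hβ' hβ μ hm₁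
      (Metric.isBounded_closedBall.subset hS₁B)
      ((Measure.measurable_rnDeriv μ volume).indicator hm₁) (hdens S₁ hm₁ Set.disjoint_sdiff_left)
      (D := (2 * R) ^ p) (by positivity)
    refine le_trans (limsup_le_limsup (.of_forall fun n => ?_)) (this.trans ?_)
    · exact regionCost_mono (fun _ _ _ _ => le_rfl)
        (fun x hx => normPenalty_le hp.le (mem_closedBall_zero_iff.1 (hS₁B hx))) n
    · refine mul_le_mul_right ?_ _
      rw [← lintegral_indicator hS]
      refine lintegral_mono fun x => ?_
      by_cases hx : x ∈ S₁
      · rw [Set.indicator_of_mem hx, Set.indicator_of_mem (hx.1.1 : x ∈ S)]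
      · rw [Set.indicator_of_notMem hx, ENNReal.zero_rpow_of_pos (by linarith)]
        exact zero_le
  have h2 : limsup (regionCost p (powCost d p) (normPenalty d p) μ S₂) atTop ≤ 0 :=
    limsup_regionCost_null hp hpd hm₂
      (Metric.isBounded_closedBall.subset fun x hx => hx.1.2)
      (measure_mono_null Set.inter_subset_right hN0)
  have h3 : limsup (regionCost p (powCost d p) (normPenalty d p) μ S₃) atTop ≤ ε := by
    refine limsup_le_of_le (by isBoundedDefault) (.of_forall fun n => htail _ hm₃ ?_ n)
    intro x hx
    have := hx.2
    simpa [hB] using this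
  have h12 : limsup (regionCost p (powCost d p) (normPenalty d p) μ (S ∩ B)) atTop ≤
      β * (∫⁻ x in S, (μ.rnDeriv volume x) ^ (1 - p / d)) + 0 := by
    refine ENNReal.limsup_le_add (.of_forall fun n => ?_) h1 h2
    have : S ∩ B = S₁ ∪ S₂ := by rw [hS₁, hS₂, Set.sdiff_union_inter]
    rw [this]
    exact regionCost_union_le (measurable_powCost p) (measurable_normPenalty d p) hm₁
      (Set.disjoint_left.2 fun x hx hx' => hx.2 hx'.2) n
  rw [add_zero] at h12
  refine ENNReal.limsup_le_add (.of_forall fun n => ?_) h12 h3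
  have : S = (S ∩ B) ∪ S₃ := by rw [hS₃, Set.inter_union_sdiff]
  nth_rewrite 1 [this]
  exact regionCost_union_le (measurable_powCost p) (measurable_normPenalty d p) (hS.inter hBm)
    (Set.disjoint_left.2 fun x hx hx' => hx'.2 hx.2) n

end UpperBound

/-! ### The lower bound by nearest neighbours. -/

section NearestNeighbour

/-- One point of the first sample and the whole second sample are jointly distributed as `μ ⊗ μ^n`;
the reindexing `e` selects these coordinates. -/
theorem lintegral_pi_inl_inr {E : Type*} [MeasurableSpace E] (μ : Measure E)
    [IsProbabilityMeasure μ] {n : ℕ} (i : Fin n) {f : E → (Fin n → E) → ℝ≥0∞}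
    (hf : Measurable (Function.uncurry f)) :
    ∫⁻ z : Fin n ⊕ Fin n → E, f (z (Sum.inl i)) (fun j => z (Sum.inr j))
      ∂(Measure.pi fun _ => μ) = ∫⁻ x, ∫⁻ y, f x y ∂(Measure.pi fun _ => μ) ∂μ := by
  let e : Fin (n + 1) → Fin n ⊕ Fin n := Fin.cons (Sum.inl i) Sum.inr
  have he : e.Injective := by
    rw [Fin.cons_injective_iff]
    exact ⟨by simp, Sum.inr_injective⟩
  have h1 := pi_map_comp_injective (fun _ : Fin n ⊕ Fin n => μ) he (fun _ => μ) (by simp)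
  simp only [measure_univ, Finset.prod_const_one, one_smul] at h1
  have h2 := (measurePreserving_piFinSuccAbove (fun _ : Fin (n + 1) => μ) 0)
  have h3 := lintegral_prod (μ := μ) (ν := Measure.pi fun _ : Fin n => μ) _ hf.aemeasurable
  simp only [Function.uncurry_apply_pair] at h3
  rw [← h3, ← h2.lintegral_comp hf, ← h1, lintegral_map]
  · rfl
  · exact hf.comp h2.measurable
  · exact measurable_pi_lambda _ fun j => measurable_pi_apply _

/-- A lower bound for the cost in terms of the distance to the nearest neighbour. -/
theorem mul_lintegral_le_lintegral_locCost {E : Type*} [MeasurableSpace E] (μ : Measure E)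
    [IsProbabilityMeasure μ] {κ : E → E → ℝ≥0∞} {a φ : E → ℝ≥0∞} (hφ : Measurable φ)
    {G : Set (E × E)} (hG : MeasurableSet G) (hκ : ∀ x y, (x, y) ∈ G → φ x ≤ κ x y)
    (ha : ∀ x, φ x ≤ a x) (n : ℕ) :
    n * ∫⁻ x, φ x * μ (Prod.mk x ⁻¹' G) ^ n ∂μ ≤
      ∫⁻ z : Fin n ⊕ Fin n → E, locCost κ a Set.univ z ∂(Measure.pi fun _ => μ) := by
  classical
  -- Equal to `φ x` if every `(x, y j)` is in `G`, and to `0` otherwise: a price paid by `x` whether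
  -- it is matched or not.
  let f : E → (Fin n → E) → ℝ≥0∞ := fun x y =>
    Set.indicator {w : E × (Fin n → E) | ∀ j, (w.1, w.2 j) ∈ G} (fun w => φ w.1) (x, y)
  have hset : MeasurableSet {w : E × (Fin n → E) | ∀ j, (w.1, w.2 j) ∈ G} := by
    rw [Set.ofPred_forall]
    refine MeasurableSet.iInter fun j => ?_
    have : Measurable fun w : E × (Fin n → E) => (w.1, w.2 j) :=
      measurable_fst.prodMk ((measurable_pi_apply j).comp measurable_snd)
    exact this hG
  have hf : Measurable (Function.uncurry f) := (hφ.comp measurable_fst).indicator hset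
  have hint : ∀ x, ∫⁻ y, f x y ∂(Measure.pi fun _ : Fin n => μ) =
      φ x * μ (Prod.mk x ⁻¹' G) ^ n := by
    intro x
    have e : (fun y => f x y) = Set.indicator (Set.univ.pi fun _ : Fin n => Prod.mk x ⁻¹' G)
        (fun _ => φ x) := by
      ext y
      simp only [f, Set.indicator_apply]
      congr 1
      simp
    rw [e, lintegral_indicator_const, Measure.pi_pi]
    · simp
    · exact MeasurableSet.univ_pi fun _ => measurable_prodMk_left hG
  calc n * ∫⁻ x, φ x * μ (Prod.mk x ⁻¹' G) ^ n ∂μ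
      = ∑ i : Fin n, ∫⁻ z : Fin n ⊕ Fin n → E, f (z (Sum.inl i)) (fun j => z (Sum.inr j))
          ∂(Measure.pi fun _ => μ) := by
        simp_rw [lintegral_pi_inl_inr μ _ hf, hint]
        simp
    _ = ∫⁻ z : Fin n ⊕ Fin n → E, ∑ i : Fin n, f (z (Sum.inl i)) (fun j => z (Sum.inr j))
          ∂(Measure.pi fun _ => μ) := by
        refine (lintegral_finsetSum _ fun i _ => ?_).symm
        have : Measurable fun z : Fin n ⊕ Fin n → E =>
            (z (Sum.inl i), fun j : Fin n => z (Sum.inr j)) :=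
          (measurable_pi_apply _).prodMk (measurable_pi_lambda _ fun j => measurable_pi_apply _)
        exact hf.comp this
    _ ≤ _ := by
        refine lintegral_mono fun z => ?_
        rw [locCost, idxIn_univ, idxIn_univ]
        refine sum_le_pmCost (g := fun i : Fin n => f (z (Sum.inl i)) (fun j => z (Sum.inr j)))
          (fun i _ j _ => ?_) fun i _ => ?_
        · simp only [f, Set.indicator_apply]
          split_ifs with h
          · exact hκ _ _ (h j)
          · exact zero_le
        · refine le_trans ?_ (ha _)
          exact Set.indicator_le_self' (fun _ _ => zero_le) _

variable {d : ℕ} {p : ℝ}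

/-- The cost truncated at `D`. -/
noncomputable def truncCost (d : ℕ) (p : ℝ) (D : ℝ≥0∞) (x y : EuclideanSpace ℝ (Fin d)) : ℝ≥0∞ :=
  min (powCost d p x y) D

theorem measurable_truncCost (p : ℝ) (D : ℝ≥0∞) :
    Measurable (Function.uncurry (truncCost d p D)) :=
  (measurable_powCost p).min measurable_const

/-- A density point: the probability that a ball of the natural radius is empty. -/
theorem tendsto_measure_compl_closedBall_pow (μ : Measure (EuclideanSpace ℝ (Fin d)))
    [IsProbabilityMeasure μ] (hd : 0 < d) {x : EuclideanSpace ℝ (Fin d)} {F : ℝ} (hF : 0 < F)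
    (h : Tendsto (fun r => μ (Metric.closedBall x r) / volume (Metric.closedBall x r)) (𝓝[>] 0)
      (𝓝 (ENNReal.ofReal F))) :
    Tendsto (fun n : ℕ => μ (Metric.closedBall x ((n * F) ^ (-(1 / d : ℝ))))ᶜ ^ n) atTop
      (𝓝 (ENNReal.ofReal (Real.exp (-(volume.real (Metric.ball (0 : EuclideanSpace ℝ (Fin d)) 1)))))) := by
  set v := volume.real (Metric.ball (0 : EuclideanSpace ℝ (Fin d)) 1) with hv
  have hd' : (0 : ℝ) < d := by exact_mod_cast hd
  have hv0 : 0 < v := ENNReal.toReal_pos (Metric.measure_ball_pos volume _ one_pos).ne'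
    measure_ball_lt_top.ne
  set r : ℕ → ℝ := fun n => (n * F) ^ (-(1 / d : ℝ)) with hr
  have hr0 : Tendsto r atTop (𝓝[>] 0) := by
    refine tendsto_nhdsWithin_iff.2 ⟨?_, ?_⟩
    · refine (tendsto_rpow_neg_atTop (y := 1 / d) (by positivity)).comp ?_
      exact tendsto_natCast_atTop_atTop.atTop_mul_const hF
    · filter_upwards [eventually_gt_atTop 0] with n hn
      have : (0 : ℝ) < n := by exact_mod_cast hn
      exact Real.rpow_pos_of_pos (by positivity) _
  have h1 := (ENNReal.tendsto_toReal ENNReal.ofReal_ne_top).comp (h.comp hr0)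
  rw [ENNReal.toReal_ofReal hF.le] at h1
  -- Since `r n ^ d = 1 / (n * F)`, the ball has volume `v / (n * F)`, and differentiation of
  -- measures gives it a mass asymptotic to `v / n`.
  have h2 : Tendsto (fun n : ℕ => (n : ℝ) * -μ.real (Metric.closedBall x (r n))) atTop (𝓝 (-v)) := by
    have h3 := (h1.mul_const (v / F)).neg
    rw [mul_div_cancel₀ _ hF.ne'] at h3
    refine h3.congr' ?_
    filter_upwards [eventually_gt_atTop 0] with n hn
    have hn' : (0 : ℝ) < n := by exact_mod_cast hn
    have hrn : 0 < r n := Real.rpow_pos_of_pos (by positivity) _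
    have hrd : r n ^ d = 1 / (n * F) := by
      rw [hr, ← Real.rpow_natCast, ← Real.rpow_mul (by positivity), neg_mul,
        one_div_mul_cancel hd'.ne', Real.rpow_neg_one, one_div]
    simp only [Function.comp_apply]
    rw [ENNReal.toReal_div, Measure.addHaar_closedBall volume _ hrn.le, finrank_euclideanSpace,
      Fintype.card_fin, ENNReal.toReal_mul, ENNReal.toReal_ofReal (by positivity), hrd]
    simp only [Measure.real] at hv ⊢
    rw [← hv]
    field_simp
  have h4 := Real.tendsto_one_add_pow_exp_of_tendsto h2
  refine (ENNReal.tendsto_ofReal h4).congr fun n => ?_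
  rw [ENNReal.ofReal_pow]
  · congr 1
    rw [← sub_eq_add_neg, ← probReal_compl_eq_one_sub Metric.isClosed_closedBall.measurableSet,
      ofReal_measureReal]
  · rw [← sub_eq_add_neg, sub_nonneg]
    exact measureReal_le_one

/-- The lower bound with a non-optimal constant. -/
theorem le_liminf_regionCost (hp : 0 < p) (hpd : 2 * p < d)
    (μ : Measure (EuclideanSpace ℝ (Fin d))) [IsProbabilityMeasure μ] :
    ENNReal.ofReal (Real.exp (-(volume.real (Metric.ball (0 : EuclideanSpace ℝ (Fin d)) 1)))) *
      densityPowerIntegral p μ ≤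
      liminf (regionCost p (truncCost d p 1) (fun _ => 1) μ Set.univ) atTop := by
  have hd : 0 < (d : ℝ) := by linarith
  have hd0 : 0 < d := by exact_mod_cast hd
  have hpd' : p / d < 1 / 2 := by rw [div_lt_div_iff₀ hd (by norm_num)]; linarith
  set c := ENNReal.ofReal
    (Real.exp (-(volume.real (Metric.ball (0 : EuclideanSpace ℝ (Fin d)) 1)))) with hc
  set f := μ.rnDeriv volume with hf
  have hfm : Measurable f := Measure.measurable_rnDeriv _ _
  -- The natural distance to a nearest neighbour at local density `f x`. Where `n * (f x).toReal =
  -- 0` the default value `0` of the power makes `φ` vanish, which is harmless for a lower bound.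
  let r : ℕ → EuclideanSpace ℝ (Fin d) → ℝ := fun n x => (n * (f x).toReal) ^ (-(1 / d : ℝ))
  have hrm : ∀ n, Measurable (r n) := fun n => ((hfm.ennreal_toReal.const_mul _).pow_const _)
  let G : ℕ → Set (EuclideanSpace ℝ (Fin d) × EuclideanSpace ℝ (Fin d)) := fun n =>
    {w | r n w.1 < dist w.1 w.2}
  have hGm : ∀ n, MeasurableSet (G n) := fun n =>
    measurableSet_lt ((hrm n).comp measurable_fst) (measurable_fst.dist measurable_snd)
  let φ : ℕ → EuclideanSpace ℝ (Fin d) → ℝ≥0∞ := fun n x => ENNReal.ofReal (min (r n x ^ p) 1)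
  have hφm : ∀ n, Measurable (φ n) := fun n =>
    ENNReal.measurable_ofReal.comp (((hrm n).pow_const p).min measurable_const)
  let g : ℕ → EuclideanSpace ℝ (Fin d) → ℝ≥0∞ := fun n x =>
    ENNReal.ofReal ((n : ℝ) ^ (p / d)) * (φ n x * μ (Prod.mk x ⁻¹' G n) ^ n)
  have hgm : ∀ n, Measurable (g n) := fun n =>
    (((hφm n).mul ((measurable_measure_prodMk_left (hGm n)).pow_const n)).const_mul _)
  have hle : ∀ᶠ n : ℕ in atTop, ∫⁻ x, g n x ∂μ ≤
      regionCost p (truncCost d p 1) (fun _ => 1) μ Set.univ n := by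
    filter_upwards [eventually_gt_atTop 0] with n hn
    have hn' : (0 : ℝ) < n := by exact_mod_cast hn
    have e₀ : ∫⁻ x, g n x ∂μ = ENNReal.ofReal ((n : ℝ) ^ (p / d)) *
        ∫⁻ x, φ n x * μ (Prod.mk x ⁻¹' G n) ^ n ∂μ := lintegral_const_mul _
      ((hφm n).mul ((measurable_measure_prodMk_left (hGm n)).pow_const n))
    rw [e₀, regionCost]
    have e : (n : ℝ) ^ (p / d) = (n : ℝ) ^ (p / d - 1) * n := by
      rw [← Real.rpow_add_one hn'.ne', sub_add_cancel]
    rw [e, ENNReal.ofReal_mul (by positivity), mul_assoc, ENNReal.ofReal_natCast]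
    gcongr
    refine mul_lintegral_le_lintegral_locCost μ (hφm n) (hGm n) (fun x y hxy => ?_) (fun x => ?_) n
    · have hxy : r n x < dist x y := hxy
      have hr0 : 0 ≤ r n x := Real.rpow_nonneg (by positivity) _
      rw [truncCost, powCost, edist_dist, ENNReal.ofReal_rpow_of_nonneg dist_nonneg hp.le]
      refine le_min (ENNReal.ofReal_le_ofReal ((min_le_left _ _).trans ?_)) ?_
      · exact Real.rpow_le_rpow hr0 hxy.le hp.le
      · exact ENNReal.ofReal_le_one.2 (min_le_right _ _)
    · exact ENNReal.ofReal_le_one.2 (min_le_right _ _)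
  -- At a density point with `f x > 0`, `g n x` tends to `c * f x ^ (-p / d)`: the scaled distance
  -- times the limiting probability that the ball is empty. Fatou's lemma then integrates the limit.
  have hpt : ∀ᵐ x, c * f x ^ (1 - p / d) ≤ f x * liminf (fun n => g n x) atTop := by
    filter_upwards [Besicovitch.ae_tendsto_rnDeriv μ volume, Measure.rnDeriv_lt_top μ volume]
      with x hx hxt
    rcases eq_or_ne (f x) 0 with h0 | h0
    · rw [h0, ENNReal.zero_rpow_of_pos (by linarith)]
      simp
    set F := (f x).toReal with hFdef
    have hF : 0 < F := ENNReal.toReal_pos h0 hxt.ne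
    have hfF : f x = ENNReal.ofReal F := (ENNReal.ofReal_toReal hxt.ne).symm
    have h1 := tendsto_measure_compl_closedBall_pow μ hd0 hF (by rw [← hfF]; exact hx)
    have h2 : Tendsto (fun n => g n x) atTop (𝓝 (ENNReal.ofReal (F ^ (-(p / d))) * c)) := by
      have h3 := ENNReal.Tendsto.const_mul (a := ENNReal.ofReal (F ^ (-(p / d)))) h1
        (Or.inr ENNReal.ofReal_ne_top)
      refine h3.congr' ?_
      have hn1 : ∀ᶠ n : ℕ in atTop, 1 ≤ (n : ℝ) * F :=
        (tendsto_natCast_atTop_atTop.atTop_mul_const hF).eventually_ge_atTop 1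
      filter_upwards [eventually_gt_atTop 0, hn1] with n hn hnF
      have hn' : (0 : ℝ) < n := by exact_mod_cast hn
      have hset : Prod.mk x ⁻¹' G n = (Metric.closedBall x ((n * F) ^ (-(1 / d : ℝ))))ᶜ := by
        ext y
        simp only [G, r, Set.mem_preimage, Set.mem_compl_iff, Metric.mem_closedBall, not_le,
          dist_comm y x]
        rfl
      simp only [g, φ]
      rw [hset, ← mul_assoc, ← ENNReal.ofReal_mul (by positivity)]
      congr 2
      have hrp : r n x ^ p = (n * F) ^ (-(p / d)) := by
        simp only [r]
        rw [← Real.rpow_mul (by positivity)]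
        congr 1
        ring
      rw [hrp, min_eq_left (Real.rpow_le_one_of_one_le_of_nonpos hnF (by
        rw [neg_nonpos]; positivity)), Real.mul_rpow hn'.le hF.le, ← mul_assoc,
        ← Real.rpow_add hn', add_neg_cancel, Real.rpow_zero, one_mul]
    rw [h2.liminf_eq, hfF, ENNReal.ofReal_rpow_of_pos hF, ← mul_assoc,
      ← ENNReal.ofReal_mul hF.le, mul_comm c]
    refine mul_le_mul_left (le_of_eq ?_) _
    rw [← Real.rpow_one_add' hF.le (by linarith), ← sub_eq_add_neg]
  calc c * densityPowerIntegral p μ = ∫⁻ x, c * f x ^ (1 - p / d) := by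
        rw [densityPowerIntegral, lintegral_const_mul _ (hfm.pow_const _)]
    _ ≤ ∫⁻ x, f x * liminf (fun n => g n x) atTop := lintegral_mono_ae hpt
    _ = ∫⁻ x, liminf (fun n => g n x) atTop ∂(volume.withDensity f) :=
        (lintegral_withDensity_eq_lintegral_mul _ hfm (.liminf hgm)).symm
    _ ≤ ∫⁻ x, liminf (fun n => g n x) atTop ∂μ :=
        lintegral_mono' (Measure.withDensity_rnDeriv_le _ _) le_rfl
    _ ≤ liminf (fun n => ∫⁻ x, g n x ∂μ) atTop := lintegral_liminf_le hgm
    _ ≤ _ := liminf_le_liminf hle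

end NearestNeighbour

/-! ### The sharp lower bound for constant densities. -/

section UniformLower

variable {d : ℕ} {p : ℝ}

/-- The map `m` converts one sample size into another, and `w` is an error that is bounded or
negligible in the limit. -/
theorem ENNReal.mul_liminf_le_liminf_add {ι : Type*} {f : Filter ι} [f.NeBot] {u : ℕ → ℝ≥0∞}
    {v w : ι → ℝ≥0∞} {m : ι → ℕ} {B C : ℝ≥0∞} (hC : C ≠ ∞) (hm : Tendsto m f atTop)
    (h : ∀ᶠ i in f, C * u (m i) ≤ v i + w i) (hw : limsup w f ≤ B) :
    C * liminf u atTop ≤ liminf v f + B := by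
  refine ENNReal.le_of_forall_pos_le_add fun ε hε hB => ?_
  have hB := (ENNReal.add_lt_top.1 hB).2
  have h1 := eventually_lt_of_limsup_lt (hw.trans_lt (ENNReal.lt_add_right hB.ne
    (show (ε : ℝ≥0∞) ≠ 0 by simpa using hε.ne')))
  calc C * liminf u atTop ≤ C * liminf (u ∘ m) f := by
        gcongr
        rw [liminf_comp]
        exact liminf_le_liminf_of_le hm
    _ = liminf (fun i => C * u (m i)) f :=
        Monotone.map_liminf_of_continuousAt (f := fun x => C * x)
          (fun _ _ h => mul_le_mul_right h C) _ (ENNReal.continuous_const_mul hC).continuousAt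
    _ ≤ liminf (fun i => v i + (B + ε)) f := by
        refine liminf_le_liminf ?_
        filter_upwards [h, h1] with i hi h1
        exact hi.trans (add_le_add_right h1.le _)
    _ = liminf v f + (B + ε) := liminf_add_const f v _ (by isBoundedDefault) (by isBoundedDefault)
    _ = _ := (add_assoc _ _ _).symm

/-- A cube containing a bounded set, for which the limit of the mean cost is known. -/
theorem exists_cube (hp : 0 < p) (hd : 0 < d) {β : ℝ≥0∞}
    (hβ : Tendsto (fun n : ℕ => ENNReal.ofReal ((n : ℝ) ^ (p / d - 1)) * cubeCost d p n) atTop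
      (𝓝 β)) {S : Set (EuclideanSpace ℝ (Fin d))} (hSb : Bornology.IsBounded S) :
    ∃ (L : ℝ) (K : Set (EuclideanSpace ℝ (Fin d))), 0 < L ∧ MeasurableSet K ∧
      Bornology.IsBounded K ∧ S ⊆ K ∧ volume K = ENNReal.ofReal (L ^ d) ∧
      (∀ x ∈ S, ∀ y ∈ S, powCost d p x y ≤ cellCost d p L) ∧
      Tendsto (fun n : ℕ => ENNReal.ofReal ((n : ℝ) ^ (p / d - 1)) *
        meanCost (powCost d p) (fun _ => cellCost d p L) (volume[|K]) n n) atTop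
        (𝓝 (ENNReal.ofReal (L ^ p) * β)) := by
  obtain ⟨R, hR0, hR⟩ : ∃ R : ℝ, 0 < R ∧ S ⊆ Metric.closedBall 0 R := by
    obtain ⟨R, hR⟩ := hSb.subset_closedBall 0
    exact ⟨max R 1, by positivity, hR.trans (Metric.closedBall_subset_closedBall (le_max_left _ _))⟩
  -- The preimage of the unit cube under `x ↦ L⁻¹ • x + (1/2, …, 1/2)` is a cube of side `L` centred
  -- at the origin; coordinates of size at most `R` are moved into `[1/4, 3/4]`.
  set L : ℝ := 4 * R with hL
  have hL0 : 0 < L := by positivity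
  let w : EuclideanSpace ℝ (Fin d) := WithLp.toLp 2 fun _ => 1 / 2
  let ψ : EuclideanSpace ℝ (Fin d) → EuclideanSpace ℝ (Fin d) := fun x => L⁻¹ • x + w
  have hψ : Measurable ψ := by fun_prop
  set U := cellIdx (d := d) 1 ⁻¹' {0} with hU
  have hUm : MeasurableSet U := measurableSet_cell 1 0
  have hvol : volume (ψ ⁻¹' U) = ENNReal.ofReal (L ^ d) := by
    have : ψ ⁻¹' U = (L⁻¹ • ·) ⁻¹' ((· + w) ⁻¹' U) := rfl
    rw [this, Measure.addHaar_preimage_smul _ (by positivity), measure_preimage_add_right, hU,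
      volume_cell one_pos, finrank_euclideanSpace, Fintype.card_fin]
    simp [abs_of_pos hL0]
  have hprob : IsProbabilityMeasure (volume[|ψ ⁻¹' U]) := by
    refine cond_isProbabilityMeasure_of_finite ?_ ?_
    · rw [hvol]
      simpa using pow_pos hL0 d
    · rw [hvol]
      exact ENNReal.ofReal_ne_top
  have hsd : 1 ≤ √(d : ℝ) := by
    rw [Real.one_le_sqrt]
    exact_mod_cast hd
  refine ⟨L, ψ ⁻¹' U, hL0, hψ hUm, ?_, ?_, hvol, ?_, ?_⟩
  · rw [Metric.isBounded_iff]
    refine ⟨√d * L, fun x hx y hy => ?_⟩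
    have h1 : dist (ψ x) (ψ y) ≤ √d * 1 :=
      dist_le_of_cellIdx_eq one_pos ((show cellIdx 1 (ψ x) = 0 from hx).trans
        (show cellIdx 1 (ψ y) = 0 from hy).symm)
    simp only [ψ] at h1
    rw [dist_add_right, dist_smul₀, norm_inv, Real.norm_eq_abs, abs_of_pos hL0, mul_one,
      inv_mul_le_iff₀ hL0] at h1
    linarith
  · intro x hx
    have hx := hR hx
    rw [mem_closedBall_zero_iff] at hx
    show cellIdx 1 (ψ x) = 0
    ext i
    have h1 : |x i| ≤ R := by
      have := PiLp.norm_apply_le x i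
      rw [Real.norm_eq_abs] at this
      exact this.trans hx
    have h2 := abs_le.1 h1
    have e : ψ x i / 1 = (x i) / L + 1 / 2 := by
      simp [ψ, w]
      ring
    simp only [cellIdx, Pi.zero_apply]
    rw [e, Int.floor_eq_iff]
    have h3 : x i / L ≤ 1 / 4 := by
      rw [div_le_iff₀ hL0]
      linarith
    have h4 : -(1 / 4) ≤ x i / L := by
      rw [le_div_iff₀ hL0]
      linarith
    constructor
    · push_cast
      linarith
    · push_cast
      linarith
  · intro x hx y hy
    rw [powCost, cellCost, edist_dist, ENNReal.ofReal_rpow_of_nonneg dist_nonneg hp.le]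
    refine ENNReal.ofReal_le_ofReal (Real.rpow_le_rpow dist_nonneg ?_ hp.le)
    have h1 := mem_closedBall_zero_iff.1 (hR hx)
    have h2 := mem_closedBall_zero_iff.1 (hR hy)
    have h3 := dist_le_norm_add_norm x y
    nlinarith
  · have h1 : ∀ n : ℕ, meanCost (powCost d p) (fun _ => cellCost d p L) (volume[|ψ ⁻¹' U]) n n =
        ENNReal.ofReal (L ^ p) * cubeCost d p n := by
      intro n
      have h2 := meanCost_map_affine hp.le (inv_pos.2 hL0) w (volume[|ψ ⁻¹' U]) (cellCost d p L) n n
      rw [cond_map_affine (inv_pos.2 hL0) w hUm, cellCost_eq hL0, ← mul_assoc,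
        ← ENNReal.ofReal_mul (by positivity), Real.inv_rpow hL0.le,
        inv_mul_cancel₀ (by positivity), ENNReal.ofReal_one, one_mul] at h2
      rw [cubeCost, h2, ← mul_assoc, ← ENNReal.ofReal_mul (by positivity),
        mul_inv_cancel₀ (by positivity), ENNReal.ofReal_one, one_mul, ← cellCost_eq hL0]
    refine (ENNReal.Tendsto.const_mul hβ (Or.inr ENNReal.ofReal_ne_top)).congr fun n => ?_
    rw [h1, mul_left_comm]

/-- The lower bound for the part of a uniform sample of a cube that lies in a subset. -/
theorem exists_le_liminf_regionCost_subset (hp : 0 < p) (hpd : 2 * p < d) {β : ℝ≥0∞} (hβ' : β ≠ ∞)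
    (hβ : Tendsto (fun n : ℕ => ENNReal.ofReal ((n : ℝ) ^ (p / d - 1)) * cubeCost d p n) atTop
      (𝓝 β)) {S : Set (EuclideanSpace ℝ (Fin d))} (hS : MeasurableSet S)
    (hSb : Bornology.IsBounded S) :
    ∃ (L : ℝ) (K : Set (EuclideanSpace ℝ (Fin d))), 0 < L ∧ MeasurableSet K ∧ S ⊆ K ∧
      volume K = ENNReal.ofReal (L ^ d) ∧
      (∀ x ∈ S, ∀ y ∈ S, powCost d p x y ≤ cellCost d p L) ∧
      β * (ENNReal.ofReal (L ^ (p - d)) * volume S) ≤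
        liminf (regionCost p (powCost d p) (fun _ => cellCost d p L) (volume[|K]) S) atTop := by
  have hd : 0 < (d : ℝ) := by linarith
  have hpd' : p / d < 1 / 2 := by rw [div_lt_div_iff₀ hd (by norm_num)]; linarith
  obtain ⟨L, K, hL, hK, hKb, hSK, hvol, hdiam, hlim⟩ := exists_cube hp (by exact_mod_cast hd) hβ hSb
  refine ⟨L, K, hL, hK, hSK, hvol, hdiam, ?_⟩
  have hLd : 0 < L ^ d := by positivity
  have hK0 : volume K ≠ 0 := by rw [hvol]; simpa using hLd
  have hKt : volume K ≠ ∞ := by rw [hvol]; exact ENNReal.ofReal_ne_top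
  have := cond_isProbabilityMeasure_of_finite hK0 hKt
  have hT : MeasurableSet (K \ S) := hK.diff hS
  set h : EuclideanSpace ℝ (Fin d) → ℝ≥0∞ := (K \ S).indicator fun _ => (volume K)⁻¹ with hh
  have hdens : (volume[|K]).restrict (K \ S) = volume.withDensity h := by
    rw [hh, withDensity_indicator hT, withDensity_const, ProbabilityTheory.cond,
      Measure.restrict_smul, Measure.restrict_restrict hT,
      Set.inter_eq_left.2 Set.sdiff_subset]
  have hint : ∫⁻ x, h x ^ (1 - p / d) = ENNReal.ofReal (L ^ (p - d)) * volume (K \ S) := by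
    have : (fun x => h x ^ (1 - p / d)) =
        (K \ S).indicator fun _ => ENNReal.ofReal (L ^ (p - d)) := by
      ext x
      by_cases hx : x ∈ K \ S
      · rw [hh, Set.indicator_of_mem hx, Set.indicator_of_mem hx, hvol,
          ← ENNReal.ofReal_inv_of_pos hLd, ENNReal.ofReal_rpow_of_pos (by positivity)]
        congr 1
        rw [Real.inv_rpow hLd.le, ← Real.rpow_natCast, ← Real.rpow_mul hL.le,
          ← Real.rpow_neg hL.le]
        congr 1
        field_simp
        ring
      · rw [hh, Set.indicator_of_notMem hx, Set.indicator_of_notMem hx,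
          ENNReal.zero_rpow_of_pos (by linarith)]
    rw [this, lintegral_indicator_const hT]
  have hupper := limsup_lintegral_locCost_le_of_withDensity hp hpd hβ' hβ (volume[|K]) hT
    (hKb.subset Set.sdiff_subset) (measurable_const.indicator hT) hdens (D := (√d * L) ^ p)
    (by positivity)
  rw [hint] at hupper
  have hBfin : β * (ENNReal.ofReal (L ^ (p - d)) * volume (K \ S)) ≠ ∞ :=
    ENNReal.mul_ne_top hβ' (ENNReal.mul_ne_top ENNReal.ofReal_ne_top
      (measure_ne_top_of_subset Set.sdiff_subset hKt))
  -- The cost of `K` is at most that of `S` plus that of `K \ S`. The first has limit `β` times `L ^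
  -- p` and the last has the sharp upper bound, so finiteness allows subtraction.
  have hmain := ENNReal.mul_liminf_le_liminf_add (f := atTop) (m := id) ENNReal.one_ne_top tendsto_id
    (u := fun n : ℕ => ENNReal.ofReal ((n : ℝ) ^ (p / d - 1)) *
        meanCost (powCost d p) (fun _ => cellCost d p L) (volume[|K]) n n)
    (v := regionCost p (powCost d p) (fun _ => cellCost d p L) (volume[|K]) S)
    (w := regionCost p (powCost d p) (fun _ => cellCost d p L) (volume[|K]) (K \ S))
    (.of_forall fun n => ?_) hupper
  · rw [hlim.liminf_eq, one_mul] at hmain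
    refine (ENNReal.add_le_add_iff_right hBfin).1 (le_trans (le_of_eq ?_) hmain)
    rw [← mul_add, ← mul_add, mul_comm _ β]
    congr 1
    rw [← measure_inter_add_sdiff K hS, Set.inter_eq_right.2 hSK] at hvol
    rw [hvol, ← ENNReal.ofReal_mul (by positivity), ← Real.rpow_natCast, ← Real.rpow_add hL,
      sub_add_cancel]
  · rw [one_mul]
    have e : ENNReal.ofReal ((n : ℝ) ^ (p / d - 1)) *
        meanCost (powCost d p) (fun _ => cellCost d p L) (volume[|K]) n n =
        regionCost p (powCost d p) (fun _ => cellCost d p L) (volume[|K]) Set.univ n := rfl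
    have hKu : (Set.univ : Set (EuclideanSpace ℝ (Fin d))) =ᵐ[volume[|K]] K := by
      filter_upwards [ae_cond_mem hK] with x hx
      exact (eq_true hx : (x ∈ K) = True).symm
    simp only [id]
    rw [e, regionCost_congr_ae hKu]
    nth_rewrite 2 [← Set.union_sdiff_cancel hSK]
    exact regionCost_union_le (measurable_powCost p) measurable_const hS Set.disjoint_sdiff_right n

/-- Fluctuations of order `√n` are invisible after normalisation because `p / d < 1 / 2`. -/
theorem tendsto_scaled_sqrt (hpd : 2 * p < d) {D : ℝ≥0∞} (hD : D ≠ ∞) :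
    Tendsto (fun n : ℕ => ENNReal.ofReal ((n : ℝ) ^ (p / d - 1)) *
      (D * ENNReal.ofReal (2 * (√n + 2)))) atTop (𝓝 0) := by
  have hpd' : p / d < 1 / 2 := by
    rcases Nat.eq_zero_or_pos d with rfl | h
    · simp
    · have hd : 0 < (d : ℝ) := by exact_mod_cast h
      rw [div_lt_div_iff₀ hd (by norm_num)]
      linarith
  have h1 : Tendsto (fun n : ℕ => 6 * (n : ℝ) ^ (p / d - 1 / 2)) atTop (𝓝 0) := by
    have := (tendsto_rpow_neg_atTop (y := 1 / 2 - p / d) (by linarith)).comp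
      (tendsto_natCast_atTop_atTop (R := ℝ))
    simpa using this.const_mul 6
  have h2 := ENNReal.Tendsto.const_mul (a := D) (ENNReal.tendsto_ofReal h1) (Or.inr hD)
  rw [ENNReal.ofReal_zero, mul_zero] at h2
  refine tendsto_of_tendsto_of_tendsto_of_le_of_le' tendsto_const_nhds h2
    (.of_forall fun _ => zero_le) ?_
  filter_upwards [eventually_gt_atTop 0] with n hn
  have hn1 : (1 : ℝ) ≤ n := by exact_mod_cast hn
  have hn' : (0 : ℝ) < n := by positivity
  rw [mul_left_comm]
  gcongr
  rw [← ENNReal.ofReal_mul (by positivity)]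
  refine ENNReal.ofReal_le_ofReal ?_
  have h3 : (1 : ℝ) ≤ √n := by rwa [Real.one_le_sqrt]
  calc (n : ℝ) ^ (p / d - 1) * (2 * (√n + 2)) ≤ (n : ℝ) ^ (p / d - 1) * (6 * √n) := by
        refine mul_le_mul_of_nonneg_left ?_ (by positivity)
        linarith
    _ = 6 * ((n : ℝ) ^ (p / d - 1) * (n : ℝ) ^ (1 / 2 : ℝ)) := by
        rw [← Real.sqrt_eq_rpow]
        ring
    _ = _ := by
        rw [← Real.rpow_add hn']
        congr 2
        ring

/-- The lower bound for uniform samples of a bounded set. -/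
theorem exists_le_liminf_meanCost (hp : 0 < p) (hpd : 2 * p < d) {β : ℝ≥0∞} (hβ' : β ≠ ∞)
    (hβ : Tendsto (fun n : ℕ => ENNReal.ofReal ((n : ℝ) ^ (p / d - 1)) * cubeCost d p n) atTop
      (𝓝 β)) {S : Set (EuclideanSpace ℝ (Fin d))} (hS : MeasurableSet S)
    (hSb : Bornology.IsBounded S) (hS0 : volume S ≠ 0) :
    ∃ D : ℝ≥0∞, D ≠ ∞ ∧ (∀ x ∈ S, ∀ y ∈ S, powCost d p x y ≤ D) ∧
      β * volume S ^ (p / d) ≤ liminf (fun k : ℕ => ENNReal.ofReal ((k : ℝ) ^ (p / d - 1)) *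
        meanCost (powCost d p) (fun _ => D) (volume[|S]) k k) atTop := by
  have hd : 0 < (d : ℝ) := by linarith
  have hpd' : p / d < 1 / 2 := by rw [div_lt_div_iff₀ hd (by norm_num)]; linarith
  obtain ⟨L, K, hL, hK, hSK, hvol, hdiam, hlim⟩ :=
    exists_le_liminf_regionCost_subset hp hpd hβ' hβ hS hSb
  have hDt : cellCost d p L ≠ ∞ := ENNReal.ofReal_ne_top
  refine ⟨cellCost d p L, hDt, hdiam, ?_⟩
  have hLd : 0 < L ^ d := by positivity
  have hK0 : volume K ≠ 0 := by rw [hvol]; simpa using hLd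
  have hKt : volume K ≠ ∞ := by rw [hvol]; exact ENNReal.ofReal_ne_top
  have := cond_isProbabilityMeasure_of_finite hK0 hKt
  set s := volume.real S with hs
  have hSt : volume S ≠ ∞ := measure_ne_top_of_subset hSK hKt
  have hs0 : 0 < s := ENNReal.toReal_pos hS0 hSt
  have hvS : volume S = ENNReal.ofReal s := (ofReal_measureReal hSt).symm
  set ρ := s / L ^ d with hρ
  have hρ0 : 0 < ρ := by positivity
  have hKS : (volume[|K]) S = ENNReal.ofReal ρ := by
    rw [ProbabilityTheory.cond_apply hK, Set.inter_eq_right.2 hSK, hvol, hvS,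
      ← ENNReal.ofReal_inv_of_pos hLd, ← ENNReal.ofReal_mul (by positivity), hρ]
    congr 1
    field_simp
  have hKSr : (volume[|K]).real S = ρ := by
    rw [Measure.real, hKS, ENNReal.toReal_ofReal hρ0.le]
  have hcond : (volume[|K])[|S] = volume[|S] := by
    rw [ProbabilityTheory.cond_cond_eq_cond_inter' hK hS hKt, Set.inter_eq_right.2 hSK]
  -- Among this many uniform points of `K`, the expected number in `S` is `k` up to at most one;
  -- rounding up gives the monotonicity used for the negative power.
  have hm : Tendsto (fun k : ℕ => ⌈(k : ℝ) / ρ⌉₊) atTop atTop :=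
    tendsto_nat_ceil_atTop.comp (tendsto_natCast_atTop_atTop.atTop_div_const hρ0)
  have hmain := ENNReal.mul_liminf_le_liminf_add (f := atTop) (C := ENNReal.ofReal (ρ ^ (p / d - 1)))
    ENNReal.ofReal_ne_top hm
    (u := regionCost p (powCost d p) (fun _ => cellCost d p L) (volume[|K]) S)
    (v := fun k : ℕ => ENNReal.ofReal ((k : ℝ) ^ (p / d - 1)) *
        meanCost (powCost d p) (fun _ => cellCost d p L) (volume[|S]) k k)
    (w := fun n : ℕ => ENNReal.ofReal ((n : ℝ) ^ (p / d - 1)) *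
      (cellCost d p L * ENNReal.ofReal (2 * (√n + 2)))) ?_
    (tendsto_scaled_sqrt hpd hDt).limsup_eq.le
  · rw [add_zero] at hmain
    refine le_trans ?_ ((mul_le_mul_right hlim _).trans hmain)
    rw [mul_left_comm, hvS, ← ENNReal.ofReal_mul (by positivity),
      ← ENNReal.ofReal_mul (by positivity), ENNReal.ofReal_rpow_of_pos hs0]
    refine mul_le_mul_right (ENNReal.ofReal_le_ofReal (le_of_eq ?_)) _
    rw [hρ, Real.div_rpow hs0.le hLd.le, ← Real.rpow_natCast L d, ← Real.rpow_mul hL.le]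
    have e1 : (d : ℝ) * (p / d - 1) = p - d := by field_simp
    rw [e1, Real.rpow_sub_one hs0.ne']
    have : 0 < L ^ (p - d) := Real.rpow_pos_of_pos hL _
    field_simp
  · filter_upwards [eventually_gt_atTop 0] with k hk
    have hk' : (0 : ℝ) < k := by exact_mod_cast hk
    set m := ⌈(k : ℝ) / ρ⌉₊ with hmk
    have h1 : (k : ℝ) ≤ m * ρ := by
      rw [← div_le_iff₀ hρ0]
      exact Nat.le_ceil _
    have hρ1 : ρ ≤ 1 := by
      rw [← hKSr]
      exact measureReal_le_one
    have h2 : (m : ℝ) * ρ ≤ k + 1 := by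
      have := (Nat.ceil_lt_add_one (show 0 ≤ (k : ℝ) / ρ by positivity)).le
      calc (m : ℝ) * ρ ≤ (k / ρ + 1) * ρ := by gcongr
        _ = k + ρ := by field_simp
        _ ≤ k + 1 := by gcongr
    have hm0 : (0 : ℝ) < m := by
      by_contra! h
      nlinarith
    rw [regionCost, ← mul_assoc, ← ENNReal.ofReal_mul (by positivity), ← mul_add]
    have h3 : ρ ^ (p / d - 1) * (m : ℝ) ^ (p / d - 1) ≤ (k : ℝ) ^ (p / d - 1) := by
      rw [← Real.mul_rpow hρ0.le hm0.le, mul_comm]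
      exact Real.rpow_le_rpow_of_nonpos hk' h1 (by linarith)
    gcongr
    refine (lintegral_locCost_le_meanCost (measurable_powCost p) m k (volume[|K]) hS
      (by rw [hKS]; simpa using hρ0) _).trans ?_
    rw [hcond, hKSr]
    refine add_le_add_right (mul_le_mul_right (ENNReal.ofReal_le_ofReal ?_) _) _
    have h4 : √(m * ρ) ≤ √k + 1 := by
      refine (Real.sqrt_le_sqrt h2).trans ?_
      rw [Real.sqrt_le_left (by positivity)]
      nlinarith [Real.sq_sqrt hk'.le, Real.sqrt_nonneg (k : ℝ)]
    have h5 : |(m : ℝ) * ρ - k| ≤ 1 := by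
      rw [abs_le]
      constructor <;> linarith
    linarith

/-- The lower bound for a set on which the measure has constant density. -/
theorem exists_le_liminf_regionCost_of_const (hp : 0 < p) (hpd : 2 * p < d) {β : ℝ≥0∞}
    (hβ' : β ≠ ∞)
    (hβ : Tendsto (fun n : ℕ => ENNReal.ofReal ((n : ℝ) ^ (p / d - 1)) * cubeCost d p n) atTop
      (𝓝 β)) {S : Set (EuclideanSpace ℝ (Fin d))} (hS : MeasurableSet S)
    (hSb : Bornology.IsBounded S) (hS0 : volume S ≠ 0) {c : ℝ≥0} (hc : 0 < c)
    {μ : Measure (EuclideanSpace ℝ (Fin d))} [IsProbabilityMeasure μ]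
    (hμ : μ.restrict S = (c : ℝ≥0∞) • volume.restrict S) :
    ∃ D : ℝ≥0∞, D ≠ ∞ ∧ (∀ x ∈ S, ∀ y ∈ S, powCost d p x y ≤ D) ∧
      β * ((c : ℝ≥0∞) ^ (1 - p / d) * volume S) ≤
        liminf (regionCost p (powCost d p) (fun _ => D) μ S) atTop := by
  have hd : 0 < (d : ℝ) := by linarith
  have hpd' : p / d < 1 / 2 := by rw [div_lt_div_iff₀ hd (by norm_num)]; linarith
  obtain ⟨D, hDt, hdiam, hlim⟩ := exists_le_liminf_meanCost hp hpd hβ' hβ hS hSb hS0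
  refine ⟨D, hDt, hdiam, ?_⟩
  set s := volume.real S with hs
  have hSt : volume S ≠ ∞ := hSb.measure_lt_top.ne
  have hs0 : 0 < s := ENNReal.toReal_pos hS0 hSt
  have hvS : volume S = ENNReal.ofReal s := (ofReal_measureReal hSt).symm
  have hc' : (0 : ℝ) < c := hc
  have hμS : μ S = c * volume S := by
    rw [← Measure.restrict_apply_self, hμ, Measure.smul_apply, Measure.restrict_apply_self,
      smul_eq_mul]
  set w : ℝ := c * s with hw
  have hw0 : 0 < w := by positivity
  have hμSr : μ.real S = w := by
    rw [Measure.real, hμS, ENNReal.toReal_mul, ENNReal.coe_toReal]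
    rfl
  have hμS0 : μ S ≠ 0 := by
    rw [hμS]
    exact mul_ne_zero (by simpa using hc.ne') hS0
  have hcond : μ[|S] = volume[|S] := by
    have hc0 : (c : ℝ≥0∞) ≠ 0 := by simpa using hc.ne'
    rw [ProbabilityTheory.cond, ProbabilityTheory.cond, hμ, hμS, smul_smul,
      ENNReal.mul_inv (.inl hc0) (.inl ENNReal.coe_ne_top), mul_right_comm,
      ENNReal.inv_mul_cancel hc0 ENNReal.coe_ne_top, one_mul]
  have hw1 : w ≤ 1 := by
    rw [← hμSr]
    exact measureReal_le_one
  -- Of `n` points with law `μ` about `n * w` fall in `S`, and conditionally they are uniform there.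
  have hm : Tendsto (fun n : ℕ => ⌈(n : ℝ) * w⌉₊) atTop atTop :=
    tendsto_nat_ceil_atTop.comp (tendsto_natCast_atTop_atTop.atTop_mul_const hw0)
  have hmain := ENNReal.mul_liminf_le_liminf_add (f := atTop) (C := ENNReal.ofReal (w ^ (1 - p / d)))
    ENNReal.ofReal_ne_top hm
    (u := fun k : ℕ => ENNReal.ofReal ((k : ℝ) ^ (p / d - 1)) *
        meanCost (powCost d p) (fun _ => D) (volume[|S]) k k)
    (v := regionCost p (powCost d p) (fun _ => D) μ S)
    (w := fun n : ℕ => ENNReal.ofReal ((n : ℝ) ^ (p / d - 1)) *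
      (D * ENNReal.ofReal (2 * (√n + 2)))) ?_
    (tendsto_scaled_sqrt hpd hDt).limsup_eq.le
  · rw [add_zero] at hmain
    refine le_trans ?_ ((mul_le_mul_right hlim _).trans hmain)
    rw [mul_left_comm (ENNReal.ofReal _) β, hvS, ENNReal.ofReal_rpow_of_pos hs0, ← ENNReal.ofReal_mul (by positivity),
      ← ENNReal.ofReal_coe_nnreal, ENNReal.ofReal_rpow_of_pos hc',
      ← ENNReal.ofReal_mul (by positivity)]
    refine mul_le_mul_right (ENNReal.ofReal_le_ofReal (le_of_eq ?_)) _
    rw [hw, Real.mul_rpow hc'.le hs0.le, mul_assoc, ← Real.rpow_add hs0]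
    simp
  · filter_upwards [eventually_gt_atTop 0] with n hn
    have hn' : (0 : ℝ) < n := by exact_mod_cast hn
    set k := ⌈(n : ℝ) * w⌉₊ with hk
    have h1 : (n : ℝ) * w ≤ k := Nat.le_ceil _
    have h2 : (k : ℝ) ≤ n * w + 1 := (Nat.ceil_lt_add_one (by positivity)).le
    rw [regionCost, ← mul_assoc, ← ENNReal.ofReal_mul (by positivity), ← mul_add]
    have h3 : w ^ (1 - p / d) * (k : ℝ) ^ (p / d - 1) ≤ (n : ℝ) ^ (p / d - 1) := by
      have h4 : (k : ℝ) ^ (p / d - 1) ≤ ((n : ℝ) * w) ^ (p / d - 1) :=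
        Real.rpow_le_rpow_of_nonpos (by positivity) h1 (by linarith)
      calc w ^ (1 - p / d) * (k : ℝ) ^ (p / d - 1) ≤
            w ^ (1 - p / d) * ((n : ℝ) * w) ^ (p / d - 1) := by gcongr
        _ = (n : ℝ) ^ (p / d - 1) * (w ^ (1 - p / d) * w ^ (p / d - 1)) := by
            rw [Real.mul_rpow hn'.le hw0.le]
            ring
        _ = _ := by
            rw [← Real.rpow_add hw0]
            simp
    gcongr
    rw [← hcond]
    refine (meanCost_le_lintegral_locCost (measurable_powCost p) n k μ hS hμS0 D).trans ?_
    rw [hμSr]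
    refine add_le_add_right (mul_le_mul_right (ENNReal.ofReal_le_ofReal ?_) _) _
    have h4 : √((n : ℝ) * w) ≤ √n := by
      refine Real.sqrt_le_sqrt ?_
      exact mul_le_of_le_one_right hn'.le hw1
    have h5 : |(n : ℝ) * w - k| ≤ 1 := by
      rw [abs_le]
      constructor <;> linarith
    linarith

end UniformLower

/-! ### Truncated costs. -/

section Truncated

variable {d : ℕ} {p : ℝ} {μ : Measure (EuclideanSpace ℝ (Fin d))} [IsProbabilityMeasure μ]

theorem truncCost_le_powCost (D : ℝ≥0∞) (x y : EuclideanSpace ℝ (Fin d)) :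
    truncCost d p D x y ≤ powCost d p x y := min_le_left _ _

/-- The triangle inequality along `x, y', x', y`, together with subadditivity of the power `p ≤ 1`.
If a term on the right reaches `D` there is nothing to prove. -/
theorem truncCost_triangle (hp : 0 ≤ p) (hp1 : p ≤ 1) (D : ℝ≥0∞)
    (x y x' y' : EuclideanSpace ℝ (Fin d)) :
    truncCost d p D x y ≤ truncCost d p D x y' + truncCost d p D x' y' + truncCost d p D x' y := by
  have h : powCost d p x y ≤ powCost d p x y' + powCost d p x' y' + powCost d p x' y := by
    simp only [powCost]
    calc edist x y ^ p ≤ (edist x y' + edist x' y' + edist x' y) ^ p := by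
          gcongr
          rw [edist_comm x' y']
          exact edist_triangle4 _ _ _ _
      _ ≤ (edist x y' + edist x' y') ^ p + edist x' y ^ p :=
          ENNReal.rpow_add_le_add_rpow _ _ hp hp1
      _ ≤ _ := by
          gcongr
          exact ENNReal.rpow_add_le_add_rpow _ _ hp hp1
  simp only [truncCost]
  rcases le_total D (powCost d p x y') with h1 | h1
  · rw [min_eq_right h1]
    exact (min_le_right _ _).trans (le_self_add.trans le_self_add)
  rcases le_total D (powCost d p x' y') with h2 | h2
  · rw [min_eq_right h2]
    exact (min_le_right _ _).trans (le_add_self.trans le_self_add)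
  rcases le_total D (powCost d p x' y) with h3 | h3
  · rw [min_eq_right h3]
    exact (min_le_right _ _).trans le_add_self
  rw [min_eq_left h1, min_eq_left h2, min_eq_left h3]
  exact (min_le_left _ _).trans h

-- With `iInf_le_locCost_normPenalty` this encloses the perfect matching cost: truncation with a
-- constant penalty lies below it, norm penalties lie above it.
omit [IsProbabilityMeasure μ] in
theorem locCost_truncCost_le_iInf (D : ℝ≥0∞) {n : ℕ}
    (z : Fin n ⊕ Fin n → EuclideanSpace ℝ (Fin d)) :
    locCost (truncCost d p D) (fun _ => D) Set.univ z ≤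
      ⨅ σ : Equiv.Perm (Fin n), ∑ i, powCost d p (z (Sum.inl i)) (z (Sum.inr (σ i))) := by
  refine le_iInf fun σ => ?_
  rw [locCost, idxIn_univ, idxIn_univ]
  refine (pmCost_univ_le_perm σ).trans ?_
  gcongr
  exact truncCost_le_powCost _ _ _

theorem iInf_le_locCost_normPenalty (hp : 0 ≤ p) {n : ℕ}
    (z : Fin n ⊕ Fin n → EuclideanSpace ℝ (Fin d)) :
    ⨅ σ : Equiv.Perm (Fin n), ∑ i, powCost d p (z (Sum.inl i)) (z (Sum.inr (σ i))) ≤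
      locCost (powCost d p) (normPenalty d p) Set.univ z := by
  rw [locCost, idxIn_univ, idxIn_univ]
  exact exists_perm_le_pmCost fun i j => powCost_le_normPenalty_add hp _ _

theorem limsup_regionCost_trunc_le (hp : 0 < p) (hpd : 2 * p < d) {β : ℝ≥0∞} (hβ' : β ≠ ∞)
    (hβ : Tendsto (fun n : ℕ => ENNReal.ofReal ((n : ℝ) ^ (p / d - 1)) * cubeCost d p n) atTop
      (𝓝 β)) {α : ℝ} (hα0 : 0 ≤ α) (hα : p < α * (1 - p / d))
    (hμ : ∫⁻ x, ENNReal.ofReal (‖x‖ ^ α) ∂μ ≠ ∞) (D : ℕ → ℝ≥0∞) :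
    limsup (fun n => regionCost p (truncCost d p (D n)) (fun _ => D n) μ Set.univ n) atTop ≤
      β * densityPowerIntegral p μ := by
  have h := limsup_regionCost_le hp hpd hβ' hβ hα0 hα hμ .univ
  rw [setLIntegral_univ] at h
  refine le_trans (limsup_le_limsup (.of_forall fun n => ?_)) h
  simp only [regionCost]
  gcongr with z
  exact (locCost_truncCost_le_iInf _ z).trans (iInf_le_locCost_normPenalty hp.le z)

theorem le_liminf_regionCost_trunc (hp : 0 < p) (hpd : 2 * p < d) {D : ℕ → ℝ≥0∞}
    (hD : Tendsto D atTop (𝓝 ∞)) :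
    ENNReal.ofReal (Real.exp (-(volume.real (Metric.ball (0 : EuclideanSpace ℝ (Fin d)) 1)))) *
      densityPowerIntegral p μ ≤
      liminf (fun n => regionCost p (truncCost d p (D n)) (fun _ => D n) μ Set.univ n) atTop := by
  refine (le_liminf_regionCost hp hpd μ).trans (liminf_le_liminf ?_)
  filter_upwards [hD.eventually (lt_mem_nhds ENNReal.one_lt_top)] with n hn
  exact regionCost_mono (fun x _ y _ => min_le_min_left _ hn.le) (fun _ _ => hn.le) n

/-- The limit constant is positive. -/
theorem exp_le_of_tendsto_cubeCost (hp : 0 < p) (hpd : 2 * p < d) {β : ℝ≥0∞}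
    (hβ : Tendsto (fun n : ℕ => ENNReal.ofReal ((n : ℝ) ^ (p / d - 1)) * cubeCost d p n) atTop
      (𝓝 β)) :
    ENNReal.ofReal (Real.exp (-(volume.real (Metric.ball (0 : EuclideanSpace ℝ (Fin d)) 1)))) ≤
      β := by
  have hd : 0 < (d : ℝ) := by linarith
  have hpd' : p / d < 1 / 2 := by rw [div_lt_div_iff₀ hd (by norm_num)]; linarith
  set U := cellIdx (d := d) 1 ⁻¹' {0} with hU
  have hUm : MeasurableSet U := measurableSet_cell 1 0
  have hU1 : volume U = 1 := by rw [hU, volume_cell one_pos]; simp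
  have hcond : volume[|U] = volume.withDensity (U.indicator 1) := by
    rw [ProbabilityTheory.cond, hU1, inv_one, one_smul, withDensity_indicator_one hUm]
  have := isProbabilityMeasure_cell (d := d) one_pos 0
  have h := le_liminf_regionCost hp hpd (volume[|U])
  have hint : densityPowerIntegral p (volume[|U]) = 1 := by
    rw [densityPowerIntegral, hcond, lintegral_congr_ae
      ((Measure.rnDeriv_withDensity volume (measurable_one.indicator hUm)).mono fun x hx => by
        rw [hx]), ← hU1, ← lintegral_indicator_one hUm]
    refine lintegral_congr fun x => ?_
    by_cases hx : x ∈ U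
    · simp [hx]
    · rw [Set.indicator_of_notMem hx, ENNReal.zero_rpow_of_pos (by linarith)]
  rw [hint, mul_one] at h
  refine h.trans ((liminf_le_liminf (.of_forall fun n => ?_)).trans hβ.liminf_eq.le)
  have hs : (1 : ℝ≥0∞) ≤ cellCost d p 1 := by
    rw [cellCost, mul_one, ENNReal.one_le_ofReal]
    refine Real.one_le_rpow ?_ hp.le
    rw [Real.one_le_sqrt]
    have : 0 < d := by exact_mod_cast hd
    exact_mod_cast this
  exact regionCost_mono (κ' := powCost d p) (a' := fun _ => cellCost d p 1)
    (fun x _ y _ => truncCost_le_powCost _ _ _) (fun _ _ => hs) n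

/-- Replacing norm penalties by the constant `D n` costs `D n` times the discrepancy in `N`, of
expected order `√n * D n`, which `hD` makes negligible. -/
theorem limsup_regionCost_trunc_null (hp : 0 < p) (hpd : 2 * p < d) {α : ℝ} (hα0 : 0 ≤ α)
    (hα : p < α * (1 - p / d)) (hμ : ∫⁻ x, ENNReal.ofReal (‖x‖ ^ α) ∂μ ≠ ∞) {D : ℕ → ℝ≥0∞}
    (hD : Tendsto (fun n : ℕ => ENNReal.ofReal ((n : ℝ) ^ (p / d - 1) * √n) * D n) atTop (𝓝 0))
    {N : Set (EuclideanSpace ℝ (Fin d))} (hN : MeasurableSet N) (hN0 : volume N = 0) :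
    limsup (fun n => regionCost p (truncCost d p (D n)) (fun _ => D n) μ N n) atTop ≤ 0 := by
  obtain ⟨β, hβ', hβ⟩ := exists_tendsto_cubeCost hp hpd
  have h1 := limsup_regionCost_le hp hpd hβ' hβ hα0 hα hμ hN
  rw [Measure.restrict_eq_zero.2 hN0, lintegral_zero_measure, mul_zero] at h1
  have h2 : Tendsto (fun n : ℕ => 2 * (ENNReal.ofReal ((n : ℝ) ^ (p / d - 1) * √n) * D n)) atTop
      (𝓝 0) := by
    have := ENNReal.Tendsto.const_mul (a := 2) hD (Or.inr (by simp))
    rwa [mul_zero] at this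
  rw [← add_zero (0 : ℝ≥0∞)]
  refine ENNReal.limsup_le_add (.of_forall fun n => ?_) h1 h2.limsup_eq.le
  calc regionCost p (truncCost d p (D n)) (fun _ => D n) μ N n
      ≤ ENNReal.ofReal ((n : ℝ) ^ (p / d - 1)) *
        ∫⁻ z : Fin n ⊕ Fin n → EuclideanSpace ℝ (Fin d),
          (locCost (powCost d p) (normPenalty d p) N z + D n * gap (numL N z) (numR N z))
          ∂(Measure.pi fun _ => μ) := by
        unfold regionCost
        gcongr with z
        refine (locCost_mono (fun _ _ _ _ => truncCost_le_powCost _ _ _) fun _ _ => le_rfl).trans ?_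
        exact locCost_le_add_gap (fun x _ y _ => powCost_le_normPenalty_add hp.le x y)
          fun _ _ => le_rfl
    _ = regionCost p (powCost d p) (normPenalty d p) μ N n + ENNReal.ofReal ((n : ℝ) ^ (p / d - 1)) *
        (D n * ∫⁻ z : Fin n ⊕ Fin n → EuclideanSpace ℝ (Fin d), gap (numL N z) (numR N z)
          ∂(Measure.pi fun _ => μ)) := by
        rw [lintegral_add_left (measurable_locCost (measurable_powCost p)
          (measurable_normPenalty d p) hN), mul_add, regionCost, lintegral_const_mul]
        exact measurable_gap hN
    _ ≤ _ := by
        refine add_le_add_right ?_ _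
        calc _ ≤ ENNReal.ofReal ((n : ℝ) ^ (p / d - 1)) *
              (D n * (2 * ENNReal.ofReal √n)) := by
              gcongr
              refine (lintegral_gap_le n μ hN).trans ?_
              gcongr
              exact mul_le_of_le_one_right (by positivity) measureReal_le_one
          _ = _ := by
              rw [ENNReal.ofReal_mul (by positivity)]
              ring

/-- Off a null set `N` carrying the singular part, `μ` is a multiple of Lebesgue measure on `A`,
where the sharp bound holds. Points in `N` are absent if `μ ≪ volume`. If `p ≤ 1`, the four-point
inequality shows that they lower the cost by at most their own negligible cost. -/
theorem le_liminf_regionCost_trunc_of_const (hp : 0 < p) (hpd : 2 * p < d) {β : ℝ≥0∞} (hβ' : β ≠ ∞)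
    (hβ : Tendsto (fun n : ℕ => ENNReal.ofReal ((n : ℝ) ^ (p / d - 1)) * cubeCost d p n) atTop
      (𝓝 β)) {α : ℝ} (hα0 : 0 ≤ α) (hα : p < α * (1 - p / d))
    (hμ : ∫⁻ x, ENNReal.ofReal (‖x‖ ^ α) ∂μ ≠ ∞) {D : ℕ → ℝ≥0∞} (hD : Tendsto D atTop (𝓝 ∞))
    (hD' : Tendsto (fun n : ℕ => ENNReal.ofReal ((n : ℝ) ^ (p / d - 1) * √n) * D n) atTop (𝓝 0))
    {S : Set (EuclideanSpace ℝ (Fin d))} (hS : NullMeasurableSet S volume)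
    (hSb : Bornology.IsBounded S) (hS0 : volume S ≠ 0) {c : ℝ≥0}
    (hf : μ.rnDeriv volume =ᵐ[volume] S.indicator fun _ => (c : ℝ≥0∞))
    (h : μ ≪ volume ∨ p ≤ 1) :
    β * densityPowerIntegral p μ ≤
      liminf (fun n => regionCost p (truncCost d p (D n)) (fun _ => D n) μ Set.univ n) atTop := by
  have hd : 0 < (d : ℝ) := by linarith
  have hpd' : p / d < 1 / 2 := by rw [div_lt_div_iff₀ hd (by norm_num)]; linarith
  -- `S` is only Lebesgue measurable, so it is replaced by a Borel subset of full measure.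
  obtain ⟨T, hTS, hT, hTae⟩ := hS.exists_measurable_subset_ae_eq
  have hf' : μ.rnDeriv volume =ᵐ[volume] T.indicator fun _ => (c : ℝ≥0∞) :=
    hf.trans (indicator_ae_eq_of_ae_eq_set hTae.symm)
  have hint : densityPowerIntegral p μ = (c : ℝ≥0∞) ^ (1 - p / d) * volume T := by
    rw [densityPowerIntegral, ← lintegral_indicator_const hT]
    refine lintegral_congr_ae (hf'.mono fun x hx => ?_)
    simp only
    rw [hx]
    by_cases hxT : x ∈ T
    · rw [Set.indicator_of_mem hxT, Set.indicator_of_mem hxT]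
    · rw [Set.indicator_of_notMem hxT, Set.indicator_of_notMem hxT,
        ENNReal.zero_rpow_of_pos (by linarith)]
  rcases eq_zero_or_pos c with rfl | hc
  · rw [hint, ENNReal.coe_zero, ENNReal.zero_rpow_of_pos (by linarith)]
    simp
  obtain ⟨N, hN, hN0, hdens⟩ := exists_null_restrict_eq_withDensity (μ := μ)
  set A := T \ N with hA
  have hAm : MeasurableSet A := hT.diff hN
  have hAT : volume A = volume T := measure_sdiff_null hN0
  have hμA : μ.restrict A = (c : ℝ≥0∞) • volume.restrict A := by
    rw [hdens A hAm Set.disjoint_sdiff_left, ← withDensity_const, ← withDensity_indicator hAm]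
    refine withDensity_congr_ae (hf'.mono fun x hx => ?_)
    by_cases hxA : x ∈ A
    · rw [Set.indicator_of_mem hxA, Set.indicator_of_mem hxA, hx, Set.indicator_of_mem hxA.1]
    · rw [Set.indicator_of_notMem hxA, Set.indicator_of_notMem hxA]
  have hout : μ (T ∪ N)ᶜ = 0 := by
    have hm : MeasurableSet (T ∪ N)ᶜ := (hT.union hN).compl
    rw [← Measure.restrict_apply_self, hdens _ hm (Set.disjoint_left.2 fun x hx hx' =>
      hx (Or.inr hx')), withDensity_apply _ hm]
    refine (lintegral_congr_ae (ae_restrict_of_ae (hf'.mono fun x hx => ?_))).trans lintegral_zero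
    by_cases hxm : x ∈ (T ∪ N)ᶜ
    · rw [Set.indicator_of_mem hxm, hx, Set.indicator_of_notMem fun h => hxm (Or.inl h)]
    · rw [Set.indicator_of_notMem hxm]
  obtain ⟨D₀, hD₀, hdiam, hlim⟩ := exists_le_liminf_regionCost_of_const hp hpd hβ' hβ hAm
    (hSb.subset (Set.sdiff_subset.trans hTS)) (by rwa [hAT, measure_congr hTae]) hc hμA
  have hlimA : β * densityPowerIntegral p μ ≤
      liminf (fun n => regionCost p (truncCost d p (D n)) (fun _ => D n) μ A n) atTop := by
    rw [hint, ← hAT]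
    refine hlim.trans (liminf_le_liminf ?_)
    filter_upwards [hD.eventually (lt_mem_nhds hD₀.lt_top)] with n hn
    exact regionCost_mono (fun x hx y hy => le_min le_rfl ((hdiam x hx y hy).trans hn.le))
      (fun _ _ => hn.le) n
  have huniv : (Set.univ : Set (EuclideanSpace ℝ (Fin d))) =ᵐ[μ] (N ∪ A : Set _) := by
    have : ∀ᵐ x ∂μ, x ∈ T ∪ N := measure_eq_zero_iff_ae_notMem.1 hout |>.mono fun x hx => by
      by_contra h
      exact hx h
    filter_upwards [this] with x hx
    refine (eq_true (?_ : x ∈ N ∪ A) : (x ∈ N ∪ A) = True).symm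
    by_cases hxN : x ∈ N
    · exact Or.inl hxN
    · exact Or.inr ⟨hx.resolve_right hxN, hxN⟩
  simp_rw [regionCost_congr_ae huniv]
  rcases h with h | h
  · have : (N ∪ A : Set (EuclideanSpace ℝ (Fin d))) =ᵐ[μ] A := by
      have hμN : ∀ᵐ x ∂μ, x ∉ N := measure_eq_zero_iff_ae_notMem.1 (h hN0)
      filter_upwards [hμN] with x hx
      exact propext (or_iff_right hx)
    simp_rw [regionCost_congr_ae this]
    exact hlimA
  · have h0 := limsup_regionCost_trunc_null hp hpd hα0 hα hμ hD' hN hN0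
    have hmain := ENNReal.mul_liminf_le_liminf_add (f := atTop) (m := id) ENNReal.one_ne_top
      tendsto_id (u := fun n => regionCost p (truncCost d p (D n)) (fun _ => D n) μ A n)
      (v := fun n => regionCost p (truncCost d p (D n)) (fun _ => D n) μ (N ∪ A) n)
      (w := fun n => regionCost p (truncCost d p (D n)) (fun _ => D n) μ N n)
      (.of_forall fun n => ?_) h0
    · rw [one_mul, add_zero] at hmain
      exact hlimA.trans hmain
    · simp only [regionCost, one_mul, id]
      rw [← mul_add, ← lintegral_add_right _ (measurable_locCost (measurable_truncCost p (D n))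
        measurable_const hN)]
      gcongr with z
      exact locCost_le_add_of_triangle Set.disjoint_sdiff_left fun _ _ _ _ =>
        truncCost_triangle hp.le h _ _ _ _ _

end Truncated

/-! ### Concentration and almost sure comparison with the mean. -/

section AlmostSure

variable {d : ℕ} {p : ℝ}

/-- The substitution `x = n ^ s` in `x ^ (2 / s) * exp (-x / 4) → 0` compares the terms with `1 / n
^ 2`. -/
theorem summable_exp_neg_rpow {s : ℝ} (hs : 0 < s) :
    Summable fun n : ℕ => 2 * Real.exp (-((n : ℝ) ^ s / 4)) := by
  have h1 : Tendsto (fun n : ℕ => ((n : ℝ) ^ s) ^ (2 / s) * Real.exp (-(1 / 4) * (n : ℝ) ^ s))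
      atTop (𝓝 0) :=
    (tendsto_rpow_mul_exp_neg_mul_atTop_nhds_zero (2 / s) (1 / 4) (by norm_num)).comp
      ((tendsto_rpow_atTop hs).comp tendsto_natCast_atTop_atTop)
  refine Summable.mul_left 2 ?_
  refine summable_of_isBigO_nat (g := fun n : ℕ => 1 / (n : ℝ) ^ 2)
    (Real.summable_one_div_nat_pow.2 one_lt_two) ?_
  refine Asymptotics.IsBigO.of_bound 1 ?_
  filter_upwards [eventually_gt_atTop 0, h1.eventually (ge_mem_nhds one_pos)] with n hn h
  have hn' : (0 : ℝ) < n := by exact_mod_cast hn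
  rw [← Real.rpow_mul hn'.le, mul_div_cancel₀ _ hs.ne', Real.rpow_ofNat] at h
  rw [Real.norm_eq_abs, Real.abs_exp, Real.norm_eq_abs, abs_of_pos (by positivity), one_mul,
    le_div_iff₀ (by positivity), mul_comm]
  refine le_trans (le_of_eq ?_) h
  congr 2
  ring

/-- The cost of an optimal matching of two samples of size `n`, for the cost truncated
at `n ^ q`. -/
noncomputable def truncTotal (d : ℕ) (p q : ℝ) (n : ℕ)
    (z : Fin n ⊕ Fin n → EuclideanSpace ℝ (Fin d)) : ℝ≥0∞ :=
  locCost (truncCost d p (ENNReal.ofReal ((n : ℝ) ^ q))) (fun _ => ENNReal.ofReal ((n : ℝ) ^ q))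
    Set.univ z

theorem measurable_truncTotal (p q : ℝ) (n : ℕ) : Measurable (truncTotal d p q n) :=
  measurable_locCost (measurable_truncCost p _) measurable_const .univ

theorem truncTotal_le (p q : ℝ) (n : ℕ) (z : Fin n ⊕ Fin n → EuclideanSpace ℝ (Fin d)) :
    truncTotal d p q n z ≤ ENNReal.ofReal ((n : ℝ) ^ q) * (n + n) := by
  refine locCost_le_card.trans (le_of_eq ?_)
  simp [numL, numR]

theorem truncTotal_ne_top (p q : ℝ) (n : ℕ) (z : Fin n ⊕ Fin n → EuclideanSpace ℝ (Fin d)) :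
    truncTotal d p q n z ≠ ∞ :=
  ((truncTotal_le p q n z).trans_lt (ENNReal.mul_lt_top ENNReal.ofReal_lt_top (by simp))).ne

/-- McDiarmid with `2n` coordinates and differences `2 * n ^ q`. The relation `hγ` is what turns the
exponent into `n ^ (2 * γ) / 4`. -/
theorem measure_deviation_le (μ : Measure (EuclideanSpace ℝ (Fin d))) [IsProbabilityMeasure μ]
    {q γ : ℝ} (hγ : 2 * γ = 1 / 2 - p / d - q) {n : ℕ} (hn : 0 < n) :
    (Measure.pi fun _ : Fin n ⊕ Fin n => μ) {z | (n : ℝ) ^ (1 - p / d - γ) ≤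
      |(truncTotal d p q n z).toReal -
        ∫ z, (truncTotal d p q n z).toReal ∂(Measure.pi fun _ => μ)|} ≤
      ENNReal.ofReal (2 * Real.exp (-((n : ℝ) ^ (2 * γ) / 4))) := by
  have hn' : (0 : ℝ) < n := by exact_mod_cast hn
  refine (measure_abs_sub_integral_ge_le (measurable_truncTotal p q n).ennreal_toReal
    (B := ((n : ℝ) ^ q) * (n + n)) (C := 2 * (n : ℝ) ^ q) (fun _ => ENNReal.toReal_nonneg)
    (fun z => ?_) (by positivity) (fun z i x => ?_)
    (show 0 ≤ (n : ℝ) ^ (1 - p / d - γ) by positivity)).trans (le_of_eq ?_)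
  · refine ENNReal.toReal_le_of_le_ofReal (by positivity) ((truncTotal_le p q n z).trans ?_)
    rw [ENNReal.ofReal_mul (by positivity), ENNReal.ofReal_add hn'.le hn'.le,
      ENNReal.ofReal_natCast]
  · refine ENNReal.toReal_le_of_le_ofReal (by positivity) ?_
    rw [ENNReal.ofReal_add ENNReal.toReal_nonneg (by positivity),
      ENNReal.ofReal_toReal (truncTotal_ne_top p q n _), ENNReal.ofReal_mul (by norm_num),
      ENNReal.ofReal_ofNat]
    exact locCost_le_update i x
  · congr 4
    simp only [Fintype.card_sum, Fintype.card_fin]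
    have e : (n : ℝ) ^ (2 * γ) = ((n : ℝ) ^ (1 - p / d - γ)) ^ 2 / (n * ((n : ℝ) ^ q) ^ 2) := by
      have e1 : (n : ℝ) * ((n : ℝ) ^ q) ^ 2 = (n : ℝ) ^ (1 + q * 2) := by
        rw [Real.rpow_add hn', Real.rpow_one, Real.rpow_mul hn'.le, Real.rpow_ofNat]
      rw [e1, eq_div_iff (by positivity), ← Real.rpow_natCast, ← Real.rpow_mul hn'.le,
        ← Real.rpow_add hn']
      congr 1
      push_cast
      linarith
    rw [e]
    push_cast
    have : (0 : ℝ) < (n : ℝ) ^ q := by positivity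
    field_simp
    ring

variable {Ω : Type*} [MeasurableSpace Ω] {P : Measure Ω} [IsProbabilityMeasure P]
  {μ : Measure (EuclideanSpace ℝ (Fin d))} [IsProbabilityMeasure μ]
  {X Y : ℕ → Ω → EuclideanSpace ℝ (Fin d)}

/-- The first `n` points of both samples. -/
def samplePair (X Y : ℕ → Ω → EuclideanSpace ℝ (Fin d)) (n : ℕ) (ω : Ω) :
    Fin n ⊕ Fin n → EuclideanSpace ℝ (Fin d) :=
  fun i => Sum.elim X Y (Sum.map Fin.val Fin.val i) ω

omit [IsProbabilityMeasure P] [IsProbabilityMeasure μ] in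
theorem aemeasurable_samplePair (hX : ∀ i, HasLaw (X i) μ P) (hY : ∀ j, HasLaw (Y j) μ P)
    (n : ℕ) : AEMeasurable (samplePair X Y n) P := by
  refine aemeasurable_pi_lambda _ fun i => ?_
  rcases i with i | i
  · exact (hX i).aemeasurable
  · exact (hY i).aemeasurable

omit [IsProbabilityMeasure μ] in
theorem map_samplePair (hX : ∀ i, HasLaw (X i) μ P) (hY : ∀ j, HasLaw (Y j) μ P)
    (h : iIndepFun (Sum.elim X Y) P) (n : ℕ) :
    P.map (samplePair X Y n) = Measure.pi fun _ => μ := by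
  have hinj : (Sum.map Fin.val Fin.val : Fin n ⊕ Fin n → ℕ ⊕ ℕ).Injective :=
    Sum.map_injective.2 ⟨Fin.val_injective, Fin.val_injective⟩
  have h1 := h.precomp hinj
  have hm : ∀ i : Fin n ⊕ Fin n, AEMeasurable (Sum.elim X Y (Sum.map Fin.val Fin.val i)) P := by
    rintro (i | i)
    · exact (hX i).aemeasurable
    · exact (hY i).aemeasurable
  have h2 := (iIndepFun_iff_map_fun_eq_pi_map hm).1 h1
  have h3 : ∀ i : Fin n ⊕ Fin n, P.map (Sum.elim X Y (Sum.map Fin.val Fin.val i)) = μ := by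
    rintro (i | i)
    · exact (hX i).map_eq
    · exact (hY i).map_eq
  simp_rw [h3] at h2
  exact h2

/-- Concentration of the truncated cost around its mean, almost surely. -/
theorem ae_eventually_truncTotal (hX : ∀ i, HasLaw (X i) μ P) (hY : ∀ j, HasLaw (Y j) μ P)
    (h : iIndepFun (Sum.elim X Y) P) {q γ : ℝ} (hγ0 : 0 < γ) (hγ : 2 * γ = 1 / 2 - p / d - q) :
    ∀ᵐ ω ∂P, ∀ᶠ n : ℕ in atTop, |(truncTotal d p q n (samplePair X Y n ω)).toReal -
        ∫ z, (truncTotal d p q n z).toReal ∂(Measure.pi fun _ => μ)| ≤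
          (n : ℝ) ^ (1 - p / d - γ) := by
  let B : (n : ℕ) → Set (Fin n ⊕ Fin n → EuclideanSpace ℝ (Fin d)) := fun n =>
    {z | (n : ℝ) ^ (1 - p / d - γ) ≤ |(truncTotal d p q n z).toReal -
        ∫ z, (truncTotal d p q n z).toReal ∂(Measure.pi fun _ => μ)|}
  have hB : ∀ n, MeasurableSet (B n) := fun n =>
    measurableSet_le measurable_const
      (((measurable_truncTotal p q n).ennreal_toReal.sub_const _).norm)
  have hP : ∀ n, P (samplePair X Y n ⁻¹' B n) = (Measure.pi fun _ => μ) (B n) := by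
    intro n
    rw [← map_samplePair hX hY h n,
      Measure.map_apply_of_aemeasurable (aemeasurable_samplePair hX hY n) (hB n)]
  have hsum : ∑' n, P (samplePair X Y n ⁻¹' B n) ≠ ∞ := by
    have hle : ∀ n : ℕ, P (samplePair X Y n ⁻¹' B n) ≤
        ENNReal.ofReal (2 * Real.exp (-((n : ℝ) ^ (2 * γ) / 4))) := by
      intro n
      rcases Nat.eq_zero_or_pos n with rfl | hn
      -- For `n = 0` the right-hand side is `2 * exp 0`, so the bound is trivial.
      · refine prob_le_one.trans ?_
        rw [ENNReal.one_le_ofReal, Nat.cast_zero, Real.zero_rpow (by positivity)]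
        norm_num
      · rw [hP]
        exact measure_deviation_le μ hγ hn
    refine ((ENNReal.tsum_le_tsum hle).trans_lt ?_).ne
    rw [← ENNReal.ofReal_tsum_of_nonneg (fun _ => by positivity)
      (summable_exp_neg_rpow (by positivity))]
    exact ENNReal.ofReal_lt_top
  filter_upwards [ae_eventually_notMem hsum] with ω hω
  filter_upwards [hω] with n hn
  have hn : ¬ samplePair X Y n ω ∈ B n := hn
  exact (not_le.1 hn).le

-- Markov's inequality gives probabilities of order `1 / n ^ 2` for the opposite event;
-- Borel–Cantelli concludes. Independence plays no role.
omit [IsProbabilityMeasure μ] in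
theorem ae_eventually_norm_rpow_le {X : ℕ → Ω → EuclideanSpace ℝ (Fin d)}
    (hX : ∀ i, HasLaw (X i) μ P) {α : ℝ} (hμ : ∫⁻ x, ENNReal.ofReal (‖x‖ ^ α) ∂μ ≠ ∞) :
    ∀ᵐ ω ∂P, ∀ᶠ n : ℕ in atTop, ‖X n ω‖ ^ α ≤ (n : ℝ) ^ 2 := by
  have hm : Measurable fun x : EuclideanSpace ℝ (Fin d) => ‖x‖ ^ α := measurable_norm.pow_const α
  let B : ℕ → Set (EuclideanSpace ℝ (Fin d)) := fun n => {x | (n : ℝ) ^ 2 < ‖x‖ ^ α}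
  have hB : ∀ n, MeasurableSet (B n) := fun n => measurableSet_lt measurable_const hm
  have hsum : ∑' n, P (X n ⁻¹' B n) ≠ ∞ := by
    have hle : ∀ n : ℕ, P (X n ⁻¹' B n) ≤ (if n = 0 then 1 else 0) +
        (∫⁻ x, ENNReal.ofReal (‖x‖ ^ α) ∂μ) * ENNReal.ofReal (1 / (n : ℝ) ^ 2) := by
      intro n
      rcases Nat.eq_zero_or_pos n with rfl | hn
      · exact prob_le_one.trans (by simp)
      · have hn' : (0 : ℝ) < n := by exact_mod_cast hn
        rw [← Measure.map_apply_of_aemeasurable (hX n).aemeasurable (hB n), (hX n).map_eq]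
        refine le_trans ?_ le_add_self
        rw [one_div, ENNReal.ofReal_inv_of_pos (by positivity), ← div_eq_mul_inv,
          ENNReal.le_div_iff_mul_le (.inl (by simpa using hn.ne')) (.inl ENNReal.ofReal_ne_top),
          mul_comm]
        refine le_trans ?_
          (mul_meas_ge_le_lintegral hm.ennreal_ofReal (ENNReal.ofReal ((n : ℝ) ^ 2)))
        gcongr
        intro x hx
        exact ENNReal.ofReal_le_ofReal (le_of_lt hx)
    refine ((ENNReal.tsum_le_tsum hle).trans_lt ?_).ne
    rw [ENNReal.tsum_add, tsum_ite_eq, ENNReal.tsum_mul_left,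
      ← ENNReal.ofReal_tsum_of_nonneg (fun _ => by positivity)
        (Real.summable_one_div_nat_pow.2 one_lt_two)]
    exact ENNReal.add_lt_top.2 ⟨by simp, ENNReal.mul_lt_top hμ.lt_top ENNReal.ofReal_lt_top⟩
  filter_upwards [ae_eventually_notMem hsum] with ω hω
  filter_upwards [hω] with n hn
  have hn : ¬ X n ω ∈ B n := hn
  exact not_lt.1 hn

/-- The truncation level exceeds the penalties of all points, eventually. -/
theorem eventually_forall_lt_le {x : ℕ → EuclideanSpace ℝ (Fin d)} {α q : ℝ} (hp : 0 < p)
    (hα : 0 < α) (hq : 2 * p / α < q) (h : ∀ᶠ n : ℕ in atTop, ‖x n‖ ^ α ≤ (n : ℝ) ^ 2) :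
    ∀ᶠ n : ℕ in atTop, ∀ i < n, (2 * ‖x i‖) ^ p ≤ (n : ℝ) ^ q := by
  have hs : 0 < 2 * p / α := by positivity
  obtain ⟨N, hN⟩ := eventually_atTop.1 h
  have hqt : Tendsto (fun n : ℕ => (n : ℝ) ^ q) atTop atTop :=
    (tendsto_rpow_atTop (hs.trans hq)).comp tendsto_natCast_atTop_atTop
  -- The finitely many points before the growth bound sets in are eventually below `n ^ q`, which
  -- tends to infinity.
  have h1 : ∀ᶠ n : ℕ in atTop, ∀ i ∈ Finset.range N, (2 * ‖x i‖) ^ p ≤ (n : ℝ) ^ q :=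
    (Finset.eventually_all _).2 fun i _ => hqt.eventually_ge_atTop _
  have h2 : Tendsto (fun n : ℕ => (n : ℝ) ^ (q - 2 * p / α)) atTop atTop :=
    (tendsto_rpow_atTop (sub_pos.2 hq)).comp tendsto_natCast_atTop_atTop
  filter_upwards [h1, h2.eventually_ge_atTop (2 ^ p), eventually_gt_atTop 0] with n hn1 hn2 hn i hi
  have hn' : (0 : ℝ) < n := by exact_mod_cast hn
  rcases lt_or_ge i N with hiN | hiN
  · exact hn1 i (Finset.mem_range.2 hiN)
  · have h3 := hN i hiN
    have h4 : ‖x i‖ ^ p ≤ (n : ℝ) ^ (2 * p / α) := by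
      calc ‖x i‖ ^ p = (‖x i‖ ^ α) ^ (p / α) := by
            rw [← Real.rpow_mul (norm_nonneg _), mul_div_cancel₀ _ hα.ne']
        _ ≤ ((n : ℝ) ^ 2) ^ (p / α) := by
            refine Real.rpow_le_rpow (by positivity) (h3.trans ?_) (by positivity)
            gcongr
        _ = _ := by
            rw [← Real.rpow_natCast, ← Real.rpow_mul hn'.le]
            congr 1
            push_cast
            ring
    calc (2 * ‖x i‖) ^ p = 2 ^ p * ‖x i‖ ^ p := Real.mul_rpow (by norm_num) (norm_nonneg _)
      _ ≤ (n : ℝ) ^ (q - 2 * p / α) * (n : ℝ) ^ (2 * p / α) := by gcongr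
      _ = _ := by
          rw [← Real.rpow_add hn', sub_add_cancel]

-- When `(2‖x‖)^p ≤ n ^ q` for all sample points, every pair costs at most `n ^ q`. Truncation then
-- changes nothing, and an optimal partial matching may be taken perfect.
omit [MeasurableSpace Ω] in
theorem scaledMatchingCost_eq (hp : 0 < p) {q : ℝ} {n : ℕ} {ω : Ω}
    (hX : ∀ i < n, (2 * ‖X i ω‖) ^ p ≤ (n : ℝ) ^ q)
    (hY : ∀ i < n, (2 * ‖Y i ω‖) ^ p ≤ (n : ℝ) ^ q) :
    scaledMatchingCost p (fun i => X i ω) (fun j => Y j ω) n =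
      ENNReal.ofReal ((n : ℝ) ^ (p / d - 1)) * truncTotal d p q n (samplePair X Y n ω) := by
  rw [scaledMatchingCost, ENNReal.ofReal_mul (by positivity), ofReal_matchingCost hp.le]
  congr 1
  set D := ENNReal.ofReal ((n : ℝ) ^ q) with hD
  set z := samplePair X Y n ω with hz
  have hle : ∀ i j : Fin n, powCost d p (z (Sum.inl i)) (z (Sum.inr j)) ≤ D := by
    intro i j
    rw [powCost, edist_dist, ENNReal.ofReal_rpow_of_nonneg dist_nonneg hp.le]
    refine ENNReal.ofReal_le_ofReal ?_
    change dist (X i ω) (Y j ω) ^ p ≤ _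
    have h1 := dist_le_norm_add_norm (X i ω) (Y j ω)
    rcases le_total ‖X i ω‖ ‖Y j ω‖ with h | h
    · exact (Real.rpow_le_rpow dist_nonneg (by linarith) hp.le).trans (hY j j.2)
    · exact (Real.rpow_le_rpow dist_nonneg (by linarith) hp.le).trans (hX i i.2)
  refine le_antisymm ?_ (locCost_truncCost_le_iInf D z)
  have h2 : ∀ i j : Fin n, truncCost d p D (z (Sum.inl i)) (z (Sum.inr j)) =
      powCost d p (z (Sum.inl i)) (z (Sum.inr j)) := fun i j => min_eq_left (hle i j)
  calc _ = ⨅ σ : Equiv.Perm (Fin n), ∑ i,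
        truncCost d p D (z (Sum.inl i)) (z (Sum.inr (σ i))) := by
        simp only [h2]
        rfl
    _ ≤ _ := by
        rw [truncTotal, locCost, idxIn_univ, idxIn_univ]
        exact exists_perm_le_pmCost fun i j => (min_le_right _ _).trans le_self_add

/-- Almost surely, the scaled matching cost is asymptotically equal to the mean of the truncated
cost. -/
theorem ae_eventually_scaledMatchingCost (hp : 0 < p) {α q γ : ℝ} (hα : 0 < α)
    (hq : 2 * p / α < q) (hγ0 : 0 < γ) (hγ : 2 * γ = 1 / 2 - p / d - q)
    (hμ : ∫⁻ x, ENNReal.ofReal (‖x‖ ^ α) ∂μ ≠ ∞)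
    (hX : ∀ i, HasLaw (X i) μ P) (hY : ∀ j, HasLaw (Y j) μ P) (h : iIndepFun (Sum.elim X Y) P) :
    ∀ᵐ ω ∂P, ∀ᶠ n : ℕ in atTop,
      scaledMatchingCost p (fun i => X i ω) (fun j => Y j ω) n ≤
        regionCost p (truncCost d p (ENNReal.ofReal ((n : ℝ) ^ q)))
          (fun _ => ENNReal.ofReal ((n : ℝ) ^ q)) μ Set.univ n + ENNReal.ofReal ((n : ℝ) ^ (-γ)) ∧
      regionCost p (truncCost d p (ENNReal.ofReal ((n : ℝ) ^ q)))
          (fun _ => ENNReal.ofReal ((n : ℝ) ^ q)) μ Set.univ n ≤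
        scaledMatchingCost p (fun i => X i ω) (fun j => Y j ω) n +
          ENNReal.ofReal ((n : ℝ) ^ (-γ)) := by
  filter_upwards [ae_eventually_truncTotal hX hY h hγ0 hγ, ae_eventually_norm_rpow_le hX hμ,
    ae_eventually_norm_rpow_le hY hμ] with ω h1 h2 h3
  filter_upwards [h1, eventually_forall_lt_le hp hα hq h2, eventually_forall_lt_le hp hα hq h3,
    eventually_gt_atTop 0] with n hn1 hn2 hn3 hn
  have hn' : (0 : ℝ) < n := by exact_mod_cast hn
  rw [scaledMatchingCost_eq hp hn2 hn3]
  set F := truncTotal d p q n (samplePair X Y n ω) with hF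
  have hFt : F ≠ ∞ := truncTotal_ne_top p q n _
  set m := ∫⁻ z, truncTotal d p q n z ∂(Measure.pi fun _ => μ) with hm
  have hmt : m ≠ ∞ := by
    refine ((lintegral_mono fun z => truncTotal_le p q n z).trans_lt ?_).ne
    rw [lintegral_const, measure_univ, mul_one]
    exact ENNReal.mul_lt_top ENNReal.ofReal_lt_top (by simp)
  have hmi : ∫ z, (truncTotal d p q n z).toReal ∂(Measure.pi fun _ => μ) = m.toReal :=
    integral_toReal (measurable_truncTotal p q n).aemeasurable
      (.of_forall fun z => (truncTotal_ne_top p q n z).lt_top)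
  rw [hmi, abs_le] at hn1
  have hr : regionCost p (truncCost d p (ENNReal.ofReal ((n : ℝ) ^ q)))
      (fun _ => ENNReal.ofReal ((n : ℝ) ^ q)) μ Set.univ n =
      ENNReal.ofReal ((n : ℝ) ^ (p / d - 1)) * m := rfl
  have he : ENNReal.ofReal ((n : ℝ) ^ (-γ)) = ENNReal.ofReal ((n : ℝ) ^ (p / d - 1)) *
      ENNReal.ofReal ((n : ℝ) ^ (1 - p / d - γ)) := by
    rw [← ENNReal.ofReal_mul (by positivity), ← Real.rpow_add hn']
    congr 2
    ring
  rw [hr, he, ← mul_add, ← mul_add]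
  have key : ∀ a b : ℝ≥0∞, a ≠ ∞ → b ≠ ∞ → a.toReal ≤ b.toReal + (n : ℝ) ^ (1 - p / d - γ) →
      a ≤ b + ENNReal.ofReal ((n : ℝ) ^ (1 - p / d - γ)) := by
    intro a b ha hb hab
    rw [← ENNReal.ofReal_toReal ha, ← ENNReal.ofReal_toReal hb,
      ← ENNReal.ofReal_add ENNReal.toReal_nonneg (by positivity)]
    exact ENNReal.ofReal_le_ofReal hab
  constructor
  · gcongr
    exact key _ _ hFt hmt (by linarith)
  · gcongr
    exact key _ _ hmt hFt (by linarith)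

end AlmostSure

/-! ### Exponents and the main theorem. -/

theorem rnDeriv_smul_restrict_ae_eq {d : ℕ} {S : Set (EuclideanSpace ℝ (Fin d))}
    (hS : NullMeasurableSet S volume) (c : ℝ≥0) :
    ((c : ℝ≥0∞) • (volume : Measure (EuclideanSpace ℝ (Fin d))).restrict S).rnDeriv volume
      =ᵐ[volume] S.indicator fun _ => (c : ℝ≥0∞) := by
  obtain ⟨A, -, hA, hAS⟩ := hS.exists_measurable_subset_ae_eq
  have h : (c : ℝ≥0∞) • (volume : Measure (EuclideanSpace ℝ (Fin d))).restrict S =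
      volume.withDensity (A.indicator fun _ => (c : ℝ≥0∞)) := by
    rw [withDensity_indicator hA, withDensity_const, Measure.restrict_congr_set hAS]
  rw [h]
  exact (Measure.rnDeriv_withDensity _ (measurable_const.indicator hA)).trans
    (indicator_ae_eq_of_ae_eq_set hAS)

/-- The threshold for `α` is exactly equivalent to the last inequality, which leaves room for the
truncation exponent. The middle one makes the shell series converge. -/
theorem exponent_bounds {d p α : ℝ} (hp : 0 < p) (hpd : 2 * p < d)
    (hα : 4 * d * p / (d - 2 * p) < α) :
    0 < α ∧ p < α * (1 - p / d) ∧ 2 * p / α < 1 / 2 - p / d := by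
  have hd : 0 < d := by linarith
  have h2 : 0 < d - 2 * p := by linarith
  have hα0 : 0 < α := lt_of_le_of_lt (by positivity) hα
  have h3 : 4 * d * p < α * (d - 2 * p) := (div_lt_iff₀ h2).1 hα
  have hdp : 1 / 2 - p / d = (d - 2 * p) / (2 * d) := by field_simp
  have hdp' : 1 - p / d = (d - p) / d := by field_simp
  refine ⟨hα0, ?_, ?_⟩
  · rw [hdp', ← mul_div_assoc, lt_div_iff₀ hd]
    nlinarith
  · rw [hdp, div_lt_div_iff₀ hα0 (by positivity)]
    linarith

theorem mainTheorem1 (d : ℕ) (p : ℝ) (hp : 0 < 2 * p) (hpd : 2 * p < d) :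
    ∃ β β' : ℝ, 0 < β ∧ 0 < β' ∧
      ∀ (μ : Measure (EuclideanSpace ℝ (Fin d))) [IsProbabilityMeasure μ] (α : ℝ),
        4 * d * p / (d - 2 * p) < α →
        Integrable (fun x => ‖x‖ ^ α) μ →
        densityPowerIntegral p μ < ∞ ∧
        ∀ {Ω : Type*} [MeasurableSpace Ω] (P : Measure Ω) [IsProbabilityMeasure P]
          (X Y : ℕ → Ω → EuclideanSpace ℝ (Fin d)),
          (∀ i, HasLaw (X i) μ P) → (∀ j, HasLaw (Y j) μ P) →
          iIndepFun (Sum.elim X Y) P →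
          (∀ᵐ ω ∂P,
            limsup (scaledMatchingCost p (fun i => X i ω) (fun j => Y j ω)) atTop
                ≤ ENNReal.ofReal β * densityPowerIntegral p μ ∧
            ENNReal.ofReal β' * densityPowerIntegral p μ
                ≤ liminf (scaledMatchingCost p (fun i => X i ω) (fun j => Y j ω)) atTop) ∧
          (((∃ S : Set (EuclideanSpace ℝ (Fin d)), NullMeasurableSet S volume ∧
                Bornology.IsBounded S ∧ 0 < volume S ∧
                μ = (volume S)⁻¹ • volume.restrict S) ∨
            ((((d = 1 ∨ d = 2) ∧ 0 < p ∧ p < (d : ℝ) / 2) ∨ (3 ≤ d ∧ 0 < p ∧ p ≤ 1)) ∧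
              ∃ (S : Set (EuclideanSpace ℝ (Fin d))) (c : ℝ≥0), NullMeasurableSet S volume ∧
                Bornology.IsBounded S ∧ 0 < volume S ∧
                μ.rnDeriv volume =ᵐ[volume] S.indicator (fun _ => (c : ℝ≥0∞)))) →
            ∀ᵐ ω ∂P,
              Tendsto (scaledMatchingCost p (fun i => X i ω) (fun j => Y j ω)) atTop
                (𝓝 (ENNReal.ofReal β * densityPowerIntegral p μ))) := by
  have hp0 : 0 < p := by linarith
  obtain ⟨β, hβ', hβ⟩ := exists_tendsto_cubeCost hp0 hpd
  have hβexp := exp_le_of_tendsto_cubeCost hp0 hpd hβ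
  have hβ0 : 0 < β := lt_of_lt_of_le (ENNReal.ofReal_pos.2 (Real.exp_pos _)) hβexp
  refine ⟨β.toReal, Real.exp (-(volume.real (Metric.ball (0 : EuclideanSpace ℝ (Fin d)) 1))),
    ENNReal.toReal_pos hβ0.ne' hβ', Real.exp_pos _, ?_⟩
  rw [ENNReal.ofReal_toReal hβ']
  intro μ _ α hα hint
  obtain ⟨hα0, hα1, hα2⟩ := exponent_bounds hp0 hpd hα
  have hμ : ∫⁻ x, ENNReal.ofReal (‖x‖ ^ α) ∂μ ≠ ∞ := hint.lintegral_lt_top.ne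
  refine ⟨densityPowerIntegral_lt_top hp0 hpd hα0.le hα1 hμ, ?_⟩
  intro Ω _ P _ X Y hX hY h
  -- Above `2 * p / α` the truncation at `n ^ q` is eventually inactive; below `1 / 2 - p / d` the
  -- truncated cost concentrates, with positive `γ`.
  obtain ⟨q, hq1, hq2⟩ := exists_between hα2
  have hq0 : 0 < q := lt_trans (by positivity) hq1
  obtain ⟨γ, hγ0, hγ⟩ : ∃ γ : ℝ, 0 < γ ∧ 2 * γ = 1 / 2 - p / d - q :=
    ⟨(1 / 2 - p / d - q) / 2, by linarith, by ring⟩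
  let D : ℕ → ℝ≥0∞ := fun n => ENNReal.ofReal ((n : ℝ) ^ q)
  let R : ℕ → ℝ≥0∞ := fun n => regionCost p (truncCost d p (D n)) (fun _ => D n) μ Set.univ n
  have hD : Tendsto D atTop (𝓝 ∞) :=
    ENNReal.tendsto_ofReal_nhds_top.2
      ((tendsto_rpow_atTop hq0).comp tendsto_natCast_atTop_atTop)
  have hpow : ∀ s : ℝ, 0 < s →
      Tendsto (fun n : ℕ => ENNReal.ofReal ((n : ℝ) ^ (-s))) atTop (𝓝 0) := by
    intro s hs
    simpa using ENNReal.tendsto_ofReal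
      ((tendsto_rpow_neg_atTop hs).comp tendsto_natCast_atTop_atTop)
  have herr := (hpow γ hγ0).limsup_eq.le
  have hev := ae_eventually_scaledMatchingCost hp0 hα0 hq1 hγ0 hγ hμ hX hY h
  have hup : ∀ᵐ ω ∂P, limsup (scaledMatchingCost p (fun i => X i ω) (fun j => Y j ω)) atTop ≤
      β * densityPowerIntegral p μ := by
    filter_upwards [hev] with ω hω
    simpa using ENNReal.limsup_le_add (hω.mono fun n hn => hn.1)
      (limsup_regionCost_trunc_le hp0 hpd hβ' hβ hα0.le hα1 hμ D) herr
  have hlow : ∀ᵐ ω ∂P, liminf R atTop ≤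
      liminf (scaledMatchingCost p (fun i => X i ω) (fun j => Y j ω)) atTop := by
    filter_upwards [hev] with ω hω
    simpa using ENNReal.mul_liminf_le_liminf_add (C := 1) (u := R) ENNReal.one_ne_top tendsto_id
      (hω.mono fun n hn => (one_mul (R n)).le.trans hn.2) herr
  constructor
  · filter_upwards [hup, hlow] with ω h1 h2
    exact ⟨h1, (le_liminf_regionCost_trunc hp0 hpd hD).trans h2⟩
  · intro hcases
    have hD' : Tendsto (fun n : ℕ => ENNReal.ofReal ((n : ℝ) ^ (p / d - 1) * √n) * D n)
        atTop (𝓝 0) := by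
      refine (hpow (1 / 2 - p / d - q) (by linarith)).congr' ?_
      filter_upwards [eventually_gt_atTop 0] with n hn
      have hn' : (0 : ℝ) < n := by exact_mod_cast hn
      rw [← ENNReal.ofReal_mul (by positivity), Real.sqrt_eq_rpow, ← Real.rpow_add hn',
        ← Real.rpow_add hn']
      congr 2
      ring
    have hR : β * densityPowerIntegral p μ ≤ liminf R atTop := by
      rcases hcases with ⟨S, hS, hSb, hS0, rfl⟩ | ⟨hdp, S, c, hS, hSb, hS0, hf⟩
      · have hc : (((volume S)⁻¹).toNNReal : ℝ≥0∞) = (volume S)⁻¹ :=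
          ENNReal.coe_toNNReal (ENNReal.inv_ne_top.2 hS0.ne')
        have hf := rnDeriv_smul_restrict_ae_eq hS ((volume S)⁻¹).toNNReal
        rw [hc] at hf
        exact le_liminf_regionCost_trunc_of_const hp0 hpd hβ' hβ hα0.le hα1 hμ hD hD' hS hSb
          hS0.ne' (c := ((volume S)⁻¹).toNNReal) (by rw [hc]; exact hf)
          (.inl ((Measure.absolutelyContinuous_of_le Measure.restrict_le_self).smul_left _))
      · refine le_liminf_regionCost_trunc_of_const hp0 hpd hβ' hβ hα0.le hα1 hμ hD hD' hS hSb
          hS0.ne' hf (.inr ?_)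
        -- In dimensions `1` and `2`, `p < d / 2` already forces `p ≤ 1`.
        rcases hdp with ⟨rfl | rfl, -, h3⟩ | ⟨-, -, h3⟩
        · norm_num at h3; linarith
        · norm_num at h3; linarith
        · exact h3
    filter_upwards [hup, hlow] with ω h1 h2
    exact tendsto_of_le_liminf_of_limsup_le (hR.trans h2) h1
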